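/- Let $\mathfrak g\supset\mathfrak b\supset\mathfrak h$ be a finite-dimensional semisimple complex Lie algebra, a Borel subalgebra and a Cartan subalgebra, let $\bar{\mathfrak b}$ be the Borel subalgebra opposite to $\mathfrak b$ with respect to $\mathfrak h$ (so $\mathfrak b\cap\bar{\mathfrak b}=\mathfrak h$), and put $\mathfrak n=[\mathfrak b,\mathfrak b]$. Let $S=S(\mathfrak h)$ be the symmetric algebra of $\mathfrak h$ and let $T$ be a commutative ring with a ring homomorphism $\varphi:S\to T$. For a $\mathfrak g$-$T$-bimodule $M$ on which the two actions of $\mathbb C$ coincide and for $\lambda\in\mathfrak h^*$, the deformed weight space is $$M^\lambda=\{m\in M\mid (H-\lambda(H))m=m\,\varphi(H)\ \text{for all } H\in\mathfrak h\}.$$ Let $\mathcal O(T)$ be the full subcategory of those bimodules that are locally finite under $\mathfrak n$ and are the sum of their deformed weight spaces. For $\lambda\in\mathfrak h^*$ let $\mathbb C_\lambda\otimes T$ be the $\mathfrak b$- (respectively $\bar{\mathfrak b}$-) module on which $\mathfrak b$ (respectively $\bar{\mathfrak b}$) acts through its canonical surjection onto $\mathfrak h$ and $H\in\mathfrak h$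 acts by multiplication by $\lambda(H)+\varphi(H)$. Let $$\Delta_T(\lambda)=U(\mathfrak g)\otimes_{U(\mathfrak b)}(\mathbb C_\lambda\otimes T)$$ and let $\nabla_T(\lambda)$ be the sum of all deformed weight spaces of $\operatorname{Hom}_{U(\bar{\mathfrak b})}(U(\mathfrak g),\mathbb C_\lambda\otimes T)$. A finite $\Delta_T$-flag (respectively $\nabla_T$-flag) of an object is a finite filtration by sub-bimodules, from $0$ to the whole object, whose successive subquotients are isomorphic to modules $\Delta_T(\lambda)$ (respectively $\nabla_T(\lambda)$) with varying $\lambda\in\mathfrak h^*$. Let $M,N\in\mathcal O(T)$, where $M$ is a direct summand of an object of $\mathcal O(T)$ with a finite $\Delta_T$-flag and $N$ is a direct summand of an object of $\mathcal O(T)$ with a finite $\nabla_T$-flag. Then $\operatorname{Hom}_{\mathcal O(T)}(M,N)$ is a finitely generated projective $T$-module. Moreover, for every homomorphism of commutative rings $T\to T'$ (with $T'$ regarded as a ring under $S$ via $S\to T\to T'$), the bimodules $M\otimes_TT'$ and $N\otimes_TT'$ belong to $\mathcal O(T')$ and the canonical map $$\operatorname{Hom}_{\mathcal O(T)}(M,N)\otimes_TT'\longrightarrow\operatorname{Hom}_{\mathcal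 O(T')}(M\otimes_TT',\,N\otimes_TT'),\qquad f\otimes t'\mapsto t'\cdot(f\otimes\operatorname{id}_{T'}),$$ is an isomorphism. -/

import Mathlib

open scoped TensorProduct

attribute [local instance 100] LieRing.ofAssociativeRing

noncomputable section

namespace DeformedO

/-! ### Borel subalgebras -/

section Borel

variable {g : Type*} [LieRing g] [LieAlgebra ℂ g]

/-- A Borel subalgebra is a maximal solvable subalgebra. -/
def IsBorel (B : LieSubalgebra ℂ g) : Prop :=
  Maximal (fun K : LieSubalgebra ℂ g => LieAlgebra.IsSolvable K) B

/-- `Bop` is the Borel subalgebra opposite to `B` with respect to the Cartan subalgebra `H`: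
the (unique) Borel subalgebra which meets `B` exactly in `H`. -/
def IsOppositeBorel (H B Bop : LieSubalgebra ℂ g) : Prop :=
  IsBorel Bop ∧ B ⊓ Bop = H

/-- The derived subalgebra `[B, B]`, as a subspace of `g`. -/
def derivedSubspace (B : LieSubalgebra ℂ g) : Submodule ℂ g :=
  Submodule.span ℂ {z | ∃ x ∈ B, ∃ y ∈ B, ⁅x, y⁆ = z}

end Borel

/-! ### Bimodules

A `g`-`T`-bimodule on which the two actions of `ℂ` coincide is a `T`-module `M` (`T` is
commutative, so we write the `T`-action on the left) together with a homomorphism of complex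
Lie algebras `ρ : g →ₗ⁅ℂ⁆ Module.End T M`. The ring `T` lies under `S = S(H)` by means of
`φ : SymmetricAlgebra ℂ H →ₐ[ℂ] T`. -/

section Bimodules

variable {g : Type*} [LieRing g] [LieAlgebra ℂ g]
variable {T : Type*} [CommRing T] [Algebra ℂ T]
variable {M : Type*} [AddCommGroup M] [Module ℂ M] [Module T M] [IsScalarTower ℂ T M]
variable {N : Type*} [AddCommGroup N] [Module ℂ N] [Module T N] [IsScalarTower ℂ T N]

/-- The `T`-module of homomorphisms of `g`-`T`-bimodules. -/
def bimodHom (ρ : g →ₗ⁅ℂ⁆ Module.End T M) (σ : g →ₗ⁅ℂ⁆ Module.End T N) :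
    Submodule T (M →ₗ[T] N) where
  carrier := {f | ∀ x m, f (ρ x m) = σ x (f m)}
  add_mem' hf hf' x m := by simp [hf x m, hf' x m]
  zero_mem' x m := by simp
  smul_mem' t f hf x m := by simp [hf x m]

/-- `M` is (isomorphic to) a direct summand of `N` as a bimodule. -/
def IsDirectSummand (ρ : g →ₗ⁅ℂ⁆ Module.End T M) (σ : g →ₗ⁅ℂ⁆ Module.End T N) : Prop :=
  ∃ i ∈ bimodHom ρ σ, ∃ p ∈ bimodHom σ ρ, p ∘ₗ i = LinearMap.id

variable {H : LieSubalgebra ℂ g}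

/-- The scalar `λ(h) + φ(h)` in `T` by which `h ∈ H` acts on `ℂ_λ ⊗ T = T`. -/
def defChar (φ : SymmetricAlgebra ℂ H →ₐ[ℂ] T) (l : Module.Dual ℂ H) (h : H) : T :=
  algebraMap ℂ T (l h) + φ (SymmetricAlgebra.ι ℂ H h)

/-- The deformed weight space `M^λ = {m | (h - λ(h)) m = m φ(h) for all h ∈ H}`. -/
def weightSpace (φ : SymmetricAlgebra ℂ H →ₐ[ℂ] T) (ρ : g →ₗ⁅ℂ⁆ Module.End T M)
    (l : Module.Dual ℂ H) : Submodule T M where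
  carrier := {m | ∀ h : H, ρ h m - l h • m = φ (SymmetricAlgebra.ι ℂ H h) • m}
  add_mem' {a b} ha hb h := by
    rw [smul_add, smul_add, ← ha h, ← hb h, map_add]; abel
  zero_mem' h := by simp
  smul_mem' t m hm h := by
    rw [map_smul, smul_comm (l h) t m, ← smul_sub, hm h, smul_comm]

/-- Membership in the deformed category `𝒪(T)`: the bimodule is locally finite under
`[B, B]`, and it is the sum of its deformed weight spaces. -/
def InO (B : LieSubalgebra ℂ g) (φ : SymmetricAlgebra ℂ H →ₐ[ℂ] T)
    (ρ : g →ₗ⁅ℂ⁆ Module.End T M) : Prop :=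
  (∀ m : M, ∃ V : Submodule ℂ M, FiniteDimensional ℂ V ∧ m ∈ V ∧
    ∀ x ∈ derivedSubspace B, ∀ v ∈ V, ρ x v ∈ V) ∧
  ⨆ l : Module.Dual ℂ H, weightSpace φ ρ l = ⊤

/-- For subspaces `F ≤ G` of `M`, with `G` stable under `g`: the subquotient `G / F` is
isomorphic to the bimodule given by `σ`. -/
def SubquotientIso (ρ : g →ₗ⁅ℂ⁆ Module.End T M) (σ : g →ₗ⁅ℂ⁆ Module.End T N)
    (F G : Submodule T M) : Prop :=
  ∃ e : (G ⧸ F.submoduleOf G) ≃ₗ[T] N, ∀ (x : g) (m : G) (hm : ρ x m ∈ G),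
    e (Submodule.Quotient.mk ⟨ρ x m, hm⟩) = σ x (e (Submodule.Quotient.mk m))

/-- The bimodule `M` has a finite flag `0 = F 0 ≤ F 1 ≤ ⋯ ≤ F n = M` by sub-bimodules whose
successive subquotients are isomorphic to members of the family `σ`. -/
def HasFiniteFlag (ρ : g →ₗ⁅ℂ⁆ Module.End T M) {I : Type*} {D : I → Type*}
    [∀ i, AddCommGroup (D i)] [∀ i, Module ℂ (D i)] [∀ i, Module T (D i)]
    [∀ i, IsScalarTower ℂ T (D i)] (σ : ∀ i, g →ₗ⁅ℂ⁆ Module.End T (D i)) : Prop :=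
  ∃ (n : ℕ) (F : Fin (n + 1) → Submodule T M) (l : Fin n → I),
    F 0 = ⊥ ∧ F (Fin.last n) = ⊤ ∧ Monotone F ∧
    (∀ k x, ∀ m ∈ F k, ρ x m ∈ F k) ∧
    ∀ k : Fin n, SubquotientIso ρ (σ (l k)) (F k.castSucc) (F k.succ)

end Bimodules

/-! ### Deformed Verma modules -/

section Verma

variable {g : Type*} [LieRing g] [LieAlgebra ℂ g]
variable {H : LieSubalgebra ℂ g} (B : LieSubalgebra ℂ g)
variable {T : Type*} [CommRing T] [Algebra ℂ T]
variable (φ : SymmetricAlgebra ℂ H →ₐ[ℂ] T) (l : Module.Dual ℂ H)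

/-- The relations `u b ⊗ t = u ⊗ b t` for `u ∈ U(g)`, `b ∈ B`, `t ∈ ℂ_λ ⊗ T = T`, which
present `U(g) ⊗_{U(B)} (ℂ_λ ⊗ T)` as a quotient of `U(g) ⊗ T` (the factor `T` is written on the
left). An element `b = h + x` of `B = H ⊕ [B, B]` acts on `ℂ_λ ⊗ T` through the canonical
surjection `B → H`, that is, by the scalar `λ(h) + φ(h)`. -/
def vermaRel : Submodule T (T ⊗[ℂ] UniversalEnvelopingAlgebra ℂ g) :=
  Submodule.span T {z | ∃ (t : T) (u : UniversalEnvelopingAlgebra ℂ g) (h : H),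
    ∃ x ∈ derivedSubspace B,
      z = t ⊗ₜ[ℂ] (u * UniversalEnvelopingAlgebra.ι ℂ ((h : g) + x)) -
        (defChar φ l h * t) ⊗ₜ[ℂ] u}

/-- The carrier of the deformed Verma module `Δ_T(λ) = U(g) ⊗_{U(B)} (ℂ_λ ⊗ T)`. -/
abbrev Verma : Type _ :=
  (T ⊗[ℂ] UniversalEnvelopingAlgebra ℂ g) ⧸ vermaRel B φ l

lemma vermaRel_le_comap (y : g) : vermaRel B φ l ≤ (vermaRel B φ l).comap
    ((LinearMap.mulLeft ℂ (UniversalEnvelopingAlgebra.ι ℂ y)).baseChange T) := by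
  refine Submodule.span_le.2 ?_
  rintro _ ⟨t, u, h, x, hx, rfl⟩
  refine Submodule.subset_span ⟨t, UniversalEnvelopingAlgebra.ι ℂ y * u, h, x, hx, ?_⟩
  rw [map_sub, LinearMap.baseChange_tmul, LinearMap.baseChange_tmul, LinearMap.mulLeft_apply,
    LinearMap.mulLeft_apply, mul_assoc]

/-- The action of `g` on `Δ_T(λ)`, by left multiplication on `U(g)`. -/
def vermaRep : g →ₗ⁅ℂ⁆ Module.End T (Verma B φ l) where
  toFun y := (vermaRel B φ l).mapQ (vermaRel B φ l)
    ((LinearMap.mulLeft ℂ (UniversalEnvelopingAlgebra.ι ℂ y)).baseChange T)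
    (vermaRel_le_comap B φ l y)
  map_add' x y := by
    refine Submodule.linearMap_qext _ (TensorProduct.AlgebraTensorModule.ext fun t u => ?_)
    simp [add_mul, TensorProduct.tmul_add]
  map_smul' c y := by
    refine Submodule.linearMap_qext _ (TensorProduct.AlgebraTensorModule.ext fun t u => ?_)
    simp
  map_lie' {x y} := by
    refine Submodule.linearMap_qext _ (TensorProduct.AlgebraTensorModule.ext fun t u => ?_)
    simp [LieRing.of_associative_ring_bracket, sub_mul, TensorProduct.tmul_sub, mul_assoc]

end Verma

/-! ### Deformed nabla modules -/

section Nabla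

variable {g : Type*} [LieRing g] [LieAlgebra ℂ g]
variable {H : LieSubalgebra ℂ g} (Bop : LieSubalgebra ℂ g)
variable {T : Type*} [CommRing T] [Algebra ℂ T]
variable (φ : SymmetricAlgebra ℂ H →ₐ[ℂ] T) (l : Module.Dual ℂ H)

/-- The coinduced module `Hom_{U(Bop)}(U(g), ℂ_λ ⊗ T)`: the `ℂ`-linear maps `f : U(g) → T` with
`f (b u) = b f(u)` for all `b = h + x` in `Bop = H ⊕ [Bop, Bop]`, where `b` acts on `ℂ_λ ⊗ T = T`
by the scalar `λ(h) + φ(h)`. -/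
def coindSub : Submodule T (UniversalEnvelopingAlgebra ℂ g →ₗ[ℂ] T) where
  carrier := {f | ∀ (h : H), ∀ x ∈ derivedSubspace Bop, ∀ u,
    f (UniversalEnvelopingAlgebra.ι ℂ ((h : g) + x) * u) = defChar φ l h * f u}
  add_mem' ha hb h x hx u := by
    rw [LinearMap.add_apply, LinearMap.add_apply, ha h x hx, hb h x hx, mul_add]
  zero_mem' h x hx u := by simp
  smul_mem' t f hf h x hx u := by
    rw [LinearMap.smul_apply, LinearMap.smul_apply, hf h x hx, smul_eq_mul, smul_eq_mul,
      mul_left_comm]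

/-- The carrier of the coinduced module. -/
def Coind : Type _ := coindSub Bop φ l

instance : AddCommGroup (Coind Bop φ l) := inferInstanceAs (AddCommGroup (coindSub Bop φ l))

instance : Module T (Coind Bop φ l) := inferInstanceAs (Module T (coindSub Bop φ l))

instance : Module ℂ (Coind Bop φ l) := inferInstanceAs (Module ℂ (coindSub Bop φ l))

instance : IsScalarTower ℂ T (Coind Bop φ l) :=
  inferInstanceAs (IsScalarTower ℂ T (coindSub Bop φ l))

/-- The action of `g` on the coinduced module: `(y f)(u) = f(u y)`. -/
def coindRep : g →ₗ⁅ℂ⁆ Module.End T (Coind Bop φ l) where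
  toFun y :=
    { toFun := fun f => ⟨f.1 ∘ₗ LinearMap.mulRight ℂ (UniversalEnvelopingAlgebra.ι ℂ y),
        fun h x hx u => by
          simpa only [LinearMap.comp_apply, LinearMap.mulRight_apply, mul_assoc] using
            f.2 h x hx (u * UniversalEnvelopingAlgebra.ι ℂ y)⟩
      map_add' := fun _ _ => rfl
      map_smul' := fun _ _ => rfl }
  map_add' x y := by
    refine LinearMap.ext fun f => Subtype.ext (LinearMap.ext fun u => ?_)
    change f.1 (u * UniversalEnvelopingAlgebra.ι ℂ (x + y)) =
      f.1 (u * UniversalEnvelopingAlgebra.ι ℂ x) + f.1 (u * UniversalEnvelopingAlgebra.ι ℂ y)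
    rw [map_add, mul_add, map_add]
  map_smul' c y := by
    refine LinearMap.ext fun f => Subtype.ext (LinearMap.ext fun u => ?_)
    change f.1 (u * UniversalEnvelopingAlgebra.ι ℂ (c • y)) =
      c • f.1 (u * UniversalEnvelopingAlgebra.ι ℂ y)
    rw [map_smul, mul_smul_comm, map_smul]
  map_lie' {x y} := by
    refine LinearMap.ext fun f => Subtype.ext (LinearMap.ext fun u => ?_)
    change f.1 (u * UniversalEnvelopingAlgebra.ι ℂ ⁅x, y⁆) =
      f.1 (u * UniversalEnvelopingAlgebra.ι ℂ x * UniversalEnvelopingAlgebra.ι ℂ y) -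
      f.1 (u * UniversalEnvelopingAlgebra.ι ℂ y * UniversalEnvelopingAlgebra.ι ℂ x)
    rw [LieHom.map_lie, LieRing.of_associative_ring_bracket, mul_sub, map_sub, mul_assoc,
      mul_assoc]

/-- The deformed nabla module `∇_T(λ)`: the sum of all deformed weight spaces of
`Hom_{U(Bop)}(U(g), ℂ_λ ⊗ T)`. -/
def nabla : Submodule T (Coind Bop φ l) :=
  ⨆ m : Module.Dual ℂ H, weightSpace φ (coindRep Bop φ l) m

variable {M : Type*} [AddCommGroup M] [Module ℂ M] [Module T M] [IsScalarTower ℂ T M]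

variable [FiniteDimensional ℂ g] [LieAlgebra.IsSemisimple ℂ g] [H.IsCartanSubalgebra]

/-- The sum of the deformed weight spaces of a bimodule is stable under `g`. -/
lemma iSup_weightSpace_stable (ρ : g →ₗ⁅ℂ⁆ Module.End T M) (y : g) :
    (⨆ m : Module.Dual ℂ H, weightSpace φ ρ m) ≤
      (⨆ m : Module.Dual ℂ H, weightSpace φ ρ m).comap (ρ y) := by
  have key : ∀ (a : LieModule.Weight ℂ H g) (y : g), y ∈ LieAlgebra.rootSpace H a →
      ∀ m v, v ∈ weightSpace φ ρ m → ρ y v ∈ weightSpace φ ρ (m + a.toLinear) := by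
    intro a y hy m v hv h
    have h1 : ⁅(h : g), y⁆ = a h • y := LieAlgebra.IsKilling.lie_eq_smul_of_mem_rootSpace hy h
    have h2 : ρ (h : g) (ρ y v) = ρ y (ρ (h : g) v) + a h • ρ y v := by
      have h3 := congrArg (fun f => f v) (ρ.map_lie (h : g) y)
      simp only [h1, LieRing.of_associative_ring_bracket, map_smul, LinearMap.smul_apply,
        LinearMap.sub_apply, Module.End.mul_apply] at h3
      rw [h3]; abel
    have h4 : ρ (h : g) v = m h • v + φ (SymmetricAlgebra.ι ℂ H h) • v := by
      rw [← hv h]; abel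
    have h5 : ρ y (m h • v) = m h • ρ y v := by
      rw [← algebraMap_smul T (m h) v, map_smul, algebraMap_smul]
    rw [h2, h4, map_add, h5, map_smul, LinearMap.add_apply, add_smul]
    simp only [LieModule.Weight.toLinear_apply]
    abel
  have hy : y ∈ ⨆ a : LieModule.Weight ℂ H g, (LieAlgebra.rootSpace H a).toSubmodule := by
    rw [← LieSubmodule.iSup_toSubmodule, LieModule.iSup_genWeightSpace_eq_top']
    trivial
  refine iSup_le fun m v hv => ?_
  rw [Submodule.mem_comap]
  induction hy using Submodule.iSup_induction' with
  | mem a y hy => exact Submodule.mem_iSup_of_mem _ (key a y hy m v hv)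
  | zero => simp
  | add y z _ _ h1 h2 =>
    rw [map_add, LinearMap.add_apply]
    exact add_mem h1 h2

lemma nabla_stable (y : g) :
    ∀ f ∈ nabla Bop φ l, coindRep Bop φ l y f ∈ nabla Bop φ l :=
  fun _ hf => iSup_weightSpace_stable φ (coindRep Bop φ l) y hf

/-- The action of `g` on `∇_T(λ)`. -/
def nablaRep : g →ₗ⁅ℂ⁆ Module.End T (nabla Bop φ l) where
  toFun y := (coindRep Bop φ l y).restrict (nabla_stable Bop φ l y)
  map_add' x y := by
    refine LinearMap.ext fun f => Subtype.ext ?_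
    simp
  map_smul' c y := by
    refine LinearMap.ext fun f => Subtype.ext ?_
    simp
  map_lie' {x y} := by
    refine LinearMap.ext fun f => Subtype.ext ?_
    simp [LieRing.of_associative_ring_bracket]

end Nabla

/-! ### Flags and base change -/

section Flags

variable {g : Type*} [LieRing g] [LieAlgebra ℂ g]
variable {H : LieSubalgebra ℂ g}
variable {T : Type*} [CommRing T] [Algebra ℂ T]
variable {M : Type*} [AddCommGroup M] [Module ℂ M] [Module T M] [IsScalarTower ℂ T M]
variable {N : Type*} [AddCommGroup N] [Module ℂ N] [Module T N] [IsScalarTower ℂ T N]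

/-- The bimodule has a finite `Δ_T`-flag. -/
def HasDeltaFlag (B : LieSubalgebra ℂ g) (φ : SymmetricAlgebra ℂ H →ₐ[ℂ] T)
    (ρ : g →ₗ⁅ℂ⁆ Module.End T M) : Prop :=
  HasFiniteFlag ρ (D := fun l => Verma B φ l) (fun l : Module.Dual ℂ H => vermaRep B φ l)

/-- The bimodule has a finite `∇_T`-flag. -/
def HasNablaFlag [FiniteDimensional ℂ g] [LieAlgebra.IsSemisimple ℂ g] [H.IsCartanSubalgebra]
    (Bop : LieSubalgebra ℂ g) (φ : SymmetricAlgebra ℂ H →ₐ[ℂ] T)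
    (ρ : g →ₗ⁅ℂ⁆ Module.End T M) : Prop :=
  HasFiniteFlag ρ (D := fun l => nabla Bop φ l) (fun l : Module.Dual ℂ H => nablaRep Bop φ l)

variable (T' : Type*) [CommRing T'] [Algebra ℂ T'] [Algebra T T'] [IsScalarTower ℂ T T']

/-- The structure map `S → T → T'`. -/
def baseChangeStr (φ : SymmetricAlgebra ℂ H →ₐ[ℂ] T) : SymmetricAlgebra ℂ H →ₐ[ℂ] T' :=
  (IsScalarTower.toAlgHom ℂ T T').comp φ

/-- The `g`-`T'`-bimodule `M ⊗_T T'` (written `T' ⊗_T M`), with `g` acting on `M`. -/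
def baseChangeRep (ρ : g →ₗ⁅ℂ⁆ Module.End T M) : g →ₗ⁅ℂ⁆ Module.End T' (T' ⊗[T] M) where
  toFun x := (ρ x).baseChange T'
  map_add' x y := by
    rw [map_add, LinearMap.baseChange_add]
  map_smul' c x := by
    refine TensorProduct.AlgebraTensorModule.ext fun t m => ?_
    simp only [map_smul, LinearMap.baseChange_tmul, LinearMap.smul_apply, RingHom.id_apply]
    rw [← algebraMap_smul T c, TensorProduct.tmul_smul, algebraMap_smul]
  map_lie' {x y} := by
    refine TensorProduct.AlgebraTensorModule.ext fun t m => ?_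
    simp [LieRing.of_associative_ring_bracket]

/-- The `T`-linear map `f ↦ f ⊗ id_{T'}` on homomorphisms of bimodules. -/
def homExtend (ρ : g →ₗ⁅ℂ⁆ Module.End T M) (σ : g →ₗ⁅ℂ⁆ Module.End T N) :
    bimodHom ρ σ →ₗ[T] bimodHom (baseChangeRep T' ρ) (baseChangeRep T' σ) where
  toFun f := ⟨f.1.baseChange T', fun x m => by
    induction m with
    | zero => simp
    | add a b ha hb => simp only [map_add, ha, hb]
    | tmul t m => simp [baseChangeRep, f.2 x m]⟩
  map_add' f f' := Subtype.ext (LinearMap.baseChange_add f.1 f'.1)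
  map_smul' t f := Subtype.ext (LinearMap.baseChange_smul t f.1)

/-- The canonical map `Hom(M, N) ⊗_T T' → Hom(M ⊗_T T', N ⊗_T T')`, given by
`f ⊗ t' ↦ t' • (f ⊗ id_{T'})`. -/
def homBaseChange (ρ : g →ₗ⁅ℂ⁆ Module.End T M) (σ : g →ₗ⁅ℂ⁆ Module.End T N) :
    T' ⊗[T] bimodHom ρ σ →ₗ[T'] bimodHom (baseChangeRep T' ρ) (baseChangeRep T' σ) :=
  (homExtend T' ρ σ).liftBaseChange T'

end Flags

end DeformedO

end

/-! The two kinds of flags are orthogonal over every base ring: Hom from `Δ_T(λ)` to `∇_T(μ)` is `T`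
if `λ = μ` and zero otherwise, and extensions of the first by the second split. Suppose `P` has a
Δ-flag with highest weights `l i` and `Q` a ∇-flag with weights `ν k`. Then Hom(P, Q) is free on the
pairs `(k, i)` with `l i = ν k`. This index set does not involve `T`, so scalar extension carries a
basis to a basis. A Hom between direct summands is a retract of Hom(P, Q), compatibly with scalar
extension, which gives projectivity and the base change isomorphism (`bimodHom_of_flags`,
`homBaseChange_bijective_of_isDirectSummand`).

No Ext groups are formed. By `exists_basis_of_deltaFlag`, `P` is free over `T` on the ordered
monomials of `[Bop, Bop]` applied to weight vectors `m i`. Over `Bop` it therefore has the universal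
property `exists_equivariant_map`. A ∇-flag is encoded by `IsNablaFiltration`: on each step a
functional `ε k`, equivariant under `Bop`, detects the subquotient. The vanishing of extensions
becomes `exists_bimodHom_lift`, which says that every `Bop`-equivariant functional on `P` of weight
`ν k` is `ε k ∘ f` for a bimodule map `f` into `F k.succ`. The graph of `f` is cut out of `Q × P`
one filtration step at a time. At each step a `Bop`-equivariant splitting supplies a functional, and
Frobenius reciprocity (`exists_nabla_of_functional`) turns it into a map to a nabla module whose
kernel is the next correspondence. The criterion `exists_basis_bimodHom` uses only data that survive
scalar extension.

Two foundations are needed. Linear independence in the PBW theorem is proved for a Lie algebra with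
a faithful matrix representation, by letting it act through vector fields on matrices; a semisimple
algebra has its adjoint representation. The decomposition of `g` into `H`, `[B, B]` and `[Bop, Bop]`
comes from Borel maximality. The key fact there is that a nonempty sum of roots of a solvable
subalgebra containing their root spaces is never zero (`sum_ne_zero_of_mem_rootsIn`); it also makes
the fibres of the weight map on monomials finite. -/

noncomputable section

namespace DeformedO

/-! ### Ordered monomials -/

section Monomials

/-- The weakly increasing list which contains `i` exactly `α i` times. -/
def monList {p : ℕ} (α : Fin p → ℕ) : List (Fin p) :=
  (List.ofFn fun i => List.replicate (α i) i).flatten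

/-- The ordered monomial `y 0 ^ α 0 * ⋯ * y (p - 1) ^ α (p - 1)`. -/
def mon {p : ℕ} {A : Type*} [Monoid A] (y : Fin p → A) (α : Fin p → ℕ) : A :=
  ((monList α).map y).prod

lemma mon_eq_prod {p : ℕ} {A : Type*} [Monoid A] (y : Fin p → A) (α : Fin p → ℕ) :
    mon y α = (List.ofFn fun i => y i ^ α i).prod := by
  simp only [mon, monList, List.map_flatten, List.prod_flatten, List.map_ofFn]
  congr 2
  funext i
  simp

lemma mon_comm {p : ℕ} {A : Type*} [CommMonoid A] (y : Fin p → A) (α : Fin p → ℕ) :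
    mon y α = ∏ i, y i ^ α i := by
  rw [mon_eq_prod, List.prod_ofFn]

lemma count_monList {p : ℕ} (α : Fin p → ℕ) (i : Fin p) : (monList α).count i = α i := by
  rw [monList, List.count_flatten, List.map_ofFn, List.sum_ofFn, Finset.sum_eq_single i]
  · simp
  · intro j _ hj
    simp [List.count_replicate, hj]
  · simp

lemma length_monList {p : ℕ} (α : Fin p → ℕ) : (monList α).length = ∑ i, α i := by
  simp [monList, List.length_flatten, List.map_ofFn, List.sum_ofFn]

lemma perm_monList {p : ℕ} (L : List (Fin p)) : L.Perm (monList fun i => L.count i) := by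
  rw [List.perm_iff_count]
  intro i
  rw [count_monList]

lemma monList_eq_nil {p : ℕ} {α : Fin p → ℕ} : monList α = [] ↔ α = 0 := by
  rw [← List.length_eq_zero_iff, length_monList, Finset.sum_eq_zero_iff]
  simp [funext_iff]

@[simp] lemma mon_zero {p : ℕ} {A : Type*} [Monoid A] (y : Fin p → A) :
    mon y 0 = 1 := by
  rw [mon, monList_eq_nil.2 rfl, List.map_nil, List.prod_nil]

lemma mon_append {p q : ℕ} {A : Type*} [Monoid A] (y : Fin p → A) (z : Fin q → A)
    (α : Fin p → ℕ) (β : Fin q → ℕ) :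
    mon (Fin.append y z) (Fin.append α β) = mon y α * mon z β := by
  rw [mon_eq_prod, mon_eq_prod, mon_eq_prod, ← List.prod_append, ← List.ofFn_fin_append]
  congr 2
  funext i
  refine Fin.addCases (fun j => ?_) (fun j => ?_) i <;> simp

lemma map_mon {p : ℕ} {A A' F : Type*} [Monoid A] [Monoid A'] [FunLike F A A']
    [MonoidHomClass F A A'] (Ψ : F) (y : Fin p → A) (α : Fin p → ℕ) :
    Ψ (mon y α) = mon (fun i => Ψ (y i)) α := by
  rw [mon, mon, map_list_prod, List.map_map]
  rfl

variable {p : ℕ} {A : Type*} [Ring A] [Algebra ℂ A] {y : Fin p → A}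

/-- The span of the nonempty products of fewer than `n` of the elements `y i`. -/
def shortSpan (y : Fin p → A) (n : ℕ) : Submodule ℂ A :=
  Submodule.span ℂ ((fun L : List (Fin p) => (L.map y).prod) '' {L | L ≠ [] ∧ L.length < n})

lemma mul_mem_shortSpan (i : Fin p) {n : ℕ} {a : A} (ha : a ∈ shortSpan y n) :
    y i * a ∈ shortSpan y (n + 1) := by
  refine Submodule.span_induction ?_ (by simp) ?_ ?_ ha
  · rintro _ ⟨L, ⟨-, hL⟩, rfl⟩
    exact Submodule.subset_span ⟨i :: L, ⟨by simp, by simpa using hL⟩, by simp⟩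
  · intro a b _ _ h1 h2
    rw [mul_add]
    exact add_mem h1 h2
  · intro c a _ h1
    rw [mul_smul_comm]
    exact Submodule.smul_mem _ _ h1

/-- Swapping two adjacent letters introduces a commutator, which is a linear combination of single
letters, so each swap costs only shorter words. -/
lemma prod_sub_prod_mem_shortSpan
    (hy : ∀ i j, y i * y j - y j * y i ∈ Submodule.span ℂ (Set.range y))
    {L L' : List (Fin p)} (h : L.Perm L') :
    (L.map y).prod - (L'.map y).prod ∈ shortSpan y L.length := by
  induction h with
  | nil => simp
  | cons a h ih =>
    simp only [List.map_cons, List.prod_cons, List.length_cons, ← mul_sub]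
    exact mul_mem_shortSpan a ih
  | swap a b L =>
    have h : ((b :: a :: L).map y).prod - ((a :: b :: L).map y).prod =
        (y b * y a - y a * y b) * (L.map y).prod := by
      simp [sub_mul, mul_assoc]
    rw [h]
    refine Submodule.span_induction ?_ (by simp) ?_ ?_ (hy b a)
    · rintro _ ⟨i, rfl⟩
      exact Submodule.subset_span ⟨i :: L, ⟨by simp, by simp⟩, by simp⟩
    · intro a b _ _ h1 h2
      rw [add_mul]
      exact add_mem h1 h2
    · intro c a _ h1
      rw [smul_mul_assoc]
      exact Submodule.smul_mem _ _ h1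
  | trans h1 h2 ih1 ih2 =>
    rw [← sub_add_sub_cancel]
    rw [h1.length_eq] at ih1 ⊢
    exact add_mem ih1 ih2

/-- Straightening: a word agrees with the sorted word having the same letter counts up to shorter
words, which are handled by induction on length. -/
lemma shortSpan_le_span_mon
    (hy : ∀ i j, y i * y j - y j * y i ∈ Submodule.span ℂ (Set.range y)) (n : ℕ) :
    shortSpan y n ≤ Submodule.span ℂ (mon y '' {α | α ≠ 0}) := by
  induction n with
  | zero => refine Submodule.span_le.2 ?_; rintro _ ⟨L, ⟨-, hL⟩, -⟩; simp at hL
  | succ n ih =>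
    refine Submodule.span_le.2 ?_
    rintro _ ⟨L, ⟨hL0, hL⟩, rfl⟩
    have h1 := prod_sub_prod_mem_shortSpan hy (perm_monList L)
    have h2 : shortSpan y L.length ≤ shortSpan y n := by
      refine Submodule.span_mono (Set.image_mono ?_)
      rintro L' ⟨h3, h4⟩
      exact ⟨h3, by omega⟩
    have h3 : mon y (fun i => L.count i) ∈ Submodule.span ℂ (mon y '' {α | α ≠ 0}) := by
      refine Submodule.subset_span ⟨_, fun h => hL0 ?_, rfl⟩
      have h4 := perm_monList L
      rw [monList_eq_nil.2 h] at h4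
      exact h4.eq_nil
    have h4 := add_mem (ih (h2 h1)) h3
    rwa [mon, sub_add_cancel] at h4

lemma mul_mon_mem_span
    (hy : ∀ i j, y i * y j - y j * y i ∈ Submodule.span ℂ (Set.range y)) {a : A}
    (ha : a ∈ Submodule.span ℂ (Set.range y)) (α : Fin p → ℕ) :
    a * mon y α ∈ Submodule.span ℂ (mon y '' {α | α ≠ 0}) := by
  refine Submodule.span_induction ?_ (by simp) ?_ ?_ ha
  · rintro _ ⟨i, rfl⟩
    refine shortSpan_le_span_mon hy ((monList α).length + 2) (Submodule.subset_span
      ⟨i :: monList α, ⟨by simp, by simp⟩, by simp [mon]⟩)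
  · intro a b _ _ h1 h2
    rw [add_mul]
    exact add_mem h1 h2
  · intro c a _ h1
    rw [smul_mul_assoc]
    exact Submodule.smul_mem _ _ h1

end Monomials

/-! ### Generation of the enveloping algebra and the spanning half of PBW. -/

section Enveloping

variable {g : Type*} [LieRing g] [LieAlgebra ℂ g]

local notation "U" => UniversalEnvelopingAlgebra ℂ

lemma adjoin_range_ι :
    Algebra.adjoin ℂ (Set.range (UniversalEnvelopingAlgebra.ι ℂ : g →ₗ⁅ℂ⁆ U g)) = ⊤ := by
  set S := Algebra.adjoin ℂ (Set.range (UniversalEnvelopingAlgebra.ι ℂ : g →ₗ⁅ℂ⁆ U g))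
  let j : g →ₗ⁅ℂ⁆ S :=
    { toFun := fun x => ⟨UniversalEnvelopingAlgebra.ι ℂ x, Algebra.subset_adjoin ⟨x, rfl⟩⟩
      map_add' := fun x y => Subtype.ext (map_add _ x y)
      map_smul' := fun c x => Subtype.ext (map_smul _ c x)
      map_lie' := fun {x y} => Subtype.ext (LieHom.map_lie _ x y) }
  have h : S.val.comp (UniversalEnvelopingAlgebra.lift ℂ j) = AlgHom.id ℂ (U g) := by
    refine UniversalEnvelopingAlgebra.hom_ext ℂ (LieHom.ext fun x => ?_)
    change S.val (UniversalEnvelopingAlgebra.lift ℂ j (UniversalEnvelopingAlgebra.ι ℂ x)) = _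
    rw [UniversalEnvelopingAlgebra.lift_ι_apply]
    rfl
  refine eq_top_iff.2 fun u _ => ?_
  have := congrArg (fun f => f u) h
  simp only [AlgHom.coe_comp, Function.comp_apply, AlgHom.coe_id, id_eq] at this
  rw [← this]
  exact (UniversalEnvelopingAlgebra.lift ℂ j u).2

/-- A subspace of `U(g)` which contains `1` and is stable under left multiplication by `g` is
everything. -/
lemma eq_top_of_mul_left_mem (S : Submodule ℂ (U g)) (h1 : 1 ∈ S)
    (hS : ∀ (x : g), ∀ u ∈ S, UniversalEnvelopingAlgebra.ι ℂ x * u ∈ S) : S = ⊤ := by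
  have key : ∀ a : U g, ∀ u ∈ S, a * u ∈ S := by
    intro a
    have ha : a ∈ Algebra.adjoin ℂ
        (Set.range (UniversalEnvelopingAlgebra.ι ℂ : g →ₗ⁅ℂ⁆ U g)) := by
      rw [adjoin_range_ι]; trivial
    induction ha using Algebra.adjoin_induction with
    | mem a ha => obtain ⟨x, rfl⟩ := ha; exact hS x
    | algebraMap c =>
      intro u hu
      rw [← Algebra.smul_def]
      exact S.smul_mem c hu
    | add a b _ _ ha hb => intro u hu; rw [add_mul]; exact add_mem (ha u hu) (hb u hu)
    | mul a b _ _ ha hb => intro u hu; rw [mul_assoc]; exact ha _ (hb u hu)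
  exact eq_top_iff.2 fun a _ => by simpa using key a 1 h1

lemma span_mon_eq_top {p : ℕ} (x : Fin p → g) (hx : Submodule.span ℂ (Set.range x) = ⊤) :
    Submodule.span ℂ (Set.range (mon fun i => UniversalEnvelopingAlgebra.ι ℂ (x i))) = ⊤ := by
  have hspan : ∀ z : g, UniversalEnvelopingAlgebra.ι ℂ z ∈
      Submodule.span ℂ (Set.range fun i => UniversalEnvelopingAlgebra.ι ℂ (x i)) := by
    intro z
    have hz : z ∈ Submodule.span ℂ (Set.range x) := hx ▸ Submodule.mem_top
    have h := Submodule.mem_map_of_mem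
      (f := (UniversalEnvelopingAlgebra.ι ℂ : g →ₗ⁅ℂ⁆ U g).toLinearMap) hz
    rw [Submodule.map_span, ← Set.range_comp] at h
    exact h
  refine eq_top_of_mul_left_mem _ (Submodule.subset_span ⟨0, mon_zero _⟩) fun z u hu => ?_
  refine Submodule.span_induction ?_ (by simp) ?_ ?_ hu
  · rintro _ ⟨α, rfl⟩
    refine Submodule.span_mono (Set.image_subset_range _ _) (mul_mon_mem_span ?_ (hspan z) α)
    intro i j
    have := hspan ⁅x i, x j⁆
    rwa [LieHom.map_lie] at this
  · intro a b _ _ h1 h2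
    rw [mul_add]
    exact add_mem h1 h2
  · intro c a _ h1
    rw [mul_smul_comm]
    exact Submodule.smul_mem _ _ h1

end Enveloping

/-! ### Linear independence of ordered monomials -/

section Independence

/-- By the Leibniz rule, differentiation removes at most one factor from `I`. -/
lemma Derivation_mem_pow {A : Type*} [CommRing A] [Algebra ℂ A] (D : Derivation ℂ A A)
    (I : Ideal A) (n : ℕ) : ∀ r ∈ I ^ (n + 1), D r ∈ I ^ n := by
  induction n with
  | zero => simp
  | succ n ih =>
    intro r hr
    rw [pow_succ'] at hr
    refine Submodule.mul_induction_on hr ?_ ?_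
    · intro a ha b hb
      rw [Derivation.leibniz, smul_eq_mul, smul_eq_mul]
      refine add_mem ?_ (Ideal.mul_mem_right _ _ hb)
      rw [pow_succ']
      exact Ideal.mul_mem_mul ha (ih b hb)
    · intro a b ha hb
      rw [map_add]
      exact add_mem ha hb

/-- A derivation, as an element of the endomorphism ring. -/
def derEnd {A : Type*} [CommRing A] [Algebra ℂ A] (D : Derivation ℂ A A) : Module.End ℂ A :=
  D.toLinearMap

/-- The leading term of a product of derivations, applied to a power. -/
lemma prod_derivation_pow {A : Type*} [CommRing A] [Algebra ℂ A] (I : Ideal A) {f : A}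
    (hf : f ∈ I) (L : List (Derivation ℂ A A)) (k : ℕ) :
    (L.map derEnd).prod (f ^ (L.length + k)) -
      ((L.length + k).descFactorial L.length : A) * (L.map fun D => D f).prod * f ^ k
      ∈ I ^ (k + 1) := by
  induction L generalizing k with
  | nil => simp
  | cons D L ih =>
    have h := Derivation_mem_pow D I _ _ (ih (k + 1))
    simp only [List.map_cons, List.prod_cons, List.length_cons, Module.End.mul_apply]
    rw [show L.length + 1 + k = L.length + (k + 1) by ring]
    set a := (L.map derEnd).prod
      (f ^ (L.length + (k + 1)))
    set P := (L.map fun D => D f).prod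
    rw [map_sub, Derivation.leibniz, Derivation.leibniz, Derivation.leibniz_pow,
      Derivation.map_natCast] at h
    simp only [smul_eq_mul, mul_zero, add_zero, nsmul_eq_mul, Nat.add_sub_cancel] at h
    have hd : ((L.length + (k + 1)).descFactorial (L.length + 1) : A) =
        ((L.length + (k + 1)).descFactorial L.length : A) * ((k + 1 : ℕ) : A) := by
      rw [Nat.descFactorial_succ, Nat.add_sub_cancel_left, Nat.cast_mul, mul_comm]
    rw [hd]
    -- The Leibniz term where `D` hits `P` still has `k + 1` factors `f`, so it is part of the
    -- error.
    have h2 : f ^ (k + 1) * (((L.length + (k + 1)).descFactorial L.length : A) * D P) ∈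
        I ^ (k + 1) := Ideal.mul_mem_right _ _ (Ideal.pow_mem_pow hf _)
    have h3 := add_mem h h2
    refine (congrArg (· ∈ I ^ (k + 1)) ?_).mp h3
    change _ = D a - _
    ring

/-- A power of `f` is invisible at the point to words with fewer derivations than its exponent, and
words of the exact length see only their commutative symbol. This is what separates PBW monomials by
degree. -/
lemma eval_prod_derivation_pow {A : Type*} [CommRing A] [Algebra ℂ A] (ev : A →ₐ[ℂ] ℂ) {f : A}
    (hf : ev f = 0) (L : List (Derivation ℂ A A)) (k : ℕ) :
    ev ((L.map derEnd).prod (f ^ (L.length + k))) =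
      if k = 0 then (L.length.factorial : ℂ) * (L.map fun D => ev (D f)).prod else 0 := by
  have h := prod_derivation_pow (RingHom.ker ev) (RingHom.mem_ker.2 hf) L k
  have h0 := RingHom.mem_ker.1 (Ideal.pow_le_self (Nat.succ_ne_zero k) h)
  rw [map_sub, sub_eq_zero] at h0
  rw [h0]
  split_ifs with hk
  · subst hk
    simp [Nat.descFactorial_self, map_list_prod, List.map_map, Function.comp_def]
  · simp [hf, hk]

variable {g : Type*} [LieRing g] [LieAlgebra ℂ g] {n : Type*} [Fintype n]

/-- The linear vector field `X ↦ X a` on the space of matrices. -/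
def matDer (a : Matrix n n ℂ) :
    Derivation ℂ (MvPolynomial (n × n) ℂ) (MvPolynomial (n × n) ℂ) :=
  MvPolynomial.mkDerivation ℂ fun ij => ∑ k, a k ij.2 • MvPolynomial.X (ij.1, k)

lemma matDer_X (a : Matrix n n ℂ) (ij : n × n) :
    matDer a (MvPolynomial.X ij) = ∑ k, a k ij.2 • MvPolynomial.X (ij.1, k) :=
  MvPolynomial.mkDerivation_X _ _ _

/-- The action of a linear Lie algebra on the polynomial functions on matrices. -/
def matRep [DecidableEq n] (ρ : g →ₗ⁅ℂ⁆ Matrix n n ℂ) :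
    g →ₗ⁅ℂ⁆ Module.End ℂ (MvPolynomial (n × n) ℂ) where
  toFun x := (matDer (ρ x) : MvPolynomial (n × n) ℂ →ₗ[ℂ] MvPolynomial (n × n) ℂ)
  map_add' x y := by
    rw [← Derivation.coe_add_linearMap]
    congr 1
    refine MvPolynomial.derivation_ext fun ij => ?_
    simp [matDer_X, add_smul, Finset.sum_add_distrib]
  map_smul' c x := by
    rw [RingHom.id_apply, ← Derivation.coe_smul_linearMap]
    congr 1
    refine MvPolynomial.derivation_ext fun ij => ?_
    simp [matDer_X, mul_smul, Finset.smul_sum]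
  map_lie' {x y} := by
    rw [LieRing.of_associative_ring_bracket]
    have : matDer (ρ ⁅x, y⁆) = ⁅matDer (ρ x), matDer (ρ y)⁆ := by
      refine MvPolynomial.derivation_ext fun ij => ?_
      -- The fields are linear, so on coordinates their composition is the matrix product;
      -- derivations are determined by coordinates, so commutators correspond.
      have h : ∀ a b : Matrix n n ℂ, matDer a (matDer b (MvPolynomial.X ij)) =
          matDer (a * b) (MvPolynomial.X ij) := by
        intro a b
        simp only [matDer_X, map_sum, Derivation.map_smul, Finset.smul_sum, Matrix.mul_apply,
          Finset.sum_smul, smul_smul]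
        rw [Finset.sum_comm]
        simp only [mul_comm]
      rw [Derivation.commutator_apply, h, h, LieHom.map_lie, LieRing.of_associative_ring_bracket]
      simp [matDer_X, sub_smul, Finset.sum_sub_distrib]
    rw [this]
    rfl

variable [DecidableEq n]

/-- Evaluation of polynomial functions at the identity matrix. -/
def evalOne : MvPolynomial (n × n) ℂ →ₐ[ℂ] ℂ :=
  MvPolynomial.aeval fun ij => (1 : Matrix n n ℂ) ij.1 ij.2

/-- A polynomial function which vanishes at the identity with prescribed derivatives there. -/
lemma exists_eval_matDer (ℓ : Matrix n n ℂ →ₗ[ℂ] ℂ) :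
    ∃ f : MvPolynomial (n × n) ℂ, evalOne f = 0 ∧ ∀ a, evalOne (matDer a f) = ℓ a := by
  -- At the identity the field of `a` differentiates the coordinate `X (i, j)` to `a i j`; centring
  -- the coordinates at the identity makes the function vanish there.
  refine ⟨∑ i, ∑ j, ℓ (Matrix.single i j 1) • (MvPolynomial.X (i, j) -
    MvPolynomial.C ((1 : Matrix n n ℂ) i j)), ?_, fun a => ?_⟩
  · simp [evalOne]
  · have h : ∀ i j, evalOne (matDer a (MvPolynomial.X (i, j))) = a i j := by
      intro i j
      simp [matDer_X, evalOne, Matrix.one_apply]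
    conv_rhs => rw [Matrix.matrix_eq_sum_single a]
    simp only [map_sum, Derivation.map_smul, map_smul, map_sub, MvPolynomial.derivation_C,
      sub_zero, smul_eq_mul]
    refine Finset.sum_congr rfl fun i _ => Finset.sum_congr rfl fun j _ => ?_
    rw [h i j, mul_comm, ← smul_eq_mul, ← map_smul, Matrix.smul_single, smul_eq_mul, mul_one]

/-- The top-degree coefficients of a relation form a polynomial in `s`. The functionals force it to
vanish at every complex point, hence identically. -/
lemma linearIndependent_of_functionals {p : ℕ} {A : Type*} [AddCommGroup A] [Module ℂ A]
    (v : (Fin p → ℕ) → A)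
    (hv : ∀ (s : Fin p → ℂ) (k : ℕ), ∃ Λ : A →ₗ[ℂ] ℂ, ∀ α : Fin p → ℕ, ∑ i, α i ≤ k →
      Λ (v α) = if ∑ i, α i = k then (k.factorial : ℂ) * ∏ i, s i ^ α i else 0) :
    LinearIndependent ℂ v := by
  rw [linearIndependent_iff]
  intro c hc
  by_contra hne
  obtain ⟨α₀, hα₀, hmax⟩ := c.support.exists_max_image (fun α => ∑ i, α i)
    (Finsupp.support_nonempty_iff.2 hne)
  set k := ∑ i, α₀ i with hk
  let P : MvPolynomial (Fin p) ℂ := ∑ α ∈ c.support with ∑ i, α i = k,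
    MvPolynomial.monomial (Finsupp.equivFunOnFinite.symm α) (c α)
  have hP : P = 0 := by
    refine MvPolynomial.funext fun s => ?_
    obtain ⟨Λ, hΛ⟩ := hv s k
    have h := congrArg Λ hc
    rw [Finsupp.linearCombination_apply, Finsupp.sum, map_sum, map_zero] at h
    have h2 : ∀ α ∈ c.support, Λ (c α • v α) =
        if ∑ i, α i = k then c α * ((k.factorial : ℂ) * ∏ i, s i ^ α i) else 0 := by
      intro α hα
      rw [map_smul, hΛ α (hmax α hα), smul_eq_mul, mul_ite, mul_zero]
    rw [Finset.sum_congr rfl h2, ← Finset.sum_filter] at h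
    have h4 : (k.factorial : ℂ) * MvPolynomial.eval s P = 0 := by
      rw [← h]
      simp only [P, map_sum, MvPolynomial.eval_monomial, Finset.mul_sum]
      refine Finset.sum_congr rfl fun α _ => ?_
      rw [Finsupp.prod_fintype _ _ (by simp)]
      simp only [Finsupp.coe_equivFunOnFinite_symm]
      ring
    rw [map_zero]
    exact (mul_eq_zero.1 h4).resolve_left (Nat.cast_ne_zero.2 (Nat.factorial_ne_zero k))
  have h5 := congrArg (MvPolynomial.coeff (Finsupp.equivFunOnFinite.symm α₀)) hP
  simp only [P, MvPolynomial.coeff_sum, MvPolynomial.coeff_monomial, EmbeddingLike.apply_eq_iff_eq,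
    MvPolynomial.coeff_zero] at h5
  have hm : α₀ ∈ c.support.filter fun α => ∑ i, α i = k := Finset.mem_filter.2 ⟨hα₀, rfl⟩
  rw [Finset.sum_ite_eq' _ α₀, if_pos hm] at h5
  exact Finsupp.mem_support_iff.1 hα₀ h5

/-- Because `ρ` has a linear left inverse, there is a function vanishing at the identity whose
derivative along each `b i` is an arbitrary `s i`. Applying monomials to its `k`-th power and
evaluating gives the functionals required above. -/
lemma linearIndependent_mon_of_injective {p : ℕ} (b : Module.Basis (Fin p) ℂ g)
    (ρ : g →ₗ⁅ℂ⁆ Matrix n n ℂ) (hρ : Function.Injective ρ) :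
    LinearIndependent ℂ (mon fun i => UniversalEnvelopingAlgebra.ι ℂ (b i)) := by
  refine linearIndependent_of_functionals _ fun s k => ?_
  obtain ⟨r, hr⟩ := LinearMap.exists_leftInverse_of_injective (ρ : g →ₗ[ℂ] Matrix n n ℂ)
    (LinearMap.ker_eq_bot.2 hρ)
  obtain ⟨f, hf0, hf⟩ := exists_eval_matDer (b.constr ℂ s ∘ₗ r)
  have hfs : ∀ i, evalOne (matDer (ρ (b i)) f) = s i := by
    intro i
    have h3 : r (ρ (b i)) = b i := congrArg (fun F => F (b i)) hr
    rw [hf, LinearMap.comp_apply, h3, Module.Basis.constr_basis]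
  let Ψ := UniversalEnvelopingAlgebra.lift ℂ (matRep ρ)
  have hΨ : ∀ α : Fin p → ℕ, Ψ (mon (fun i => UniversalEnvelopingAlgebra.ι ℂ (b i)) α) =
      (((monList α).map fun i => matDer (ρ (b i))).map derEnd).prod := by
    intro α
    rw [map_mon, mon, List.map_map]
    congr 2
    funext i
    exact UniversalEnvelopingAlgebra.lift_ι_apply _ _ _
  refine ⟨evalOne.toLinearMap ∘ₗ LinearMap.applyₗ (f ^ k) ∘ₗ Ψ.toLinearMap, fun α hα => ?_⟩
  change evalOne (Ψ (mon (fun i => UniversalEnvelopingAlgebra.ι ℂ (b i)) α) (f ^ k)) = _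
  have h3 := eval_prod_derivation_pow evalOne hf0
    ((monList α).map fun i => matDer (ρ (b i))) (k - ∑ i, α i)
  rw [List.length_map, length_monList, Nat.add_sub_cancel' hα] at h3
  rw [hΨ, h3]
  by_cases hh : ∑ i, α i = k
  · rw [if_pos (by omega), if_pos hh, hh, List.map_map, ← mon_comm, mon]
    congr 3
    funext i
    exact hfs i
  · rw [if_neg (by omega), if_neg hh]

/-- The ordered monomials in a basis of a semisimple Lie algebra are linearly independent in its
enveloping algebra. -/
lemma linearIndependent_mon [FiniteDimensional ℂ g] [LieAlgebra.IsSemisimple ℂ g] {p : ℕ}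
    (b : Module.Basis (Fin p) ℂ g) :
    LinearIndependent ℂ (mon fun i => UniversalEnvelopingAlgebra.ι ℂ (b i)) := by
  let m := (LinearMap.toMatrixAlgEquiv b : (g →ₗ[ℂ] g) ≃ₐ[ℂ] Matrix (Fin p) (Fin p) ℂ)
  refine linearIndependent_mon_of_injective b
    ((AlgHom.toLieHom m.toAlgHom).comp (LieAlgebra.ad ℂ g)) ?_
  refine m.injective.comp ?_
  refine (LieHom.ker_eq_bot (LieAlgebra.ad ℂ g)).1 ?_
  rw [LieAlgebra.ad_ker_eq_self_module_ker, LieAlgebra.self_module_ker_eq_center]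
  exact LieAlgebra.center_eq_bot ℂ g

end Independence

/-! ### Functionals on enveloping algebras which are equivariant for a subalgebra -/

section Functionals

local notation "U" => UniversalEnvelopingAlgebra ℂ

local notation "ι" => UniversalEnvelopingAlgebra.ι ℂ

variable {g : Type*} [LieRing g] [LieAlgebra ℂ g]

lemma linearIndependent_append {E : Type*} [AddCommGroup E] [Module ℂ E] {p q : ℕ}
    {x : Fin p → E} {y : Fin q → E} (hx : LinearIndependent ℂ x)
    (hy : LinearIndependent ℂ y)
    (h : Disjoint (Submodule.span ℂ (Set.range x)) (Submodule.span ℂ (Set.range y))) :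
    LinearIndependent ℂ (Fin.append x y) := by
  rw [← linearIndependent_equiv finSumFinEquiv]
  have h2 : Fin.append x y ∘ finSumFinEquiv = Sum.elim x y := by
    funext i
    cases i <;> simp
  rw [h2]
  exact hx.sum_type hy h

lemma span_range_append {E : Type*} [AddCommGroup E] [Module ℂ E] {p q : ℕ}
    (x : Fin p → E) (y : Fin q → E) : Submodule.span ℂ (Set.range (Fin.append x y)) =
      Submodule.span ℂ (Set.range x) ⊔ Submodule.span ℂ (Set.range y) := by
  rw [← Submodule.span_union]
  congr 1
  ext z
  constructor
  · rintro ⟨i, rfl⟩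
    refine Fin.addCases (fun j => ?_) (fun j => ?_) i
    · exact Or.inl ⟨j, by simp⟩
    · exact Or.inr ⟨j, by simp⟩
  · rintro (⟨i, rfl⟩ | ⟨i, rfl⟩)
    · exact ⟨Fin.castAdd q i, by simp⟩
    · exact ⟨Fin.natAdd p i, by simp⟩

/-- The canonical homomorphism `U(K) → U(g)` for a subalgebra `K`. -/
def envelopingIncl (K : LieSubalgebra ℂ g) : U K →ₐ[ℂ] U g :=
  UniversalEnvelopingAlgebra.lift ℂ ((ι : g →ₗ⁅ℂ⁆ U g).comp K.incl)

lemma envelopingIncl_ι (K : LieSubalgebra ℂ g) (k : K) :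
    envelopingIncl K (ι k) = ι (k : g) :=
  UniversalEnvelopingAlgebra.lift_ι_apply _ _ _

lemma mon_fin_add {A : Type*} [Monoid A] {p q : ℕ} (y : Fin p → A) (z : Fin q → A)
    (γ : Fin (p + q) → ℕ) : mon (Fin.append y z) γ =
      mon y (fun i => γ (Fin.castAdd q i)) * mon z (fun i => γ (Fin.natAdd p i)) := by
  rw [← mon_append, Fin.append_castAdd_natAdd]

lemma comp_fin_append {A A' : Type*} {p q : ℕ} (F : A → A') (y : Fin p → A) (z : Fin q → A) :
    (fun i => F (Fin.append y z i)) = Fin.append (fun i => F (y i)) (fun i => F (z i)) := by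
  funext i
  refine Fin.addCases (fun j => ?_) (fun j => ?_) i <;> simp

variable {T : Type*} [CommRing T] [Algebra ℂ T]

section

variable [FiniteDimensional ℂ g] {p : ℕ} {y : Fin p → g} {K : LieSubalgebra ℂ g}

/-- Functionals on `U(g)`, equivariant for the right multiplication by `K`, with prescribed
values on the ordered monomials in a basis of a complement of `K`. -/
lemma exists_functional_right [LieAlgebra.IsSemisimple ℂ g]
    (hy : LinearIndependent ℂ y) (hK : IsCompl (Submodule.span ℂ (Set.range y)) K.toSubmodule)
    (χ : K →ₗ⁅ℂ⁆ T) (c : (Fin p → ℕ) → T) :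
    ∃ θ : U g →ₗ[ℂ] T, (∀ α, θ (mon (fun i => ι (y i)) α) = c α) ∧
      ∀ u (k : K), θ (u * ι (k : g)) = χ k * θ u := by
  let z := Module.finBasis ℂ K
  have hzs : Submodule.span ℂ (Set.range fun i => (z i : g)) = K.toSubmodule := by
    have := congrArg (Submodule.map K.toSubmodule.subtype) z.span_eq
    rw [Submodule.map_span, ← Set.range_comp, Submodule.map_top, Submodule.range_subtype] at this
    exact this
  have hz : LinearIndependent ℂ fun i => (z i : g) :=
    z.linearIndependent.map' K.toSubmodule.subtype (Submodule.ker_subtype _)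
  let b : Module.Basis _ ℂ g := Module.Basis.mk
    (linearIndependent_append hy hz (by rw [hzs]; exact hK.disjoint))
    (by rw [span_range_append, hzs, hK.sup_eq_top])
  have hmon : (mon fun i => ι (b i)) = fun γ => mon (fun i => ι (y i))
      (fun i => γ (Fin.castAdd _ i)) * mon (fun i => ι (z i : g)) (fun i => γ (Fin.natAdd p i)) := by
    funext γ
    rw [← mon_fin_add, ← comp_fin_append]
    simp [b]
  let bU : Module.Basis _ ℂ (U g) := Module.Basis.mk (linearIndependent_mon b)
    (span_mon_eq_top b b.span_eq).ge
  -- On the PBW basis adapted to the complement and `K`, the `K`-part is evaluated through `χ`. Then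
  -- `hθ2` extends this to all of `U(K)`, where `χ` is an algebra map, and equivariance follows.
  let θ : U g →ₗ[ℂ] T := bU.constr ℂ fun γ => c (fun i => γ (Fin.castAdd _ i)) *
    mon (fun i => χ (z i)) (fun i => γ (Fin.natAdd p i))
  have hθ : ∀ α β, θ (mon (fun i => ι (y i)) α * mon (fun i => ι (z i : g)) β) =
      c α * mon (fun i => χ (z i)) β := by
    intro α β
    have h1 : mon (fun i => ι (y i)) α * mon (fun i => ι (z i : g)) β =
        bU (Fin.append α β) := by
      rw [Module.Basis.mk_apply, hmon]
      simp
    rw [h1, Module.Basis.constr_basis]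
    simp
  have hθ2 : ∀ α w, θ (mon (fun i => ι (y i)) α * envelopingIncl K w) =
      c α * UniversalEnvelopingAlgebra.lift ℂ χ w := by
    intro α
    have h : θ ∘ₗ LinearMap.mulLeft ℂ (mon (fun i => ι (y i)) α) ∘ₗ
        (envelopingIncl K).toLinearMap =
        LinearMap.mulLeft ℂ (c α) ∘ₗ (UniversalEnvelopingAlgebra.lift ℂ χ).toLinearMap := by
      refine LinearMap.ext_on_range (span_mon_eq_top z z.span_eq) fun β => ?_
      simp only [LinearMap.comp_apply, AlgHom.toLinearMap_apply, LinearMap.mulLeft_apply, map_mon,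
        envelopingIncl_ι, UniversalEnvelopingAlgebra.lift_ι_apply]
      exact hθ α β
    exact fun w => congrArg (fun F => F w) h
  refine ⟨θ, fun α => by simpa using hθ2 α 1, fun u k => ?_⟩
  have h : θ ∘ₗ LinearMap.mulRight ℂ (ι (k : g)) = LinearMap.mulLeft ℂ (χ k) ∘ₗ θ := by
    refine bU.ext fun γ => ?_
    simp only [bU, Module.Basis.mk_apply, hmon, LinearMap.comp_apply, LinearMap.mulLeft_apply,
      LinearMap.mulRight_apply]
    have h1 : mon (fun i => ι (z i : g)) (fun i => γ (Fin.natAdd p i)) =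
      envelopingIncl K (mon (fun i => ι (z i)) (fun i => γ (Fin.natAdd p i))) := by
      simp only [map_mon, envelopingIncl_ι]
    rw [h1, mul_assoc, ← envelopingIncl_ι, ← map_mul, hθ2, hθ2, map_mul,
      UniversalEnvelopingAlgebra.lift_ι_apply]
    ring
  exact congrArg (fun F => F u) h

/-- Functionals on `U(g)`, equivariant for the left multiplication by `K`, with prescribed
values on the ordered monomials in a basis of a complement of `K`. -/
lemma exists_functional_left [LieAlgebra.IsSemisimple ℂ g]
    (hy : LinearIndependent ℂ y) (hK : IsCompl (Submodule.span ℂ (Set.range y)) K.toSubmodule)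
    (χ : K →ₗ⁅ℂ⁆ T) (c : (Fin p → ℕ) → T) :
    ∃ θ : U g →ₗ[ℂ] T, (∀ α, θ (mon (fun i => ι (y i)) α) = c α) ∧
      ∀ u (k : K), θ (ι (k : g) * u) = χ k * θ u := by
  let z := Module.finBasis ℂ K
  have hzs : Submodule.span ℂ (Set.range fun i => (z i : g)) = K.toSubmodule := by
    have := congrArg (Submodule.map K.toSubmodule.subtype) z.span_eq
    rw [Submodule.map_span, ← Set.range_comp, Submodule.map_top, Submodule.range_subtype] at this
    exact this
  have hz : LinearIndependent ℂ fun i => (z i : g) :=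
    z.linearIndependent.map' K.toSubmodule.subtype (Submodule.ker_subtype _)
  let b : Module.Basis _ ℂ g := Module.Basis.mk
    (linearIndependent_append hz hy (by rw [hzs]; exact hK.symm.disjoint))
    (by rw [span_range_append, hzs, hK.symm.sup_eq_top])
  have hmon : (mon fun i => ι (b i)) = fun γ => mon (fun i => ι (z i : g))
      (fun i => γ (Fin.castAdd _ i)) * mon (fun i => ι (y i)) (fun i => γ (Fin.natAdd _ i)) := by
    funext γ
    rw [← mon_fin_add, ← comp_fin_append]
    simp [b]
  let bU : Module.Basis _ ℂ (U g) := Module.Basis.mk (linearIndependent_mon b)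
    (span_mon_eq_top b b.span_eq).ge
  let θ : U g →ₗ[ℂ] T := bU.constr ℂ fun γ =>
    mon (fun i => χ (z i)) (fun i => γ (Fin.castAdd _ i)) * c (fun i => γ (Fin.natAdd _ i))
  have hθ : ∀ α β, θ (mon (fun i => ι (z i : g)) β * mon (fun i => ι (y i)) α) =
      mon (fun i => χ (z i)) β * c α := by
    intro α β
    have h1 : mon (fun i => ι (z i : g)) β * mon (fun i => ι (y i)) α =
        bU (Fin.append β α) := by
      rw [Module.Basis.mk_apply, hmon]
      simp
    rw [h1, Module.Basis.constr_basis]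
    simp
  have hθ2 : ∀ α w, θ (envelopingIncl K w * mon (fun i => ι (y i)) α) =
      UniversalEnvelopingAlgebra.lift ℂ χ w * c α := by
    intro α
    have h : θ ∘ₗ LinearMap.mulRight ℂ (mon (fun i => ι (y i)) α) ∘ₗ
        (envelopingIncl K).toLinearMap =
        LinearMap.mulRight ℂ (c α) ∘ₗ (UniversalEnvelopingAlgebra.lift ℂ χ).toLinearMap := by
      refine LinearMap.ext_on_range (span_mon_eq_top z z.span_eq) fun β => ?_
      simp only [LinearMap.comp_apply, AlgHom.toLinearMap_apply, LinearMap.mulRight_apply, map_mon,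
        envelopingIncl_ι, UniversalEnvelopingAlgebra.lift_ι_apply]
      exact hθ α β
    exact fun w => congrArg (fun F => F w) h
  refine ⟨θ, fun α => by simpa using hθ2 α 1, fun u k => ?_⟩
  have h : θ ∘ₗ LinearMap.mulLeft ℂ (ι (k : g)) = LinearMap.mulLeft ℂ (χ k) ∘ₗ θ := by
    refine bU.ext fun γ => ?_
    simp only [bU, Module.Basis.mk_apply, hmon, LinearMap.comp_apply, LinearMap.mulLeft_apply]
    have h1 : mon (fun i => ι (z i : g)) (fun i => γ (Fin.castAdd _ i)) =
      envelopingIncl K (mon (fun i => ι (z i)) (fun i => γ (Fin.castAdd _ i))) := by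
      simp only [map_mon, envelopingIncl_ι]
    rw [h1, ← mul_assoc, ← envelopingIncl_ι, ← map_mul, hθ2, hθ2, map_mul,
      UniversalEnvelopingAlgebra.lift_ι_apply]
    ring
  exact congrArg (fun F => F u) h

lemma span_envelopingIncl_mul_mon
    (hK : IsCompl (Submodule.span ℂ (Set.range y)) K.toSubmodule) : Submodule.span ℂ
    {u | ∃ w α, u = envelopingIncl K w * mon (fun i => ι (y i)) α} = ⊤ := by
  let z := Module.finBasis ℂ K
  have hzs : Submodule.span ℂ (Set.range fun i => (z i : g)) = K.toSubmodule := by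
    have := congrArg (Submodule.map K.toSubmodule.subtype) z.span_eq
    rw [Submodule.map_span, ← Set.range_comp, Submodule.map_top, Submodule.range_subtype] at this
    exact this
  refine eq_top_iff.2 ((span_mon_eq_top (Fin.append (fun i => (z i : g)) y) ?_).ge.trans
    (Submodule.span_mono ?_))
  · rw [span_range_append, hzs, hK.symm.sup_eq_top]
  · rintro _ ⟨γ, rfl⟩
    refine ⟨mon (fun i => ι (z i)) (fun i => γ (Fin.castAdd _ i)),
      fun i => γ (Fin.natAdd _ i), ?_⟩
    rw [comp_fin_append, mon_fin_add]
    simp only [map_mon, envelopingIncl_ι]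

lemma span_mon_mul_envelopingIncl
    (hK : IsCompl (Submodule.span ℂ (Set.range y)) K.toSubmodule) : Submodule.span ℂ
    {u | ∃ w α, u = mon (fun i => ι (y i)) α * envelopingIncl K w} = ⊤ := by
  let z := Module.finBasis ℂ K
  have hzs : Submodule.span ℂ (Set.range fun i => (z i : g)) = K.toSubmodule := by
    have := congrArg (Submodule.map K.toSubmodule.subtype) z.span_eq
    rw [Submodule.map_span, ← Set.range_comp, Submodule.map_top, Submodule.range_subtype] at this
    exact this
  refine eq_top_iff.2 ((span_mon_eq_top (Fin.append y (fun i => (z i : g))) ?_).ge.trans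
    (Submodule.span_mono ?_))
  · rw [span_range_append, hzs, hK.sup_eq_top]
  · rintro _ ⟨γ, rfl⟩
    refine ⟨mon (fun i => ι (z i)) (fun i => γ (Fin.natAdd _ i)),
      fun i => γ (Fin.castAdd _ i), ?_⟩
    rw [comp_fin_append, mon_fin_add]
    simp only [map_mon, envelopingIncl_ι]

/-- A functional on `U(g)`, equivariant for the left multiplication by `K`, is determined by its
values on the ordered monomials in a basis of a complement of `K`. -/
lemma functional_left_eq_zero
    (hK : IsCompl (Submodule.span ℂ (Set.range y)) K.toSubmodule)
    (χ : K →ₗ⁅ℂ⁆ T) (θ : U g →ₗ[ℂ] T)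
    (hθ : ∀ u (k : K), θ (ι (k : g) * u) = χ k * θ u)
    (h0 : ∀ α, θ (mon (fun i => ι (y i)) α) = 0) : θ = 0 := by
  have key : ∀ w : U K, ∀ u, θ u = 0 → θ (envelopingIncl K w * u) = 0 := by
    intro w
    have hw : w ∈ Algebra.adjoin ℂ (Set.range (ι : K →ₗ⁅ℂ⁆ U K)) := by
      rw [adjoin_range_ι]; trivial
    induction hw using Algebra.adjoin_induction with
    | mem a ha =>
      obtain ⟨k, rfl⟩ := ha
      intro u hu
      rw [envelopingIncl_ι, hθ, hu, mul_zero]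
    | algebraMap c =>
      intro u hu
      rw [AlgHom.commutes, ← Algebra.smul_def, map_smul, hu, smul_zero]
    | add a b _ _ ha hb => intro u hu; rw [map_add, add_mul, map_add, ha u hu, hb u hu, add_zero]
    | mul a b _ _ ha hb =>
      intro u hu
      rw [map_mul (envelopingIncl K), mul_assoc]
      exact ha _ (hb u hu)
  refine LinearMap.ext_on (span_envelopingIncl_mul_mon hK) ?_
  rintro _ ⟨w, α, rfl⟩
  exact key w _ (h0 α)

end

end Functionals

/-! ### Deformed weight spaces -/

section Weights

local notation "U" => UniversalEnvelopingAlgebra ℂ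

local notation "ι" => UniversalEnvelopingAlgebra.ι ℂ

variable {g : Type*} [LieRing g] [LieAlgebra ℂ g] {H : LieSubalgebra ℂ g}
variable {T : Type*} [CommRing T] [Algebra ℂ T]
variable {M : Type*} [AddCommGroup M] [Module ℂ M] [Module T M] [IsScalarTower ℂ T M]
variable {N : Type*} [AddCommGroup N] [Module ℂ N] [Module T N] [IsScalarTower ℂ T N]
variable {φ : SymmetricAlgebra ℂ H →ₐ[ℂ] T} {ρ : g →ₗ⁅ℂ⁆ Module.End T M}
  {σ : g →ₗ⁅ℂ⁆ Module.End T N}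

lemma mem_weightSpace {l : Module.Dual ℂ H} {m : M} :
    m ∈ weightSpace φ ρ l ↔ ∀ h : H, ρ h m = defChar φ l h • m := by
  refine forall_congr' fun h => ?_
  rw [sub_eq_iff_eq_add, defChar, add_smul, algebraMap_smul, add_comm]

/-- The deformation `φ` cancels, leaving a complex scalar. It is invertible as soon as it is
nonzero, whatever `T` is; all separation of weights rests on this. -/
lemma defChar_sub (l l' : Module.Dual ℂ H) (h : H) :
    defChar φ l h - defChar φ l' h = algebraMap ℂ T (l h - l' h) := by
  rw [defChar, defChar, map_sub]
  abel

/-- Lagrange interpolation: for each `ν` in `s`, one factor `h - ν(h) - φ(h)` divided by `μ(h) -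
ν(h)`, with `h` chosen to separate `μ` from `ν`. -/
lemma exists_weight_projector (s : Finset (Module.Dual ℂ H)) {μ : Module.Dual ℂ H} (hμ : μ ∉ s)
    {K : Submodule T M} (hK : ∀ (h : H), ∀ m ∈ K, ρ h m ∈ K) :
    ∃ D : Module.End T M, (∀ m ∈ K, D m ∈ K) ∧ (∀ ν ∈ s, ∀ m ∈ weightSpace φ ρ ν, D m = 0) ∧
      ∀ m ∈ weightSpace φ ρ μ, D m = m := by
  classical
  induction s using Finset.induction_on with
  | empty => exact ⟨1, by simp⟩
  | insert ν s hν ih =>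
    obtain ⟨D, hD1, hD2, hD3⟩ := ih fun h => hμ (Finset.mem_insert_of_mem h)
    have hne : μ ≠ ν := fun h => hμ (h ▸ Finset.mem_insert_self _ _)
    obtain ⟨h, hh⟩ : ∃ h, μ h ≠ ν h := by
      by_contra hcon
      push Not at hcon
      exact hne (LinearMap.ext hcon)
    let E : Module.End T M := ρ h - defChar φ ν h • 1
    have hE : ∀ m, E m = ρ h m - defChar φ ν h • m := fun m => rfl
    have hE2 : ∀ ν' m, m ∈ weightSpace φ ρ ν' → E m = (ν' h - ν h) • m := by
      intro ν' m hm
      rw [hE, mem_weightSpace.1 hm h, ← sub_smul, defChar_sub, algebraMap_smul]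
    refine ⟨D * algebraMap ℂ T (μ h - ν h)⁻¹ • E, fun m hm => ?_, fun ν' hν' m hm => ?_,
      fun m hm => ?_⟩
    · exact hD1 _ (K.smul_mem _ (sub_mem (hK h m hm) (K.smul_mem _ hm)))
    · change D (algebraMap ℂ T (μ h - ν h)⁻¹ • E m) = 0
      rw [hE2 ν' m hm, map_smul]
      rcases Finset.mem_insert.1 hν' with rfl | hν'
      · simp
      · rw [hD2 ν' hν' _ ((weightSpace φ ρ ν').smul_of_tower_mem _ hm), smul_zero]
    · change D (algebraMap ℂ T (μ h - ν h)⁻¹ • E m) = m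
      rw [hE2 μ m hm, algebraMap_smul, smul_smul, inv_mul_cancel₀ (sub_ne_zero.2 hh), one_smul,
        hD3 m hm]

/-- The projectors are polynomials in `H`, so `H`-stable subspaces contain the weight components of
their elements. -/
lemma mem_of_sum_weight_mem {K : Submodule T M} (hK : ∀ (h : H), ∀ m ∈ K, ρ h m ∈ K)
    {s : Finset (Module.Dual ℂ H)} {v : Module.Dual ℂ H → M} (hv : ∀ ν, v ν ∈ weightSpace φ ρ ν)
    (hs : ∑ ν ∈ s, v ν ∈ K) {μ : Module.Dual ℂ H} (hμ : μ ∈ s) : v μ ∈ K := by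
  classical
  obtain ⟨D, hD1, hD2, hD3⟩ :=
    exists_weight_projector (φ := φ) (s.erase μ) (Finset.notMem_erase μ s) hK
  have h := hD1 _ hs
  rw [map_sum, Finset.sum_eq_single_of_mem μ hμ, hD3 _ (hv μ)] at h
  · exact h
  · intro ν hν hne
    exact hD2 ν (Finset.mem_erase.2 ⟨hne, hν⟩) _ (hv ν)

lemma exists_sum_weight (hM : ⨆ l, weightSpace φ ρ l = ⊤) (m : M) :
    ∃ (s : Finset (Module.Dual ℂ H)) (v : Module.Dual ℂ H → M),
      (∀ ν, v ν ∈ weightSpace φ ρ ν) ∧ ∑ ν ∈ s, v ν = m := by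
  have hm : m ∈ ⨆ l, weightSpace φ ρ l := hM ▸ Submodule.mem_top
  obtain ⟨f, hf, rfl⟩ := (Submodule.mem_iSup_iff_exists_finsupp _ _).1 hm
  exact ⟨f.support, f, hf, rfl⟩

/-- A vector of a stable subspace which has weight `μ` modulo a stable subspace `K₀` can be
modified by an element of `K₀` to a vector of weight `μ`. -/
lemma exists_weight_lift (hM : ⨆ l, weightSpace φ ρ l = ⊤) {K₀ K : Submodule T M}
    (hK₀ : ∀ (h : H), ∀ m ∈ K₀, ρ h m ∈ K₀) (hK : ∀ (h : H), ∀ m ∈ K, ρ h m ∈ K) {m : M}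
    (hm : m ∈ K) {μ : Module.Dual ℂ H} (hμ : ∀ h : H, ρ h m - defChar φ μ h • m ∈ K₀) :
    ∃ m' ∈ K, m' ∈ weightSpace φ ρ μ ∧ m - m' ∈ K₀ := by
  classical
  obtain ⟨s, v, hv, rfl⟩ := exists_sum_weight hM m
  -- Applying `h - μ(h) - φ(h)` scales the component of weight `ν` by `ν h - μ h` and lands in `K₀`;
  -- hence only the component of weight `μ` survives modulo `K₀`.
  have h1 : ∀ ν ∈ s, ν ≠ μ → v ν ∈ K₀ := by
    intro ν hν hne
    obtain ⟨h, hh⟩ : ∃ h, ν h ≠ μ h := by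
      by_contra hcon
      push Not at hcon
      exact hne (LinearMap.ext hcon)
    have h2 := hμ h
    rw [map_sum, Finset.smul_sum, ← Finset.sum_sub_distrib] at h2
    have h3 : ∀ ν, ρ h (v ν) - defChar φ μ h • v ν = (ν h - μ h) • v ν := by
      intro ν
      rw [mem_weightSpace.1 (hv ν) h, ← sub_smul, defChar_sub, algebraMap_smul]
    simp only [h3] at h2
    have h4 := mem_of_sum_weight_mem hK₀
      (fun ν => (weightSpace φ ρ ν).smul_of_tower_mem (ν h - μ h) (hv ν)) h2 hν
    have h5 := K₀.smul_of_tower_mem (ν h - μ h)⁻¹ h4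
    rwa [smul_smul, inv_mul_cancel₀ (sub_ne_zero.2 hh), one_smul] at h5
  by_cases hμs : μ ∈ s
  · refine ⟨v μ, mem_of_sum_weight_mem hK hv hm hμs, hv μ, ?_⟩
    rw [← Finset.add_sum_erase s v hμs, add_sub_cancel_left]
    exact sum_mem fun ν hν => h1 ν (Finset.mem_of_mem_erase hν) (Finset.ne_of_mem_erase hν)
  -- Without a component of weight `μ`, the whole vector already lies in `K₀`.
  · refine ⟨0, zero_mem _, zero_mem _, ?_⟩
    rw [sub_zero]
    exact sum_mem fun ν hν => h1 ν hν fun h => hμs (h ▸ hν)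

/-- The action of the enveloping algebra on a bimodule. -/
def repU (ρ : g →ₗ⁅ℂ⁆ Module.End T M) : U g →ₐ[ℂ] Module.End T M :=
  UniversalEnvelopingAlgebra.lift ℂ ρ

@[simp] lemma repU_ι (x : g) : repU ρ (ι x) = ρ x :=
  UniversalEnvelopingAlgebra.lift_ι_apply _ _ _

lemma repU_mul_apply (u v : U g) (m : M) : repU ρ (u * v) m = repU ρ u (repU ρ v m) := by
  rw [map_mul]
  rfl

/-- Induction principle for statements about the action of the enveloping algebra. -/
lemma enveloping_induction {p : U g → Prop} (halg : ∀ c, p (algebraMap ℂ (U g) c))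
    (hι : ∀ x, p (ι x)) (hadd : ∀ u v, p u → p v → p (u + v)) (hmul : ∀ u v, p u → p v → p (u * v))
    (u : U g) : p u := by
  have hu : u ∈ Algebra.adjoin ℂ (Set.range (ι : g →ₗ⁅ℂ⁆ U g)) := by
    rw [adjoin_range_ι]; trivial
  induction hu using Algebra.adjoin_induction with
  | mem a ha => obtain ⟨x, rfl⟩ := ha; exact hι x
  | algebraMap c => exact halg c
  | add a b _ _ ha hb => exact hadd a b ha hb
  | mul a b _ _ ha hb => exact hmul a b ha hb

lemma repU_mem {K : Submodule T M} (hK : ∀ x, ∀ m ∈ K, ρ x m ∈ K) (u : U g) :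
    ∀ m ∈ K, repU ρ u m ∈ K := by
  refine enveloping_induction (p := fun u => ∀ m ∈ K, repU ρ u m ∈ K) (fun c m hm => ?_)
    (fun x => ?_) (fun u v hu hv m hm => ?_)
    (fun u v hu hv m hm => ?_) u
  · rw [AlgHom.commutes]
    exact K.smul_of_tower_mem c hm
  · rw [repU_ι]
    exact hK x
  · rw [map_add]
    exact add_mem (hu m hm) (hv m hm)
  · rw [repU_mul_apply]
    exact hu _ (hv m hm)

/-- A map which intertwines the actions of `g` on a stable subspace intertwines the actions of
`U(g)`. -/
lemma intertwine_repU {K : Submodule T M} (hK : ∀ x, ∀ m ∈ K, ρ x m ∈ K) {F : K →ₗ[T] N}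
    (hF : ∀ x (m : K), F ⟨ρ x m, hK x m m.2⟩ = σ x (F m)) (u : U g) :
    ∀ m : K, F ⟨repU ρ u m, repU_mem hK u m m.2⟩ = repU σ u (F m) := by
  refine enveloping_induction (p := fun u => ∀ m : K, F ⟨repU ρ u m, repU_mem hK u m m.2⟩ =
    repU σ u (F m)) (fun c m => ?_) (fun x m => ?_) (fun u v hu hv m => ?_)
    (fun u v hu hv m => ?_) u
  · simp only [AlgHom.commutes, Module.algebraMap_end_apply]
    rw [← algebraMap_smul T c (F m), ← map_smul]
    congr 1
    exact Subtype.ext (algebraMap_smul T c (m : M)).symm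
  · simp only [repU_ι]
    exact hF x m
  · have h : (⟨repU ρ (u + v) m, repU_mem hK _ m m.2⟩ : K) =
        ⟨repU ρ u m, repU_mem hK u m m.2⟩ + ⟨repU ρ v m, repU_mem hK v m m.2⟩ :=
      Subtype.ext (by simp)
    rw [h, map_add, hu, hv, map_add, LinearMap.add_apply]
  · have h : (⟨repU ρ (u * v) m, repU_mem hK _ m m.2⟩ : K) =
        ⟨repU ρ u (⟨repU ρ v m, repU_mem hK v m m.2⟩ : K),
          repU_mem hK u _ (repU_mem hK v m m.2)⟩ :=
      Subtype.ext (repU_mul_apply u v (m : M))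
    rw [h, hu, hv, repU_mul_apply]

lemma bimodHom_repU {f : M →ₗ[T] N} (hf : f ∈ bimodHom ρ σ) (u : U g) (m : M) :
    f (repU ρ u m) = repU σ u (f m) :=
  intertwine_repU (K := ⊤) (fun _ _ _ => Submodule.mem_top) (F := f ∘ₗ Submodule.subtype ⊤)
    (fun x m => hf x m) u ⟨m, Submodule.mem_top⟩

/-- The weight of the ordered monomial with exponent `α`. -/
def monWeight {p : ℕ} (w : Fin p → Module.Dual ℂ H) (α : Fin p → ℕ) : Module.Dual ℂ H :=
  ∑ i, α i • w i

/-- Passing `h` across a factor costs that factor's eigenvalue, and these costs add up along the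
monomial. -/
lemma ι_mul_mon {p : ℕ} {z : Fin p → g} {h : g} {c : Fin p → ℂ}
    (hz : ∀ i, ⁅h, z i⁆ = c i • z i) (α : Fin p → ℕ) :
    ι h * mon (fun i => ι (z i)) α =
      mon (fun i => ι (z i)) α * ι h + (∑ i, α i • c i) • mon (fun i => ι (z i)) α := by
  have hsum : ((monList α).map c).sum = ∑ i, α i • c i := by
    rw [monList, List.map_flatten, List.sum_flatten, List.map_ofFn, List.map_ofFn, List.sum_ofFn]
    simp
  rw [← hsum, mon]
  induction monList α with
  | nil => simp
  | cons i L ih =>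
    have h1 := LieHom.map_lie (ι : g →ₗ⁅ℂ⁆ U g) h (z i)
    rw [hz, LieRing.of_associative_ring_bracket, eq_sub_iff_add_eq, map_smul] at h1
    simp only [List.map_cons, List.prod_cons, List.sum_cons]
    rw [← mul_assoc, ← h1, add_mul, mul_assoc, ih, add_smul, mul_add, mul_smul_comm,
      smul_mul_assoc, mul_assoc]
    abel

end Weights

/-! ### Triangular decompositions -/

section Triangular

local notation "U" => UniversalEnvelopingAlgebra ℂ

local notation "ι" => UniversalEnvelopingAlgebra.ι ℂ

variable {g : Type*} [LieRing g] [LieAlgebra ℂ g]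

/-- Bases of weight vectors in the derived algebras of two opposite Borel subalgebras. -/
structure Triangular (H B Bop : LieSubalgebra ℂ g) where
  /-- the dimension of `[Bop, Bop]` -/
  p : ℕ
  /-- the dimension of `[B, B]` -/
  q : ℕ
  /-- the basis of `[Bop, Bop]` -/
  f : Fin p → g
  /-- the basis of `[B, B]` -/
  e : Fin q → g
  /-- the weights of the vectors `f i` -/
  wf : Fin p → Module.Dual ℂ H
  /-- the weights of the vectors `e i` -/
  we : Fin q → Module.Dual ℂ H
  lie_f : ∀ (h : H) i, ⁅(h : g), f i⁆ = wf i h • f i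
  lie_e : ∀ (h : H) i, ⁅(h : g), e i⁆ = we i h • e i
  indep_f : LinearIndependent ℂ f
  indep_e : LinearIndependent ℂ e
  span_f : Submodule.span ℂ (Set.range f) = derivedSubspace Bop
  span_e : Submodule.span ℂ (Set.range e) = derivedSubspace B
  sup_B : H.toSubmodule ⊔ derivedSubspace B = B.toSubmodule
  disj_B : Disjoint H.toSubmodule (derivedSubspace B)
  sup_Bop : H.toSubmodule ⊔ derivedSubspace Bop = Bop.toSubmodule
  disj_Bop : Disjoint H.toSubmodule (derivedSubspace Bop)
  compl_f : IsCompl (derivedSubspace Bop) B.toSubmodule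
  compl_e : IsCompl (derivedSubspace B) Bop.toSubmodule
  finite_e : ∀ w, {δ | monWeight we δ = w}.Finite

variable {H B Bop : LieSubalgebra ℂ g}
variable {T : Type*} [CommRing T] [Algebra ℂ T] (φ : SymmetricAlgebra ℂ H →ₐ[ℂ] T)
variable (l : Module.Dual ℂ H)

/-- Projecting to `H` along a complement containing the derived subspace kills brackets, and
commutators vanish in the commutative ring `T`. -/
lemma exists_lie_char {K : LieSubalgebra ℂ g}
    (hdisj : Disjoint H.toSubmodule (derivedSubspace K))
    (hsup : H.toSubmodule ⊔ derivedSubspace K = K.toSubmodule) :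
    ∃ χ : K →ₗ⁅ℂ⁆ T, (∀ (h : H), ∀ x ∈ derivedSubspace K, ∀ k : K, (k : g) = h + x →
      χ k = defChar φ l h) ∧ ∀ k : K, ∃ h : H, ∃ x ∈ derivedSubspace K, (k : g) = h + x := by
  obtain ⟨C, hC1, hC2⟩ := hdisj.symm.exists_isCompl
  have hchar : ∃ Λ : H →ₗ[ℂ] T, ∀ h, Λ h = defChar φ l h :=
    ⟨Algebra.linearMap ℂ T ∘ₗ l + φ.toLinearMap ∘ₗ SymmetricAlgebra.ι ℂ H, fun h => rfl⟩
  obtain ⟨Λ, hΛ⟩ := hchar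
  have hpr : ∃ pr : g →ₗ[ℂ] H, (∀ h : H, pr h = h) ∧ ∀ x ∈ derivedSubspace K, pr x = 0 :=
    ⟨H.toSubmodule.projectionOnto C hC2.symm,
      fun h => Submodule.projectionOnto_apply_left hC2.symm h,
      fun x hx => (Submodule.projectionOnto_apply_eq_zero_iff hC2.symm).2 (hC1 hx)⟩
  obtain ⟨pr, hpr1, hpr2⟩ := hpr
  refine ⟨{ toLinearMap := Λ ∘ₗ pr ∘ₗ K.toSubmodule.subtype, map_lie' := fun {x y} => ?_ }, ?_, ?_⟩
  · change Λ (pr ⁅(x : g), (y : g)⁆) = _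
    rw [hpr2 _ (Submodule.subset_span ⟨x, x.2, y, y.2, rfl⟩), map_zero,
      LieRing.of_associative_ring_bracket, mul_comm, sub_self]
  · intro h x hx k hk
    change Λ (pr k) = _
    rw [hk, map_add, hpr1, hpr2 x hx, add_zero, hΛ]
  · intro k
    have hk : (k : g) ∈ H.toSubmodule ⊔ derivedSubspace K := hsup ▸ k.2
    obtain ⟨h, hh, x, hx, hk⟩ := Submodule.mem_sup.1 hk
    exact ⟨⟨h, hh⟩, x, hx, hk.symm⟩

/-! ### Monomial bases of deformed Verma modules. -/

section Verma

variable (B)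

/-- The canonical generator of the deformed Verma module. -/
def vermaGen : Verma B φ l := (vermaRel B φ l).mkQ (1 ⊗ₜ 1)

lemma repU_vermaRep (u : U g) (t : T) (w : U g) :
    repU (vermaRep B φ l) u ((vermaRel B φ l).mkQ (t ⊗ₜ w)) =
      (vermaRel B φ l).mkQ (t ⊗ₜ (u * w)) := by
  induction u using enveloping_induction generalizing w with
  | halg c =>
    rw [AlgHom.commutes, Module.algebraMap_end_apply, ← Algebra.smul_def, TensorProduct.tmul_smul]
    rfl
  | hι x =>
    rw [repU_ι]
    rfl
  | hadd u v hu hv =>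
    rw [map_add, LinearMap.add_apply, hu, hv, add_mul, TensorProduct.tmul_add, map_add]
  | hmul u v hu hv => rw [repU_mul_apply, hv, hu, mul_assoc]

lemma mkQ_tmul_mul (h : H) {x : g} (hx : x ∈ derivedSubspace B) (t : T) (u : U g) :
    (vermaRel B φ l).mkQ (t ⊗ₜ (u * ι ((h : g) + x))) =
      (vermaRel B φ l).mkQ ((defChar φ l h * t) ⊗ₜ u) := by
  rw [← sub_eq_zero, ← map_sub]
  exact (Submodule.Quotient.mk_eq_zero _).2 (Submodule.subset_span ⟨t, u, h, x, hx, rfl⟩)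

lemma vermaGen_mem : vermaGen B φ l ∈ weightSpace φ (vermaRep B φ l) l := by
  rw [mem_weightSpace]
  intro h
  have h1 := mkQ_tmul_mul B φ l h (zero_mem (derivedSubspace B)) 1 1
  rw [← repU_ι, vermaGen, repU_vermaRep, mul_one]
  rw [add_zero, one_mul] at h1
  rw [h1, ← smul_eq_mul, ← TensorProduct.smul_tmul', map_smul]

variable {B}

/-- PBW for the decomposition of `g` into `[Bop, Bop]` and `B`: factors from `U(B)` are absorbed
into `T`, and equivariant functionals dual to the monomials prove independence. -/
lemma exists_basis_verma [FiniteDimensional ℂ g] [LieAlgebra.IsSemisimple ℂ g]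
    (D : Triangular H B Bop) :
    ∃ b : Module.Basis (Fin D.p → ℕ) T (Verma B φ l), ∀ α,
      b α = repU (vermaRep B φ l) (mon (fun i => ι (D.f i)) α) (vermaGen B φ l) := by
  obtain ⟨χ, hχ, hdec⟩ := exists_lie_char φ l D.disj_B D.sup_B
  have hcompl : IsCompl (Submodule.span ℂ (Set.range D.f)) B.toSubmodule := by
    rw [D.span_f]; exact D.compl_f
  have hgen : ∀ α, repU (vermaRep B φ l) (mon (fun i => ι (D.f i)) α) (vermaGen B φ l) =
      (vermaRel B φ l).mkQ (1 ⊗ₜ mon (fun i => ι (D.f i)) α) := by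
    intro α
    rw [vermaGen, repU_vermaRep, mul_one]
  have hli : LinearIndependent T fun α =>
      repU (vermaRep B φ l) (mon (fun i => ι (D.f i)) α) (vermaGen B φ l) := by
    rw [linearIndependent_iff]
    intro c hc
    ext β
    obtain ⟨θ, hθ1, hθ2⟩ := exists_functional_right D.indep_f hcompl χ
      (fun α => if α = β then 1 else 0)
    -- Equivariance of `θ` on the right is exactly what makes its `T`-linear extension kill the
    -- Verma relations; on the quotient it reads off the coefficient at `β`.
    let Θ : T ⊗[ℂ] U g →ₗ[T] T := TensorProduct.AlgebraTensorModule.lift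
      ((LinearMap.lsmul T (U g →ₗ[ℂ] T)).flip θ)
    have hΘ : ∀ t u, Θ (t ⊗ₜ u) = t * θ u := fun t u => rfl
    have hrel : vermaRel B φ l ≤ LinearMap.ker Θ := by
      refine Submodule.span_le.2 ?_
      rintro _ ⟨t, u, h, x, hx, rfl⟩
      have hk : (h : g) + x ∈ B := by
        rw [← LieSubalgebra.mem_toSubmodule, ← D.sup_B]
        exact add_mem (Submodule.mem_sup_left h.2) (Submodule.mem_sup_right hx)
      have h1 := hθ2 u ⟨_, hk⟩
      rw [hχ h x hx ⟨_, hk⟩ rfl] at h1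
      rw [SetLike.mem_coe, LinearMap.mem_ker, map_sub, hΘ, hΘ, h1]
      ring
    have h1 := congrArg ((vermaRel B φ l).liftQ Θ hrel) hc
    rw [Finsupp.linearCombination_apply, Finsupp.sum, map_sum, map_zero] at h1
    rw [Finset.sum_congr rfl fun α _ => by
      rw [map_smul, hgen, Submodule.mkQ_apply, Submodule.liftQ_apply, hΘ, hθ1, one_mul,
        smul_eq_mul, mul_ite, mul_one, mul_zero], Finset.sum_ite_eq'] at h1
    rw [Finsupp.zero_apply]
    by_contra hne
    rw [if_pos (Finsupp.mem_support_iff.2 hne)] at h1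
    exact hne h1
  refine ⟨Module.Basis.mk hli ?_, fun α => Module.Basis.mk_apply _ _ _⟩
  have key : ∀ w : U B, ∀ t u, ∃ t' : T, (vermaRel B φ l).mkQ (t ⊗ₜ (u * envelopingIncl B w)) =
      (vermaRel B φ l).mkQ (t' ⊗ₜ u) := by
    intro w
    induction w using enveloping_induction with
    | halg c =>
      intro t u
      refine ⟨c • t, ?_⟩
      rw [AlgHom.commutes, ← Algebra.commutes, ← Algebra.smul_def, TensorProduct.smul_tmul]
    | hι k =>
      intro t u
      obtain ⟨h, x, hx, hk⟩ := hdec k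
      exact ⟨_, by rw [envelopingIncl_ι, hk, mkQ_tmul_mul B φ l h hx]⟩
    | hadd a b ha hb =>
      intro t u
      obtain ⟨t1, h1⟩ := ha t u
      obtain ⟨t2, h2⟩ := hb t u
      refine ⟨t1 + t2, ?_⟩
      rw [map_add (envelopingIncl B), mul_add, TensorProduct.tmul_add, map_add, h1, h2,
        TensorProduct.add_tmul, map_add]
    | hmul a b ha hb =>
      intro t u
      obtain ⟨t1, h1⟩ := hb t (u * envelopingIncl B a)
      obtain ⟨t2, h2⟩ := ha t1 u
      exact ⟨t2, by rw [map_mul, ← mul_assoc, h1, h2]⟩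
  rintro z -
  obtain ⟨z, rfl⟩ := (vermaRel B φ l).mkQ_surjective z
  induction z with
  | zero => simp
  | add a b ha hb =>
    rw [map_add]
    exact add_mem ha hb
  | tmul t u =>
    have hu : u ∈ Submodule.span ℂ
        {u | ∃ w α, u = mon (fun i => ι (D.f i)) α * envelopingIncl B w} := by
      rw [span_mon_mul_envelopingIncl hcompl]; trivial
    induction hu using Submodule.span_induction generalizing t with
    | mem u hu =>
      obtain ⟨w, α, rfl⟩ := hu
      obtain ⟨t', ht'⟩ := key w t (mon (fun i => ι (D.f i)) α)
      rw [ht', ← mul_one t', ← smul_eq_mul, ← TensorProduct.smul_tmul', map_smul, ← hgen]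
      exact Submodule.smul_mem _ _ (Submodule.subset_span ⟨α, rfl⟩)
    | zero => simp
    | add a b _ _ ha hb =>
      rw [TensorProduct.tmul_add, map_add]
      exact add_mem (ha t) (hb t)
    | smul c a _ ha =>
      rw [← TensorProduct.smul_tmul]
      exact ha _

end Verma

/-! ### Monomial coordinates on nabla modules and Frobenius reciprocity. -/

section Nabla

variable {φ l}

lemma coind_apply (f : Coind Bop φ l) (h : H) {x : g} (hx : x ∈ derivedSubspace Bop) (u : U g) :
    f.1 (ι ((h : g) + x) * u) = defChar φ l h * f.1 u :=
  f.2 h x hx u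

lemma coindRep_apply (y : g) (f : Coind Bop φ l) (u : U g) :
    (coindRep Bop φ l y f).1 u = f.1 (u * ι y) := rfl

/-- The value of an element of the coinduced module at a fixed element of `U(g)`. -/
def coindEval (u : U g) : Coind Bop φ l →ₗ[T] T where
  toFun f := f.1 u
  map_add' _ _ := rfl
  map_smul' _ _ := rfl

lemma coind_ext_mon [FiniteDimensional ℂ g] (D : Triangular H B Bop) {f f' : Coind Bop φ l}
    (h : ∀ γ, f.1 (mon (fun i => ι (D.e i)) γ) = f'.1 (mon (fun i => ι (D.e i)) γ)) :
    f = f' := by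
  obtain ⟨χ, hχ, hdec⟩ := exists_lie_char φ l D.disj_Bop D.sup_Bop
  have hcompl : IsCompl (Submodule.span ℂ (Set.range D.e)) Bop.toSubmodule := by
    rw [D.span_e]; exact D.compl_e
  refine Subtype.ext (sub_eq_zero.1 (functional_left_eq_zero hcompl χ _ (fun u k => ?_)
    fun γ => ?_))
  · obtain ⟨h, x, hx, hk⟩ := hdec k
    rw [hχ h x hx k hk, hk, LinearMap.sub_apply, LinearMap.sub_apply, coind_apply f h hx,
      coind_apply f' h hx, mul_sub]
  · rw [LinearMap.sub_apply, h, sub_self]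

lemma coind_mon_mul (D : Triangular H B Bop) (f : Coind Bop φ l) (h : H) (γ : Fin D.q → ℕ) :
    f.1 (mon (fun i => ι (D.e i)) γ * ι (h : g)) =
      defChar φ (l - monWeight D.we γ) h * f.1 (mon (fun i => ι (D.e i)) γ) := by
  have h1 := coind_apply f h (zero_mem _) (mon (fun i => ι (D.e i)) γ)
  have h2 : ∑ i, γ i • D.we i h = monWeight D.we γ h := by simp [monWeight]
  rw [add_zero, ι_mul_mon (D.lie_e h), h2, map_add, map_smul, ← eq_sub_iff_add_eq] at h1
  rw [h1, Algebra.smul_def, ← sub_mul, defChar, defChar, LinearMap.sub_apply, map_sub]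
  ring

/-- The value at the monomial `γ` is scaled by `h` both through `m` and through `l - monWeight D.we
γ`; if these differ, a nonzero complex scalar annihilates it. -/
lemma eq_of_mem_weightSpace_coind (D : Triangular H B Bop) {m : Module.Dual ℂ H}
    {f : Coind Bop φ l} (hf : f ∈ weightSpace φ (coindRep Bop φ l) m) {γ : Fin D.q → ℕ}
    (hγ : f.1 (mon (fun i => ι (D.e i)) γ) ≠ 0) : monWeight D.we γ = l - m := by
  by_contra hne
  obtain ⟨h, hh⟩ : ∃ h, (l - monWeight D.we γ) h ≠ m h := by
    by_contra hcon
    push Not at hcon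
    refine hne ?_
    rw [← LinearMap.ext hcon, sub_sub_cancel]
  have h1 := congrArg (fun f : Coind Bop φ l => f.1 (mon (fun i => ι (D.e i)) γ))
    (mem_weightSpace.1 hf h)
  have h2 : defChar φ (l - monWeight D.we γ) h * f.1 (mon (fun i => ι (D.e i)) γ) =
      defChar φ m h * f.1 (mon (fun i => ι (D.e i)) γ) := by
    rw [← coind_mon_mul]
    exact h1
  rw [← sub_eq_zero, ← sub_mul, defChar_sub, ← Algebra.smul_def] at h2
  have h3 := congrArg (fun t => ((l - monWeight D.we γ) h - m h)⁻¹ • t) h2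
  rw [smul_smul, inv_mul_cancel₀ (sub_ne_zero.2 hh), one_smul, smul_zero] at h3
  exact hγ h3

/-- A weight vector is supported on monomials of a single weight, of which there are finitely many
by `D.finite_e`. This is how the sum of weight spaces becomes free, unlike the full coinduced
module. -/
lemma finite_support_nabla (D : Triangular H B Bop) (f : nabla Bop φ l) :
    (Function.support fun γ => f.1.1 (mon (fun i => ι (D.e i)) γ)).Finite := by
  obtain ⟨f, hf⟩ := f
  change (Function.support fun γ => f.1 (mon (fun i => ι (D.e i)) γ)).Finite
  rw [nabla] at hf
  induction hf using Submodule.iSup_induction' with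
  | mem m f hf =>
    exact (D.finite_e (l - m)).subset fun γ hγ => eq_of_mem_weightSpace_coind D hf hγ
  | zero =>
    convert Set.finite_empty
    exact Function.support_eq_empty_iff.2 rfl
  | add f f' _ _ h1 h2 =>
    exact (h1.union h2).subset (Function.support_add _ _)

lemma exists_basis_nabla [FiniteDimensional ℂ g] [LieAlgebra.IsSemisimple ℂ g]
    (D : Triangular H B Bop) :
    ∃ b : Module.Basis (Fin D.q → ℕ) T (nabla Bop φ l), ∀ f γ,
      b.repr f γ = f.1.1 (mon (fun i => ι (D.e i)) γ) := by
  classical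
  obtain ⟨χ, hχ, hdec⟩ := exists_lie_char φ l D.disj_Bop D.sup_Bop
  have hcompl : IsCompl (Submodule.span ℂ (Set.range D.e)) Bop.toSubmodule := by
    rw [D.span_e]; exact D.compl_e
  let Λ : nabla Bop φ l →ₗ[T] ((Fin D.q → ℕ) →₀ T) :=
    { toFun := fun f => Finsupp.ofSupportFinite _ (finite_support_nabla D f)
      map_add' := fun _ _ => Finsupp.ext fun _ => rfl
      map_smul' := fun _ _ => Finsupp.ext fun _ => rfl }
  have hΛ : ∀ f γ, Λ f γ = f.1.1 (mon (fun i => ι (D.e i)) γ) := fun _ _ => rfl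
  have hinj : Function.Injective Λ := fun f f' h =>
    Subtype.ext (coind_ext_mon D fun γ => by rw [← hΛ, ← hΛ, h])
  have hsurj : Function.Surjective Λ := by
    intro c
    rw [← LinearMap.mem_range]
    induction c using Finsupp.induction_linear with
    | zero => exact zero_mem _
    | add c c' h1 h2 => exact add_mem h1 h2
    | single γ t =>
      obtain ⟨θ, hθ1, hθ2⟩ := exists_functional_left D.indep_e hcompl χ
        (fun δ => if γ = δ then 1 else 0)
      have hθ3 : θ ∈ coindSub Bop φ l := by
        intro h x hx u
        have hk : (h : g) + x ∈ Bop := by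
          rw [← LieSubalgebra.mem_toSubmodule, ← D.sup_Bop]
          exact add_mem (Submodule.mem_sup_left h.2) (Submodule.mem_sup_right hx)
        rw [← hχ h x hx ⟨_, hk⟩ rfl, ← hθ2]
      let d : Coind Bop φ l := ⟨θ, hθ3⟩
      -- The functional dual to one monomial is a weight vector, so it belongs to the nabla module.
      have hd : d ∈ weightSpace φ (coindRep Bop φ l) (l - monWeight D.we γ) := by
        rw [mem_weightSpace]
        intro h
        refine coind_ext_mon D fun δ => ?_
        rw [coindRep_apply, coind_mon_mul]
        change _ * θ _ = _ * θ _
        rw [hθ1]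
        by_cases hδ : γ = δ
        · rw [hδ]
        · rw [if_neg hδ, mul_zero, mul_zero]
      refine ⟨t • ⟨d, Submodule.mem_iSup_of_mem _ hd⟩, ?_⟩
      ext δ
      rw [map_smul, Finsupp.smul_apply, hΛ]
      change t * θ _ = _
      rw [hθ1, Finsupp.single_apply, mul_ite, mul_one, mul_zero]
  exact ⟨Module.Basis.ofRepr (LinearEquiv.ofBijective Λ ⟨hinj, hsurj⟩), fun f γ => rfl⟩

/-- A functional which is equivariant under `Bop` on a stable subspace `K` of a bimodule maps the
elements of `K` to the nabla module. -/
lemma exists_nabla_of_functional {E : Type*} [AddCommGroup E] [Module ℂ E] [Module T E]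
    [IsScalarTower ℂ T E] {ρ : g →ₗ⁅ℂ⁆ Module.End T E} (hE : ⨆ m, weightSpace φ ρ m = ⊤)
    {K : Submodule T E} (hK : ∀ x, ∀ e ∈ K, ρ x e ∈ K) {ξ : E →ₗ[T] T}
    (hξ : ∀ e ∈ K, ∀ (h : H), ∀ x ∈ derivedSubspace Bop,
      ξ (ρ ((h : g) + x) e) = defChar φ l h * ξ e) {e : E} (he : e ∈ K) :
    ∃ f : nabla Bop φ l, ∀ u, f.1.1 u = ξ (repU ρ u e) := by
  -- Frobenius reciprocity: `e` is sent to the functional `u ↦ ξ(u e)`.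
  have hcoind : ∀ e ∈ K, ∃ f : Coind Bop φ l, ∀ u, f.1 u = ξ (repU ρ u e) := by
    intro e he
    refine ⟨⟨ξ.restrictScalars ℂ ∘ₗ (LinearMap.applyₗ e).restrictScalars ℂ ∘ₗ
      (repU ρ).toLinearMap, fun h x hx u => ?_⟩, fun u => rfl⟩
    change ξ (repU ρ (ι ((h : g) + x) * u) e) = defChar φ l h * ξ (repU ρ u e)
    rw [repU_mul_apply, repU_ι, hξ _ (repU_mem hK u e he) h x hx]
  -- Weight components of `e` remain in `K` and map to weight vectors, so the image lies in the
  -- nabla module and not merely in the coinduced one.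
  obtain ⟨s, v, hv, rfl⟩ := exists_sum_weight hE e
  have hvK : ∀ ν ∈ s, v ν ∈ K := fun ν hν =>
    mem_of_sum_weight_mem (fun h => hK h) hv he hν
  have hvf : ∀ ν ∈ s, ∃ f : nabla Bop φ l, ∀ u, f.1.1 u = ξ (repU ρ u (v ν)) := by
    intro ν hν
    obtain ⟨f, hf⟩ := hcoind _ (hvK ν hν)
    refine ⟨⟨f, Submodule.mem_iSup_of_mem ν (mem_weightSpace.2 fun h => ?_)⟩, hf⟩
    refine Subtype.ext (LinearMap.ext fun u => ?_)
    change f.1 (u * ι (h : g)) = defChar φ ν h * f.1 u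
    rw [hf, hf, repU_mul_apply, repU_ι, mem_weightSpace.1 (hv ν) h, map_smul, map_smul,
      smul_eq_mul]
  choose! F hF using hvf
  refine ⟨∑ ν ∈ s, F ν, fun u => ?_⟩
  change coindEval u (∑ ν ∈ s, F ν : nabla Bop φ l).1 = _
  rw [map_sum, map_sum, Submodule.coe_sum, map_sum]
  exact Finset.sum_congr rfl fun ν hν => hF ν hν u

end Nabla

end Triangular

/-! ### Filtrations -/

section Filtration

variable {T : Type*} [CommRing T] {M : Type*} [AddCommGroup M] [Module T M]
variable {n : ℕ} {I : Fin n → Type*} {F : Fin (n + 1) → Submodule T M} {v : ∀ k, I k → M}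

/-- In a relation, let `k` be the last step that occurs. All other terms lie in `F k.castSucc`, so
the part at step `k` does too, and `hli` kills it. -/
lemma linearIndependent_of_filtration (hmono : Monotone F) (hv : ∀ k i, v k i ∈ F k.succ)
    (hli : ∀ k (c : I k →₀ T), Finsupp.linearCombination T (v k) c ∈ F k.castSucc → c = 0) :
    LinearIndependent T fun x : Σ k, I k => v x.1 x.2 := by
  classical
  rw [linearIndependent_iff]
  intro c hc
  by_contra hne
  obtain ⟨x₀, hx₀, hmax⟩ := c.support.exists_max_image (fun x => x.1)
    (Finsupp.support_nonempty_iff.2 hne)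
  obtain ⟨k, i₀⟩ := x₀
  let c' : I k →₀ T := c.comapDomain (Sigma.mk k) sigma_mk_injective.injOn
  have hc' : c.filter (fun x => x.1 = k) = Finsupp.mapDomain (Sigma.mk k) c' := by
    ext ⟨j, i⟩
    by_cases hj : j = k
    · subst hj
      rw [Finsupp.filter_apply_pos (fun x : Σ k, I k => x.1 = j) _ rfl,
        Finsupp.mapDomain_apply sigma_mk_injective]
      rfl
    · rw [Finsupp.filter_apply_neg (fun x : Σ k, I k => x.1 = k) _ hj,
        Finsupp.mapDomain_of_notMem_range]
      rintro ⟨i', hi'⟩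
      exact hj (congrArg Sigma.fst hi').symm
  have h1 := Finsupp.filter_add_filter_not c (fun x => x.1 = k)
  rw [← h1, map_add, hc', Finsupp.linearCombination_mapDomain] at hc
  have h2 : Finsupp.linearCombination T (fun x : Σ k, I k => v x.1 x.2)
      (c.filter fun x => ¬ x.1 = k) ∈ F k.castSucc := by
    rw [Finsupp.linearCombination_apply]
    refine sum_mem fun x hx => Submodule.smul_mem _ _ ?_
    rw [Finsupp.support_filter, Finset.mem_filter] at hx
    have hlt : x.1 < k := lt_of_le_of_ne (hmax x hx.1) hx.2
    exact hmono (Fin.le_def.2 (by simpa using hlt)) (hv x.1 x.2)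
  have h3 : Finsupp.linearCombination T (v k) c' ∈ F k.castSucc := by
    have h4 := neg_mem h2
    rwa [← eq_neg_iff_add_eq_zero.2 hc] at h4
  have h5 := congrArg (fun d => d i₀) (hli k c' h3)
  exact Finsupp.mem_support_iff.1 hx₀ h5

lemma le_span_of_filtration (hbot : F 0 = ⊥)
    (hle : ∀ k, F k.succ ≤ F k.castSucc ⊔ Submodule.span T (Set.range (v k)))
    (k : Fin (n + 1)) :
    F k ≤ Submodule.span T (Set.range fun x : Σ k, I k => v x.1 x.2) := by
  induction k using Fin.induction with
  | zero => rw [hbot]; exact bot_le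
  | succ k ih =>
    refine (hle k).trans (sup_le ih (Submodule.span_mono ?_))
    rintro _ ⟨i, rfl⟩
    exact ⟨⟨k, i⟩, rfl⟩

/-- A basis adapted to a finite filtration. -/
lemma exists_basis_of_filtration (hbot : F 0 = ⊥) (htop : F (Fin.last n) = ⊤)
    (hmono : Monotone F) (hv : ∀ k i, v k i ∈ F k.succ)
    (hli : ∀ k (c : I k →₀ T), Finsupp.linearCombination T (v k) c ∈ F k.castSucc → c = 0)
    (hle : ∀ k, F k.succ ≤ F k.castSucc ⊔ Submodule.span T (Set.range (v k))) :
    ∃ b : Module.Basis (Σ k, I k) T M, ∀ x, b x = v x.1 x.2 :=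
  ⟨Module.Basis.mk (linearIndependent_of_filtration hmono hv hli)
    (htop ▸ le_span_of_filtration hbot hle (Fin.last n)), fun _ => Module.Basis.mk_apply _ _ _⟩

/-- A filtration with projective subquotients splits. -/
lemma exists_retraction (htop : F (Fin.last n) = ⊤)
    (hmono : Monotone F)
    (hproj : ∀ k : Fin n,
      Module.Projective T (F k.succ ⧸ (F k.castSucc).submoduleOf (F k.succ)))
    (k : Fin (n + 1)) : ∃ r : M →ₗ[T] F k, ∀ m : F k, r m = m := by
  induction k using Fin.reverseInduction with
  | last => exact ⟨LinearMap.codRestrict _ LinearMap.id fun m => htop ▸ Submodule.mem_top,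
      fun m => rfl⟩
  | cast k ih =>
    obtain ⟨r, hr⟩ := ih
    have := hproj k
    -- With a section `s` of the quotient, `m ↦ m - s [m]` retracts `F k.succ` onto `F k.castSucc`;
    -- it is then composed with the retraction already found.
    obtain ⟨s, hs⟩ := Module.projective_lifting_property
      ((F k.castSucc).submoduleOf (F k.succ)).mkQ LinearMap.id (Submodule.mkQ_surjective _)
    have hs' : ∀ m : F k.succ, ((m - s (Submodule.mkQ _ m) : F k.succ) : M) ∈ F k.castSucc := by
      intro m
      have h1 : ((F k.castSucc).submoduleOf (F k.succ)).mkQ (m - s (Submodule.mkQ _ m)) = 0 := by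
        rw [map_sub, ← LinearMap.comp_apply, hs, LinearMap.id_apply, sub_self]
      exact (Submodule.Quotient.mk_eq_zero ((F k.castSucc).submoduleOf (F k.succ))).1 h1
    refine ⟨LinearMap.codRestrict (F k.castSucc)
      ((F k.succ).subtype ∘ₗ (LinearMap.id - s ∘ₗ Submodule.mkQ _) ∘ₗ r)
      (fun m => by simpa using hs' (r m)), fun m => Subtype.ext ?_⟩
    have hm : (m : M) ∈ F k.succ := hmono (Fin.castSucc_le_succ k) m.2
    have h2 : ((F k.castSucc).submoduleOf (F k.succ)).mkQ ⟨m, hm⟩ = 0 :=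
      (Submodule.Quotient.mk_eq_zero _).2 m.2
    change ((r m - s (Submodule.mkQ _ (r m)) : F k.succ) : M) = m
    rw [hr ⟨m, hm⟩, h2, map_zero, sub_zero]

end Filtration

/-! ### Modules with a Verma flag -/

section DeltaFlag

local notation "U" => UniversalEnvelopingAlgebra ℂ

local notation "ι" => UniversalEnvelopingAlgebra.ι ℂ

variable {g : Type*} [LieRing g] [LieAlgebra ℂ g] {H B Bop : LieSubalgebra ℂ g}
variable {T : Type*} [CommRing T] [Algebra ℂ T] {φ : SymmetricAlgebra ℂ H →ₐ[ℂ] T}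
variable {P : Type*} [AddCommGroup P] [Module ℂ P] [Module T P] [IsScalarTower ℂ T P]
variable {ρ : g →ₗ⁅ℂ⁆ Module.End T P}

/-- Canonical generators of the subquotients lift to genuine weight vectors of `P`; monomials
applied to them lift the Verma bases and assemble along the flag. -/
lemma exists_basis_of_deltaFlag [FiniteDimensional ℂ g] [LieAlgebra.IsSemisimple ℂ g]
    (D : Triangular H B Bop) (hP : ⨆ l, weightSpace φ ρ l = ⊤) (hflag : HasDeltaFlag B φ ρ) :
    ∃ (n : ℕ) (m : Fin n → P) (l : Fin n → Module.Dual ℂ H)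
      (b : Module.Basis (Σ _ : Fin n, Fin D.p → ℕ) T P),
      (∀ i, m i ∈ weightSpace φ ρ (l i)) ∧
      ∀ x, b x = repU ρ (mon (fun i => ι (D.f i)) x.2) (m x.1) := by
  obtain ⟨n, F, l, hbot, htop, hmono, hstab, hiso⟩ := hflag
  have hm : ∀ k : Fin n, ∃ m : P, m ∈ F k.succ ∧ m ∈ weightSpace φ ρ (l k) ∧
      (∀ c : (Fin D.p → ℕ) →₀ T, Finsupp.linearCombination T
        (fun α => repU ρ (mon (fun i => ι (D.f i)) α) m) c ∈ F k.castSucc → c = 0) ∧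
      F k.succ ≤ F k.castSucc ⊔ Submodule.span T
        (Set.range fun α => repU ρ (mon (fun i => ι (D.f i)) α) m) := by
    intro k
    obtain ⟨e, he⟩ := hiso k
    obtain ⟨b, hb⟩ := exists_basis_verma φ (l k) D
    let π : F k.succ →ₗ[T] Verma B φ (l k) :=
      e.toLinearMap ∘ₗ ((F k.castSucc).submoduleOf (F k.succ)).mkQ
    have hπ0 : ∀ m : F k.succ, π m = 0 ↔ (m : P) ∈ F k.castSucc := by
      intro m
      change e (Submodule.Quotient.mk m) = 0 ↔ _
      rw [LinearEquiv.map_eq_zero_iff, Submodule.Quotient.mk_eq_zero]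
      rfl
    have hπs : Function.Surjective π := e.surjective.comp (Submodule.mkQ_surjective _)
    have hπ : ∀ x (m : F k.succ), π ⟨ρ x m, hstab _ x m m.2⟩ = vermaRep B φ (l k) x (π m) :=
      fun x m => he x m _
    obtain ⟨m₀, hm₀⟩ := hπs (vermaGen B φ (l k))
    -- An arbitrary lift has the right weight only modulo `F k.castSucc`; `exists_weight_lift` then
    -- corrects it.
    have hw : ∀ h : H, ρ h (m₀ : P) - defChar φ (l k) h • (m₀ : P) ∈ F k.castSucc := by
      intro h
      have h1 := hπ0 (⟨ρ h m₀, hstab _ h m₀ m₀.2⟩ - defChar φ (l k) h • m₀)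
      refine h1.1 ?_
      rw [map_sub, hπ, map_smul, hm₀, mem_weightSpace.1 (vermaGen_mem B φ (l k)) h, sub_self]
    obtain ⟨m, hm1, hm2, hm3⟩ := exists_weight_lift hP (fun h => hstab k.castSucc h)
      (fun h => hstab k.succ h) m₀.2 hw
    have hπm : π ⟨m, hm1⟩ = vermaGen B φ (l k) := by
      rw [← hm₀, eq_comm, ← sub_eq_zero, ← map_sub, hπ0]
      exact hm3
    have hπb : ∀ c : (Fin D.p → ℕ) →₀ T, ∃ z : F k.succ, (z : P) = Finsupp.linearCombination T
        (fun α => repU ρ (mon (fun i => ι (D.f i)) α) m) c ∧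
        π z = Finsupp.linearCombination T b c := by
      intro c
      refine ⟨Finsupp.linearCombination T (fun α => (⟨repU ρ (mon (fun i => ι (D.f i)) α) m,
        repU_mem (hstab _) _ _ hm1⟩ : F k.succ)) c, ?_, ?_⟩
      · exact Finsupp.apply_linearCombination T (F k.succ).subtype _ c
      · rw [Finsupp.apply_linearCombination]
        congr 2
        funext α
        rw [hb α, ← hπm, ← intertwine_repU (hstab k.succ) hπ]
        rfl
    refine ⟨m, hm1, hm2, fun c hc => ?_, fun z hz => ?_⟩
    · obtain ⟨z, hz1, hz2⟩ := hπb c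
      rw [← hz1, ← hπ0, hz2] at hc
      exact (linearIndependent_iff.1 b.linearIndependent) c hc
    · obtain ⟨y, hy1, hy2⟩ := hπb (b.repr (π ⟨z, hz⟩))
      rw [Module.Basis.linearCombination_repr, ← sub_eq_zero, ← map_sub, hπ0] at hy2
      have h1 : z = -((y - ⟨z, hz⟩ : F k.succ) : P) + y := by simp
      rw [h1]
      refine add_mem (Submodule.mem_sup_left (neg_mem hy2)) (Submodule.mem_sup_right ?_)
      rw [hy1]
      exact Finsupp.mem_span_range_iff_exists_finsupp.2 ⟨_, rfl⟩
  choose m hm1 hm2 hm3 hm4 using hm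
  obtain ⟨b, hb⟩ := exists_basis_of_filtration (I := fun _ : Fin n => Fin D.p → ℕ)
    (v := fun k α => repU ρ (mon (fun i => ι (D.f i)) α) (m k)) hbot htop hmono
    (fun k α => repU_mem (hstab _) _ _ (hm1 k)) hm3 hm4
  exact ⟨n, m, l, b, hm2, hb⟩

/-- The bimodule is generated by the vectors `m i` under the action of `Bop` and of `T`. -/
def IsGeneratedBy {n : ℕ} (Bop : LieSubalgebra ℂ g) (ρ : g →ₗ⁅ℂ⁆ Module.End T P)
    (m : Fin n → P) : Prop :=
  ∀ K : Submodule T P, (∀ i, m i ∈ K) → (∀ k ∈ Bop, ∀ z ∈ K, ρ k z ∈ K) → K = ⊤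

lemma Triangular.f_mem (D : Triangular H B Bop) (i : Fin D.p) : D.f i ∈ Bop := by
  rw [← LieSubalgebra.mem_toSubmodule, ← D.sup_Bop, ← D.span_f]
  exact Submodule.mem_sup_right (Submodule.subset_span ⟨i, rfl⟩)

/-- The vector `f i`, as an element of the opposite Borel subalgebra. -/
def Triangular.f' (D : Triangular H B Bop) (i : Fin D.p) : Bop := ⟨D.f i, D.f_mem i⟩

variable {n : ℕ} {m : Fin n → P} {l : Fin n → Module.Dual ℂ H}

lemma isGeneratedBy_of_basis (D : Triangular H B Bop)
    (b : Module.Basis (Σ _ : Fin n, Fin D.p → ℕ) T P)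
    (hb : ∀ x, b x = repU ρ (mon (fun i => ι (D.f i)) x.2) (m x.1)) :
    IsGeneratedBy Bop ρ m := by
  intro K hm hK
  rw [eq_top_iff, ← b.span_eq, Submodule.span_le]
  rintro _ ⟨⟨i, α⟩, rfl⟩
  rw [hb, mon, SetLike.mem_coe]
  dsimp only
  induction monList α with
  | nil => simpa using hm i
  | cons j L ih =>
    rw [List.map_cons, List.prod_cons, repU_mul_apply, repU_ι]
    exact hK _ (D.f_mem j) _ ih

/-- The universal property of a module with a Verma flag as a module over the opposite Borel
subalgebra. -/
lemma exists_equivariant_map (D : Triangular H B Bop)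
    (b : Module.Basis (Σ _ : Fin n, Fin D.p → ℕ) T P)
    (hb : ∀ x, b x = repU ρ (mon (fun i => ι (D.f i)) x.2) (m x.1))
    (hm : ∀ i, m i ∈ weightSpace φ ρ (l i))
    {X : Type*} [AddCommGroup X] [Module ℂ X] [Module T X] [IsScalarTower ℂ T X]
    (τ : Bop →ₗ⁅ℂ⁆ Module.End T X) (x : Fin n → X)
    (hx : ∀ i (h : H) (k : Bop), (k : g) = h → τ k (x i) = defChar φ (l i) h • x i) :
    ∃ s : P →ₗ[T] X, (∀ i, s (m i) = x i) ∧ ∀ (k : Bop) z, s (ρ k z) = τ k (s z) := by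
  have hjmon : ∀ α, envelopingIncl Bop (mon (fun i => ι (D.f' i)) α) =
      mon (fun i => ι (D.f i)) α := by
    intro α
    simp only [map_mon, envelopingIncl_ι]
    rfl
  let s : P →ₗ[T] X := b.constr T fun y => repU τ (mon (fun i => ι (D.f' i)) y.2) (x y.1)
  have hs : ∀ i α, s (repU ρ (mon (fun i => ι (D.f i)) α) (m i)) =
      repU τ (mon (fun i => ι (D.f' i)) α) (x i) := by
    intro i α
    have := b.constr_basis T (fun y => repU τ (mon (fun i => ι (D.f' i)) y.2) (x y.1)) ⟨i, α⟩
    rwa [hb] at this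
  have hsw : ∀ i, ∀ w ∈ Submodule.span ℂ (Set.range (mon fun i => ι (D.f' i))),
      s (repU ρ (envelopingIncl Bop w) (m i)) = repU τ w (x i) := by
    intro i w hw
    induction hw using Submodule.span_induction with
    | mem w hw => obtain ⟨α, rfl⟩ := hw; rw [hjmon, hs]
    | zero => simp
    | add a b _ _ ha hb => simp only [map_add, LinearMap.add_apply, ha, hb]
    | smul c a _ ha =>
      simp only [map_smul, LinearMap.smul_apply]
      rw [← ha, LinearMap.map_smul_of_tower]
  refine ⟨s, fun i => by simpa using hs i 0, fun k z => ?_⟩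
  have hspan : ∀ k : Bop, (k : g) ∈ derivedSubspace Bop → ι k ∈
      Submodule.span ℂ (Set.range fun i => ι (D.f' i)) := by
    intro k hk
    have h1 : k ∈ Submodule.span ℂ (Set.range D.f') := by
      have h2 : (Submodule.span ℂ (Set.range D.f')).map Bop.toSubmodule.subtype =
          derivedSubspace Bop := by
        rw [Submodule.map_span, ← Set.range_comp, ← D.span_f]
        rfl
      rw [← h2] at hk
      obtain ⟨k', hk', hkk⟩ := hk
      rwa [← Subtype.ext hkk]
    have h := Submodule.mem_map_of_mem (f := (ι : Bop →ₗ⁅ℂ⁆ U Bop).toLinearMap) h1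
    rw [Submodule.map_span, ← Set.range_comp] at h
    exact h
  have hbr : ∀ i j, ι (D.f' i) * ι (D.f' j) - ι (D.f' j) * ι (D.f' i) ∈
      Submodule.span ℂ (Set.range fun i => ι (D.f' i)) := by
    intro i j
    rw [← LieRing.of_associative_ring_bracket, ← LieHom.map_lie]
    exact hspan _ (Submodule.subset_span ⟨D.f i, D.f_mem i, D.f j, D.f_mem j, rfl⟩)
  -- Split `k` into a part `y` in `[Bop, Bop]` and a part `h` in `H`. Left multiplication by `y`
  -- stays in the span of the monomials, while `h` moves through the monomial and acts on the
  -- generators by the same scalars on both sides.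
  have key : ∀ k : Bop, (s ∘ₗ ρ k) = τ k ∘ₗ s := by
    intro k
    have hk : (k : g) ∈ H.toSubmodule ⊔ derivedSubspace Bop := D.sup_Bop ▸ k.2
    obtain ⟨h, hh, y, hy, hky⟩ := Submodule.mem_sup.1 hk
    have hHB : h ∈ Bop := by
      rw [← LieSubalgebra.mem_toSubmodule, ← D.sup_Bop]
      exact Submodule.mem_sup_left hh
    have hyB : y ∈ Bop := by
      rw [← LieSubalgebra.mem_toSubmodule, ← D.sup_Bop]
      exact Submodule.mem_sup_right hy
    have hk2 : k = ⟨h, hHB⟩ + ⟨y, hyB⟩ := Subtype.ext hky.symm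
    refine b.ext fun ⟨i, α⟩ => ?_
    rw [LinearMap.comp_apply, LinearMap.comp_apply, hb]
    dsimp only
    rw [hs, hk2]
    have e1 : s (ρ y (repU ρ (mon (fun i => ι (D.f i)) α) (m i))) =
        τ ⟨y, hyB⟩ (repU τ (mon (fun i => ι (D.f' i)) α) (x i)) := by
      have h1 := hsw i _ (Submodule.span_mono (Set.image_subset_range _ _)
        (mul_mon_mem_span hbr (hspan ⟨y, hyB⟩ hy) α))
      rwa [map_mul, envelopingIncl_ι, hjmon, repU_mul_apply, repU_mul_apply, repU_ι, repU_ι] at h1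
    have e2 : s (ρ h (repU ρ (mon (fun i => ι (D.f i)) α) (m i))) =
        τ ⟨h, hHB⟩ (repU τ (mon (fun i => ι (D.f' i)) α) (x i)) := by
      have c1 := ι_mul_mon (D.lie_f ⟨h, hh⟩) α
      have c2 := ι_mul_mon (z := D.f') (h := ⟨h, hHB⟩) (c := fun i => D.wf i ⟨h, hh⟩)
        (fun i => Subtype.ext (D.lie_f ⟨h, hh⟩ i)) α
      rw [← repU_ι, ← repU_mul_apply, c1, ← repU_ι, ← repU_mul_apply, c2]
      simp only [map_add, LinearMap.add_apply, map_smul, LinearMap.smul_apply, repU_mul_apply,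
        repU_ι]
      rw [mem_weightSpace.1 (hm i) ⟨h, hh⟩, hx i ⟨h, hh⟩ ⟨h, hHB⟩ rfl,
        map_smul (repU ρ _), map_smul s, hs, LinearMap.map_smul_of_tower s, hs, map_smul (repU τ _)]
    rw [map_add, LinearMap.add_apply, ← e1, ← e2, ← map_add, ← LinearMap.add_apply, ← map_add]
    rfl
  exact congrArg (fun F => F z) (key k)

end DeltaFlag

/-! ### Modules with a nabla flag -/

section NablaFlag

local notation "U" => UniversalEnvelopingAlgebra ℂ

local notation "ι" => UniversalEnvelopingAlgebra.ι ℂ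

variable {g : Type*} [LieRing g] [LieAlgebra ℂ g] {H B Bop : LieSubalgebra ℂ g}
variable {T : Type*} [CommRing T] [Algebra ℂ T] {φ : SymmetricAlgebra ℂ H →ₐ[ℂ] T}
variable {P : Type*} [AddCommGroup P] [Module ℂ P] [Module T P] [IsScalarTower ℂ T P]
variable {Q : Type*} [AddCommGroup Q] [Module ℂ Q] [Module T Q] [IsScalarTower ℂ T Q]
variable {ρ : g →ₗ⁅ℂ⁆ Module.End T P} {σ : g →ₗ⁅ℂ⁆ Module.End T Q}

/-- A finite filtration `F` of a bimodule whose subquotients look like submodules of coinduced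
modules: they are cogenerated by a functional `ε k` equivariant under the opposite Borel subalgebra,
and spanned by vectors `q k γ` which are dual to the ordered monomials in the `e i`. -/
structure IsNablaFiltration (D : Triangular H B Bop) (φ : SymmetricAlgebra ℂ H →ₐ[ℂ] T)
    (σ : g →ₗ⁅ℂ⁆ Module.End T Q) {n : ℕ} (F : Fin (n + 1) → Submodule T Q)
    (ν : Fin n → Module.Dual ℂ H) (ε : Fin n → Q →ₗ[T] T) (q : Fin n → (Fin D.q → ℕ) → Q) :
    Prop where
  bot : F 0 = ⊥
  top : F (Fin.last n) = ⊤
  mono : Monotone F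
  stable : ∀ k x, ∀ m ∈ F k, σ x m ∈ F k
  equivariant : ∀ k, ∀ m ∈ F k.succ, ∀ (h : H), ∀ x ∈ derivedSubspace Bop,
    ε k (σ ((h : g) + x) m) = defChar φ (ν k) h * ε k m
  map_eq_zero : ∀ k, ∀ m ∈ F k.castSucc, ε k m = 0
  mem : ∀ k γ, q k γ ∈ F k.succ
  le : ∀ k, F k.succ ≤ F k.castSucc ⊔ Submodule.span T (Set.range (q k))
  dual : ∀ k γ δ, ε k (repU σ (mon (fun i => ι (D.e i)) δ) (q k γ)) = if γ = δ then 1 else 0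

section

variable {D : Triangular H B Bop} {n : ℕ} {F : Fin (n + 1) → Submodule T Q}
  {ν : Fin n → Module.Dual ℂ H} {ε : Fin n → Q →ₗ[T] T} {q : Fin n → (Fin D.q → ℕ) → Q}

/-- Modulo `F k.castSucc`, `m` is a combination of the `q k γ`, whose coefficients are exactly these
values by duality. -/
lemma IsNablaFiltration.mem_of_eval (hF : IsNablaFiltration D φ σ F ν ε q) {k : Fin n} {m : Q}
    (hm : m ∈ F k.succ) (h0 : ∀ δ, ε k (repU σ (mon (fun i => ι (D.e i)) δ) m) = 0) :
    m ∈ F k.castSucc := by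
  obtain ⟨y, hy, z, hz, rfl⟩ := Submodule.mem_sup.1 (hF.le k hm)
  obtain ⟨c, rfl⟩ := Finsupp.mem_span_range_iff_exists_finsupp.1 hz
  have hc : c = 0 := by
    ext δ
    have h1 := h0 δ
    rw [map_add, map_add, hF.map_eq_zero k _ (repU_mem (hF.stable _) _ _ hy), zero_add,
      Finsupp.sum, map_sum, map_sum] at h1
    rw [Finset.sum_congr rfl fun γ _ => by
      rw [map_smul, map_smul, hF.dual, smul_eq_mul, mul_ite, mul_one, mul_zero],
      Finset.sum_ite_eq'] at h1
    by_contra hne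
    rw [if_pos (Finsupp.mem_support_iff.2 hne)] at h1
    exact hne h1
  rw [hc, Finsupp.sum_zero_index, add_zero]
  exact hy

end

/-- The functional `ε k` is evaluation at `1` on the `k`-th subquotient. Those subquotients are free
over `T`, so the filtration splits `T`-linearly and `ε k` can be defined on all of `Q`, which makes
its base change immediate. -/
lemma exists_isNablaFiltration [FiniteDimensional ℂ g] [LieAlgebra.IsSemisimple ℂ g]
    [H.IsCartanSubalgebra] (D : Triangular H B Bop) (hflag : HasNablaFlag Bop φ σ) :
    ∃ (n : ℕ) (F : Fin (n + 1) → Submodule T Q) (ν : Fin n → Module.Dual ℂ H)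
      (ε : Fin n → Q →ₗ[T] T) (q : Fin n → (Fin D.q → ℕ) → Q),
      IsNablaFiltration D φ σ F ν ε q ∧ ∀ k (f : nabla Bop φ (ν k)), ∃ m ∈ F k.succ,
        ∀ u, ε k (repU σ u m) = f.1.1 u := by
  obtain ⟨n, F, ν, hbot, htop, hmono, hstab, hiso⟩ := hflag
  choose e he using hiso
  have hbasis := fun k => exists_basis_nabla (φ := φ) (l := ν k) D
  choose b hb using hbasis
  let π : ∀ k, F k.succ →ₗ[T] nabla Bop φ (ν k) := fun k =>
    (e k).toLinearMap ∘ₗ ((F k.castSucc).submoduleOf (F k.succ)).mkQ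
  have hπ0 : ∀ k (m : F k.succ), π k m = 0 ↔ (m : Q) ∈ F k.castSucc := by
    intro k m
    change e k (Submodule.Quotient.mk m) = 0 ↔ _
    rw [LinearEquiv.map_eq_zero_iff, Submodule.Quotient.mk_eq_zero]
    rfl
  have hπs : ∀ k, Function.Surjective (π k) := fun k =>
    (e k).surjective.comp (Submodule.mkQ_surjective _)
  have hπ : ∀ k x (m : F k.succ), π k ⟨σ x m, hstab _ x m m.2⟩ =
      nablaRep Bop φ (ν k) x (π k m) := fun k x m => he k x m _
  have hproj : ∀ k : Fin n,
      Module.Projective T (F k.succ ⧸ (F k.castSucc).submoduleOf (F k.succ)) := fun k =>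
    Module.Projective.of_basis ((b k).map (e k).symm)
  choose r hr using exists_retraction htop hmono hproj
  let ev : ∀ k, nabla Bop φ (ν k) →ₗ[T] T := fun k =>
    coindEval 1 ∘ₗ (nabla Bop φ (ν k)).subtype
  let ε : Fin n → Q →ₗ[T] T := fun k => ev k ∘ₗ π k ∘ₗ r k.succ
  have hε : ∀ k m (hm : m ∈ F k.succ), ε k m = (π k ⟨m, hm⟩).1.1 1 := by
    intro k m hm
    change ev k (π k (r k.succ m)) = _
    rw [hr k.succ ⟨m, hm⟩]
    rfl
  have hrep : ∀ k u (f : nabla Bop φ (ν k)) w,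
      (repU (nablaRep Bop φ (ν k)) u f).1.1 w = f.1.1 (w * u) := by
    intro k u
    induction u using enveloping_induction with
    | halg c =>
      intro f w
      rw [AlgHom.commutes, Module.algebraMap_end_apply, ← Algebra.commutes, ← Algebra.smul_def,
        map_smul]
      rfl
    | hι x =>
      intro f w
      rw [repU_ι]
      rfl
    | hadd u v hu hv =>
      intro f w
      rw [map_add, LinearMap.add_apply, mul_add, map_add, ← hu, ← hv]
      rfl
    | hmul u v hu hv =>
      intro f w
      rw [repU_mul_apply, hu, hv, mul_assoc]
  have hεu : ∀ k u m (hm : m ∈ F k.succ), ε k (repU σ u m) = (π k ⟨m, hm⟩).1.1 u := by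
    intro k u m hm
    rw [hε k _ (repU_mem (hstab _) u m hm)]
    have h1 := intertwine_repU (hstab k.succ) (hπ k) u ⟨m, hm⟩
    rw [h1, hrep, one_mul]
  have hq : ∀ k γ, ∃ m : F k.succ, π k m = b k γ := fun k γ => hπs k _
  choose q hq using hq
  refine ⟨n, F, ν, ε, fun k γ => q k γ, ⟨hbot, htop, hmono, hstab, ?_, ?_, fun k γ => (q k γ).2,
    ?_, ?_⟩, ?_⟩
  · intro k m hm h x hx
    rw [← repU_ι, hεu k _ m hm, ← mul_one (ι ((h : g) + x)), coind_apply _ h hx, hε k m hm]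
  · intro k m hm
    have hm' := hmono (Fin.castSucc_le_succ k) hm
    rw [hε k m hm', (hπ0 k ⟨m, hm'⟩).2 hm]
    rfl
  · intro k z hz
    let c := (b k).repr (π k ⟨z, hz⟩)
    let y : F k.succ := Finsupp.linearCombination T (q k) c
    have hy : π k y = π k ⟨z, hz⟩ := by
      rw [Finsupp.apply_linearCombination]
      have : (π k ∘ q k) = b k := funext (hq k)
      rw [this, Module.Basis.linearCombination_repr]
    rw [← sub_eq_zero, ← map_sub, hπ0] at hy
    have h1 : z = -((y - ⟨z, hz⟩ : F k.succ) : Q) + y := by simp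
    rw [h1]
    refine add_mem (Submodule.mem_sup_left (neg_mem hy)) (Submodule.mem_sup_right ?_)
    refine Finsupp.mem_span_range_iff_exists_finsupp.2 ⟨c, ?_⟩
    exact (Finsupp.apply_linearCombination T (F k.succ).subtype (q k) c).symm
  · intro k γ δ
    rw [hεu k _ _ (q k γ).2, ← hb]
    change (b k).repr (π k (q k γ)) δ = _
    rw [hq, Module.Basis.repr_self, Finsupp.single_apply]
  · intro k f
    obtain ⟨m, hm⟩ := hπs k f
    exact ⟨m, m.2, fun u => by rw [hεu k u m m.2, ← hm]⟩

/-! ### Lifting of functionals -/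

/-- The direct sum of two bimodules. -/
def prodRep (σ : g →ₗ⁅ℂ⁆ Module.End T Q) (ρ : g →ₗ⁅ℂ⁆ Module.End T P) :
    g →ₗ⁅ℂ⁆ Module.End T (Q × P) where
  toFun x := (σ x).prodMap (ρ x)
  map_add' x y := by ext <;> simp
  map_smul' c x := by ext <;> simp
  map_lie' {x y} := by ext <;> simp [LieRing.of_associative_ring_bracket]

lemma repU_prodRep (u : U g) (z : Q × P) :
    repU (prodRep σ ρ) u z = (repU σ u z.1, repU ρ u z.2) := by
  refine Prod.ext ?_ ?_
  · exact bimodHom_repU (f := LinearMap.fst T Q P) (ρ := prodRep σ ρ) (σ := σ)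
      (fun _ _ => rfl) u z
  · exact bimodHom_repU (f := LinearMap.snd T Q P) (ρ := prodRep σ ρ) (σ := ρ)
      (fun _ _ => rfl) u z

lemma iSup_weightSpace_prodRep (hQ : ⨆ l, weightSpace φ σ l = ⊤)
    (hP : ⨆ l, weightSpace φ ρ l = ⊤) : ⨆ l, weightSpace φ (prodRep σ ρ) l = ⊤ := by
  rw [eq_top_iff]
  rintro ⟨y, z⟩ -
  have h1 : y ∈ (⨆ l, weightSpace φ (prodRep σ ρ) l).comap (LinearMap.inl T Q P) := by
    have h2 : ⨆ l, weightSpace φ σ l ≤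
        (⨆ l, weightSpace φ (prodRep σ ρ) l).comap (LinearMap.inl T Q P) := by
      refine iSup_le fun l y hy => Submodule.mem_iSup_of_mem l (mem_weightSpace.2 fun h => ?_)
      change (σ h y, ρ h 0) = _
      rw [mem_weightSpace.1 hy h, map_zero]
      simp
    exact h2 (hQ ▸ Submodule.mem_top)
  have h3 : z ∈ (⨆ l, weightSpace φ (prodRep σ ρ) l).comap (LinearMap.inr T Q P) := by
    have h2 : ⨆ l, weightSpace φ ρ l ≤
        (⨆ l, weightSpace φ (prodRep σ ρ) l).comap (LinearMap.inr T Q P) := by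
      refine iSup_le fun l y hy => Submodule.mem_iSup_of_mem l (mem_weightSpace.2 fun h => ?_)
      change (σ h 0, ρ h y) = _
      rw [mem_weightSpace.1 hy h, map_zero]
      simp
    exact h2 (hP ▸ Submodule.mem_top)
  have h4 := add_mem (Submodule.mem_comap.1 h1) (Submodule.mem_comap.1 h3)
  simpa using h4

section Lift

variable {D : Triangular H B Bop} {n : ℕ} {F : Fin (n + 1) → Submodule T Q}
  {ν : Fin n → Module.Dual ℂ H} {ε : Fin n → Q →ₗ[T] T} {q : Fin n → (Fin D.q → ℕ) → Q}

/-- One step in the construction of the graph of a lift. -/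
lemma exists_smaller_correspondence (hQ : ⨆ l, weightSpace φ σ l = ⊤)
    (hP : ⨆ l, weightSpace φ ρ l = ⊤) (hF : IsNablaFiltration D φ σ F ν ε q)
    (hsurj : ∀ k (f : nabla Bop φ (ν k)), ∃ m ∈ F k.succ, ∀ u, ε k (repU σ u m) = f.1.1 u)
    (j : Fin n) (E : Submodule T (Q × P)) (hE : ∀ x, ∀ z ∈ E, prodRep σ ρ x z ∈ E)
    (hEF : ∀ y, (y, 0) ∈ E ↔ y ∈ F j.succ) (hEP : ∀ z, ∃ y, (y, z) ∈ E)
    (ξ : Q × P →ₗ[T] T) (hξ : ∀ z ∈ E, ∀ (h : H), ∀ x ∈ derivedSubspace Bop,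
      ξ (prodRep σ ρ ((h : g) + x) z) = defChar φ (ν j) h * ξ z)
    (hξε : ∀ y ∈ F j.succ, ξ (y, 0) = ε j y) :
    ∃ E' ≤ E, (∀ z ∈ E', ξ z = 0) ∧ (∀ x, ∀ z ∈ E', prodRep σ ρ x z ∈ E') ∧
      (∀ y, (y, 0) ∈ E' ↔ y ∈ F j.castSucc) ∧ ∀ z, ∃ y, (y, z) ∈ E' := by
  -- This is the kernel of the map from `E` to the nabla module adjoint to `ξ`, equivalently the
  -- largest `g`-stable subspace of `E` on which `ξ` vanishes.
  let E' : Submodule T (Q × P) :=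
    E ⊓ ⨅ u : U g, LinearMap.ker (ξ ∘ₗ repU (prodRep σ ρ) u)
  have hE' : ∀ z, z ∈ E' ↔ z ∈ E ∧ ∀ u, ξ (repU (prodRep σ ρ) u z) = 0 := by
    intro z
    simp [E']
  refine ⟨E', inf_le_left, fun z hz => ?_, fun x z hz => ?_, fun y => ?_, fun z => ?_⟩
  · simpa using ((hE' z).1 hz).2 1
  · rw [hE'] at hz ⊢
    refine ⟨hE x z hz.1, fun u => ?_⟩
    rw [← repU_ι, ← repU_mul_apply]
    exact hz.2 _
  · rw [hE', hEF]
    constructor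
    · rintro ⟨hy, h0⟩
      refine hF.mem_of_eval hy fun δ => ?_
      have h1 := h0 (mon (fun i => ι (D.e i)) δ)
      rw [repU_prodRep, map_zero] at h1
      rwa [← hξε _ (repU_mem (hF.stable _) _ _ hy)]
    · intro hy
      have hy' := hF.mono (Fin.castSucc_le_succ j) hy
      refine ⟨hy', fun u => ?_⟩
      rw [repU_prodRep, map_zero, hξε _ (repU_mem (hF.stable _) _ _ hy')]
      exact hF.map_eq_zero j _ (repU_mem (hF.stable _) _ _ hy)
  -- The fibre `F j.succ` already surjects onto the nabla module, so any element of `E` over `z` can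
  -- be corrected by the fibre to lie in the kernel.
  · obtain ⟨y, hy⟩ := hEP z
    obtain ⟨f, hf⟩ := exists_nabla_of_functional (iSup_weightSpace_prodRep hQ hP) hE hξ hy
    obtain ⟨m, hm, hmf⟩ := hsurj j f
    refine ⟨y - m, (hE' _).2 ⟨?_, fun u => ?_⟩⟩
    · have := sub_mem hy ((hEF m).2 hm)
      simpa using this
    · have h1 : ((y - m, z) : Q × P) = (y, z) - (m, 0) := by simp
      have h2 : ξ (repU (prodRep σ ρ) u (m, 0)) = ε j (repU σ u m) := by
        rw [repU_prodRep, map_zero, hξε _ (repU_mem (hF.stable _) _ _ hm)]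
      rw [h1, map_sub, map_sub, h2, hmf, hf, sub_self]

/-- Starting from all of `F k.succ × P`, `g`-stable correspondences over `P` are shrunk until the
fibre over zero is zero; what remains is the graph of the desired map. -/
lemma exists_bimodHom_lift (hQ : ⨆ l, weightSpace φ σ l = ⊤)
    (hP : ⨆ l, weightSpace φ ρ l = ⊤) (hF : IsNablaFiltration D φ σ F ν ε q)
    (hsurj : ∀ k (f : nabla Bop φ (ν k)), ∃ m ∈ F k.succ, ∀ u, ε k (repU σ u m) = f.1.1 u)
    {r : ℕ} {m : Fin r → P} {l : Fin r → Module.Dual ℂ H}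
    (b : Module.Basis (Σ _ : Fin r, Fin D.p → ℕ) T P)
    (hb : ∀ x, b x = repU ρ (mon (fun i => ι (D.f i)) x.2) (m x.1))
    (hm : ∀ i, m i ∈ weightSpace φ ρ (l i)) (k : Fin n) (ξ : P →ₗ[T] T)
    (hξ : ∀ z, ∀ (h : H), ∀ x ∈ derivedSubspace Bop,
      ξ (ρ ((h : g) + x) z) = defChar φ (ν k) h * ξ z) :
    ∃ f ∈ bimodHom ρ σ, (∀ z, f z ∈ F k.succ) ∧ ∀ z, ε k (f z) = ξ z := by
  have key : ∀ j : Fin (n + 1), j ≤ k.castSucc → ∃ E : Submodule T (Q × P),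
      (∀ z ∈ E, z.1 ∈ F k.succ ∧ ε k z.1 = ξ z.2) ∧ (∀ x, ∀ z ∈ E, prodRep σ ρ x z ∈ E) ∧
      (∀ y, (y, 0) ∈ E ↔ y ∈ F j) ∧ ∀ z, ∃ y, (y, z) ∈ E := by
    intro j
    induction j using Fin.reverseInduction with
    | last => exact fun h => absurd h (not_le.2 (Fin.castSucc_lt_last k))
    | cast j ih =>
      intro hj
      -- At `j = k`, the first cut uses `ε j y - ξ z` and imposes the prescribed functional. At
      -- smaller `j`, the functional must come from a splitting.
      rcases eq_or_lt_of_le hj with hjk | hjk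
      · obtain rfl : j = k := Fin.castSucc_injective n hjk
        obtain ⟨E', h1, h2, h3, h4, h5⟩ := exists_smaller_correspondence hQ hP hF hsurj j
          ((F j.succ).prod ⊤) (fun x z hz => ⟨hF.stable _ x _ hz.1, trivial⟩)
          (fun y => by simp) (fun z => ⟨0, by simp⟩)
          (ε j ∘ₗ LinearMap.fst T Q P - ξ ∘ₗ LinearMap.snd T Q P)
          (fun z hz h x hx => by
            change ε j (σ _ z.1) - ξ (ρ _ z.2) = _ * (ε j z.1 - ξ z.2)
            rw [hF.equivariant j _ hz.1 h x hx, hξ _ h x hx, mul_sub])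
          (fun y _ => by simp)
        exact ⟨E', fun z hz => ⟨(h1 hz).1, sub_eq_zero.1 (h2 z hz)⟩, h3, h4, h5⟩
      · have hjk' : j.succ ≤ k.castSucc := Fin.succ_le_castSucc_iff.2 (by simpa using hjk)
        obtain ⟨E, hE1, hE2, hE3, hE4⟩ := ih hjk'
        -- Weight lifts of the generators determine, by the universal property of `P`, a
        -- `Bop`-equivariant section `s` of `E → P`.
        have hlift : ∀ i, ∃ z ∈ E, z ∈ weightSpace φ (prodRep σ ρ) (l i) ∧ z.2 = m i := by
          intro i
          obtain ⟨y, hy⟩ := hE4 (m i)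
          obtain ⟨z, hz1, hz2, hz3⟩ := exists_weight_lift (iSup_weightSpace_prodRep hQ hP)
            (K₀ := LinearMap.ker (LinearMap.snd T Q P)) (μ := l i)
            (fun h z hz => by
              rw [LinearMap.mem_ker, LinearMap.snd_apply] at hz ⊢
              change ρ _ z.2 = 0
              rw [hz, map_zero]) (fun h => hE2 h) hy (fun h => by
              rw [LinearMap.mem_ker, LinearMap.snd_apply]
              change ρ _ (m i) - _ • m i = 0
              rw [mem_weightSpace.1 (hm i) h, sub_self])
          exact ⟨z, hz1, hz2, (sub_eq_zero.1 hz3).symm⟩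
        choose z hz1 hz2 hz3 using hlift
        obtain ⟨s, hs1, hs2⟩ := exists_equivariant_map D b hb hm
          ((prodRep σ ρ).comp Bop.incl) z (fun i h k hk => by
            change prodRep σ ρ (k : g) (z i) = _
            rw [hk, mem_weightSpace.1 (hz2 i) h])
        have hgen := isGeneratedBy_of_basis D b hb
        have hsE : ∀ p, s p ∈ E := by
          have := hgen (E.comap s) (fun i => by rw [Submodule.mem_comap, hs1]; exact hz1 i)
            (fun k hk p hp => by
              rw [Submodule.mem_comap] at hp ⊢
              rw [hs2 ⟨k, hk⟩]
              exact hE2 _ _ hp)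
          exact fun p => (this.ge Submodule.mem_top : p ∈ E.comap s)
        have hsid : ∀ p, (s p).2 = p := by
          have := hgen (LinearMap.eqLocus (LinearMap.snd T Q P ∘ₗ s) LinearMap.id)
            (fun i => by
              change (s (m i)).2 = m i
              rw [hs1, hz3])
            (fun k hk p hp => by
              change (s (ρ k p)).2 = ρ k p
              change (s p).2 = p at hp
              rw [hs2 ⟨k, hk⟩]
              change ρ k (s p).2 = _
              rw [hp])
          exact fun p => (this.ge Submodule.mem_top :
            p ∈ LinearMap.eqLocus (LinearMap.snd T Q P ∘ₗ s) LinearMap.id)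
        have hdiff : ∀ z ∈ E, z.1 - (s z.2).1 ∈ F j.succ := by
          intro z hz
          rw [← hE3]
          have h1 := sub_mem hz (hsE z.2)
          have h2 : z - s z.2 = (z.1 - (s z.2).1, 0) := Prod.ext rfl (by simp [hsid])
          rwa [h2] at h1
        -- Subtracting the section projects `E` onto its fibre `F j.succ` equivariantly under `Bop`,
        -- so `ε j` extends from the fibre to `E`.
        obtain ⟨E', h1, h2, h3, h4, h5⟩ := exists_smaller_correspondence hQ hP hF hsurj j
          E hE2 hE3 hE4
          (ε j ∘ₗ (LinearMap.fst T Q P - LinearMap.fst T Q P ∘ₗ s ∘ₗ LinearMap.snd T Q P))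
          (fun z hz h x hx => by
            change ε j (σ _ z.1 - (s (ρ _ z.2)).1) = _ * ε j (z.1 - (s z.2).1)
            have hk : (h : g) + x ∈ Bop := by
              rw [← LieSubalgebra.mem_toSubmodule, ← D.sup_Bop]
              exact add_mem (Submodule.mem_sup_left h.2) (Submodule.mem_sup_right hx)
            rw [← hF.equivariant j _ (hdiff z hz) h x hx, hs2 ⟨_, hk⟩,
              map_sub (σ ((h : g) + x))]
            rfl)
          (fun y _ => by simp)
        exact ⟨E', fun z hz => hE1 z (h1 hz), h3, h4, h5⟩
  -- Since `F 0 = ⊥`, this correspondence is single-valued, and its `g`-stability makes the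
  -- resulting map equivariant.
  obtain ⟨E, hE1, hE2, hE3, hE4⟩ := key 0 (Fin.zero_le _)
  have huniq : ∀ y y' z, (y, z) ∈ E → (y', z) ∈ E → y = y' := by
    intro y y' z h1 h2
    have h3 := sub_mem h1 h2
    rw [Prod.mk_sub_mk, sub_self, hE3, hF.bot, Submodule.mem_bot, sub_eq_zero] at h3
    exact h3
  choose f hf using hE4
  refine ⟨{ toFun := f, map_add' := fun a b => ?_, map_smul' := fun t a => ?_ }, fun x z => ?_,
    fun z => (hE1 _ (hf z)).1, fun z => (hE1 _ (hf z)).2⟩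
  · exact huniq _ _ _ (hf _) (add_mem (hf a) (hf b))
  · exact huniq _ _ _ (hf _) (E.smul_mem t (hf a))
  · exact huniq _ _ _ (hf _) (hE2 x _ (hf z))

end Lift

end NablaFlag

/-! ### Bases of spaces of homomorphisms and base change -/

section Functionals

variable {T : Type*} [CommRing T] {P : Type*} [AddCommGroup P] [Module T P]
variable (T' : Type*) [CommRing T'] [Algebra T T']

/-- The base change of a linear functional. -/
def functionalBaseChange (ξ : P →ₗ[T] T) : T' ⊗[T] P →ₗ[T'] T' :=
  (TensorProduct.AlgebraTensorModule.rid T T' T').toLinearMap ∘ₗ ξ.baseChange T'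

lemma functionalBaseChange_tmul (ξ : P →ₗ[T] T) (t : T') (z : P) :
    functionalBaseChange T' ξ (t ⊗ₜ z) = algebraMap T T' (ξ z) * t := by
  simp [functionalBaseChange, Algebra.smul_def]

lemma baseChange_induction {K : Submodule T P} {p : T' ⊗[T] P → Prop}
    (htmul : ∀ (t : T'), ∀ z ∈ K, p (t ⊗ₜ z)) (hadd : ∀ a b, p a → p b → p (a + b))
    {z : T' ⊗[T] P} (hz : z ∈ K.baseChange T') : p z := by
  obtain ⟨y, rfl⟩ := hz
  induction y with
  | zero => simpa using htmul 0 0 (zero_mem _)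
  | add a b ha hb => rw [map_add]; exact hadd _ _ ha hb
  | tmul t z => exact htmul t z z.2

end Functionals

section HomBasis

local notation "U" => UniversalEnvelopingAlgebra ℂ

local notation "ι" => UniversalEnvelopingAlgebra.ι ℂ

variable {g : Type*} [LieRing g] [LieAlgebra ℂ g] {H B Bop : LieSubalgebra ℂ g}
variable {T : Type*} [CommRing T] [Algebra ℂ T] {φ : SymmetricAlgebra ℂ H →ₐ[ℂ] T}
variable {P : Type*} [AddCommGroup P] [Module ℂ P] [Module T P] [IsScalarTower ℂ T P]
variable {Q : Type*} [AddCommGroup Q] [Module ℂ Q] [Module T Q] [IsScalarTower ℂ T Q]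
variable {ρ : g →ₗ⁅ℂ⁆ Module.End T P} {σ : g →ₗ⁅ℂ⁆ Module.End T Q}
variable {D : Triangular H B Bop} {n : ℕ} {F : Fin (n + 1) → Submodule T Q}
  {ν : Fin n → Module.Dual ℂ H} {ε : Fin n → Q →ₗ[T] T} {q : Fin n → (Fin D.q → ℕ) → Q}
variable {r : ℕ} {m : Fin r → P} {l : Fin r → Module.Dual ℂ H}

/-- The kernel of `ξ` is `Bop`-stable. Generators of weight other than `μ` lie in it because the two
weights differ by an invertible scalar for some `h`. -/
lemma functional_eq_zero_of_isGeneratedBy (D : Triangular H B Bop)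
    (hgen : IsGeneratedBy Bop ρ m) (hm : ∀ i, m i ∈ weightSpace φ ρ (l i))
    {μ : Module.Dual ℂ H} {ξ : P →ₗ[T] T} (hξ : ∀ z, ∀ (h : H), ∀ x ∈ derivedSubspace Bop,
      ξ (ρ ((h : g) + x) z) = defChar φ μ h * ξ z) (h0 : ∀ i, l i = μ → ξ (m i) = 0) : ξ = 0 := by
  rw [← LinearMap.ker_eq_top]
  refine hgen _ (fun i => ?_) fun k hk z hz => ?_
  · rw [LinearMap.mem_ker]
    by_cases hi : l i = μ
    · exact h0 i hi
    · obtain ⟨h, hh⟩ : ∃ h, l i h ≠ μ h := by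
        by_contra hcon
        push Not at hcon
        exact hi (LinearMap.ext hcon)
      have h1 := hξ (m i) h 0 (zero_mem _)
      rw [add_zero, mem_weightSpace.1 (hm i) h, map_smul, smul_eq_mul, ← sub_eq_zero, ← sub_mul,
        defChar_sub, ← Algebra.smul_def] at h1
      have h3 := congrArg (fun t => (l i h - μ h)⁻¹ • t) h1
      rwa [smul_smul, inv_mul_cancel₀ (sub_ne_zero.2 hh), one_smul, smul_zero] at h3
  · rw [LinearMap.mem_ker] at hz ⊢
    rw [← LieSubalgebra.mem_toSubmodule, ← D.sup_Bop] at hk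
    obtain ⟨h, hh, x, hx, rfl⟩ := Submodule.mem_sup.1 hk
    rw [hξ z ⟨h, hh⟩ x hx, hz, mul_zero]

/-- Homs are filtered by the step containing their image. In layer `k`, the coordinates are the
values of `ε k` on the generators of weight `ν k`, and the given maps are dual to them. Generation,
not freeness, of `P` suffices here. -/
lemma exists_basis_bimodHom (hF : IsNablaFiltration D φ σ F ν ε q)
    (hgen : IsGeneratedBy Bop ρ m) (hm : ∀ i, m i ∈ weightSpace φ ρ (l i))
    (f : ∀ k, {i // l i = ν k} → bimodHom ρ σ) (hf : ∀ k i z, (f k i).1 z ∈ F k.succ)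
    (hfε : ∀ k i j, ε k ((f k i).1 (m j)) = if i.1 = j then 1 else 0) :
    ∃ b : Module.Basis (Σ k, {i // l i = ν k}) T (bimodHom ρ σ), ∀ x, b x = f x.1 x.2 := by
  classical
  let G : Fin (n + 1) → Submodule T (bimodHom ρ σ) := fun k =>
    { carrier := {f | ∀ z, f.1 z ∈ F k}
      add_mem' := fun ha hb z => add_mem (ha z) (hb z)
      zero_mem' := fun z => zero_mem _
      smul_mem' := fun t a ha z => (F k).smul_mem t (ha z) }
  have hG : ∀ k a, a ∈ G k ↔ ∀ z, a.1 z ∈ F k := fun k a => Iff.rfl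
  let ev : ∀ k j, bimodHom ρ σ →ₗ[T] T := fun k j =>
    ε k ∘ₗ LinearMap.applyₗ (m j) ∘ₗ (bimodHom ρ σ).subtype
  have hev : ∀ k j a, ev k j a = ε k (a.1 (m j)) := fun k j a => rfl
  refine exists_basis_of_filtration (F := G) (v := f) ?_ ?_ ?_ hf ?_ ?_
  · rw [eq_bot_iff]
    intro a ha
    rw [hG, hF.bot] at ha
    exact (Submodule.mem_bot T).2 (Subtype.ext (LinearMap.ext fun z => by simpa using ha z))
  · rw [eq_top_iff]
    intro a _
    rw [hG, hF.top]
    exact fun _ => trivial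
  · exact fun j k hjk a ha z => hF.mono hjk (ha z)
  · intro k c hc
    ext j
    have h1 : ev k j.1 (Finsupp.linearCombination T (f k) c) = 0 :=
      hF.map_eq_zero k _ (hc (m j.1))
    rw [Finsupp.linearCombination_apply, Finsupp.sum, map_sum,
      Finset.sum_congr rfl fun i _ => by
        rw [map_smul, hev, hfε, smul_eq_mul, mul_ite, mul_one, mul_zero]] at h1
    simp only [Subtype.coe_inj, Finset.sum_ite_eq'] at h1
    by_contra hne
    rw [if_pos (Finsupp.mem_support_iff.2 hne)] at h1
    exact hne h1
  · intro k a ha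
    -- After subtracting `a'`, the functional `ε k ∘ (a - a')` vanishes on all generators of weight
    -- `ν k`, hence everywhere; `mem_of_eval` drops the image one step.
    let a' : bimodHom ρ σ := ∑ i : {i // l i = ν k}, ε k (a.1 (m i)) • f k i
    have ha' : a' ∈ Submodule.span T (Set.range (f k)) :=
      sum_mem fun i _ => Submodule.smul_mem _ _ (Submodule.subset_span ⟨i, rfl⟩)
    have ha'2 : ∀ j (hj : l j = ν k), ε k (a'.1 (m j)) = ε k (a.1 (m j)) := by
      intro j hj
      change ev k j a' = _
      rw [map_sum, Finset.sum_congr rfl fun i _ => by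
        rw [map_smul, hev, hfε, smul_eq_mul, mul_ite, mul_one, mul_zero]]
      have h3 : ∀ i : {i // l i = ν k}, (i.1 = j) = (i = ⟨j, hj⟩) := fun i => by
        rw [← Subtype.coe_inj]
      simp only [h3, Finset.sum_ite_eq', Finset.mem_univ, if_true]
    have hsub : ∀ z, (a - a').1 z ∈ F k.succ := by
      have h1 : a' ∈ G k.succ := sum_mem fun i _ => Submodule.smul_mem _ _ (hf k i)
      exact sub_mem ha h1
    have hzero : ε k ∘ₗ (a - a').1 = 0 := by
      refine functional_eq_zero_of_isGeneratedBy D hgen hm (μ := ν k) (fun z h x hx => ?_)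
        fun i hi => ?_
      · rw [LinearMap.comp_apply, LinearMap.comp_apply, (a - a').2,
          hF.equivariant k _ (hsub z) h x hx]
      · change ε k (a.1 (m i) - a'.1 (m i)) = 0
        rw [map_sub, ha'2 i hi, sub_self]
    have hmem : a - a' ∈ G k.castSucc := by
      intro z
      refine hF.mem_of_eval (hsub z) fun δ => ?_
      rw [← bimodHom_repU (a - a').2]
      exact LinearMap.congr_fun hzero _
    rw [← sub_add_cancel a a']
    exact add_mem (Submodule.mem_sup_left hmem) (Submodule.mem_sup_right ha')

/-! ### Base change of weights, generators, nabla filtrations and category membership. -/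

variable (T' : Type*) [CommRing T'] [Algebra ℂ T'] [Algebra T T'] [IsScalarTower ℂ T T']

lemma defChar_baseChangeStr (μ : Module.Dual ℂ H) (h : H) :
    defChar (baseChangeStr T' φ) μ h = algebraMap T T' (defChar φ μ h) := by
  rw [defChar, defChar, map_add, ← IsScalarTower.algebraMap_apply]
  rfl

lemma baseChangeRep_tmul (x : g) (t : T') (z : P) :
    baseChangeRep T' ρ x (t ⊗ₜ z) = t ⊗ₜ ρ x z := rfl

lemma repU_baseChangeRep (u : U g) (t : T') (z : P) :
    repU (baseChangeRep T' ρ) u (t ⊗ₜ z) = t ⊗ₜ repU ρ u z := by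
  induction u using enveloping_induction generalizing z with
  | halg c =>
    rw [AlgHom.commutes, AlgHom.commutes, Module.algebraMap_end_apply,
      Module.algebraMap_end_apply, ← algebraMap_smul T c z, ← TensorProduct.smul_tmul,
      algebraMap_smul]
    rfl
  | hι x => rw [repU_ι, repU_ι, baseChangeRep_tmul]
  | hadd u v hu hv =>
    rw [map_add, LinearMap.add_apply, hu, hv, ← TensorProduct.tmul_add, map_add,
      LinearMap.add_apply]
  | hmul u v hu hv => rw [repU_mul_apply, hv, hu, repU_mul_apply]

lemma tmul_mem_weightSpace {μ : Module.Dual ℂ H} {z : P} (hz : z ∈ weightSpace φ ρ μ) (t : T') :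
    t ⊗ₜ z ∈ weightSpace (baseChangeStr T' φ) (baseChangeRep T' ρ) μ := by
  rw [mem_weightSpace] at hz ⊢
  intro h
  rw [baseChangeRep_tmul, hz h, defChar_baseChangeStr, algebraMap_smul, TensorProduct.tmul_smul]

lemma IsGeneratedBy.baseChange (hgen : IsGeneratedBy Bop ρ m) :
    IsGeneratedBy Bop (baseChangeRep T' ρ) fun i => (1 : T') ⊗ₜ[T] m i := by
  intro K hK hstab
  have h1 := hgen ((K.restrictScalars T).comap (TensorProduct.mk T T' P 1)) hK
    (fun k hk z hz => by
      rw [Submodule.mem_comap] at hz ⊢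
      exact hstab k hk _ hz)
  rw [eq_top_iff]
  rintro z -
  induction z with
  | zero => exact zero_mem _
  | add a b ha hb => exact add_mem ha hb
  | tmul t z =>
    have h2 : z ∈ (K.restrictScalars T).comap (TensorProduct.mk T T' P 1) := h1.ge trivial
    rw [← mul_one t, ← smul_eq_mul, ← TensorProduct.smul_tmul']
    exact K.smul_mem t h2

/-- Every condition is an identity or spanning statement that can be checked on pure tensors; no
exactness of scalar extension is needed. -/
lemma IsNablaFiltration.baseChange (hF : IsNablaFiltration D φ σ F ν ε q) :
    IsNablaFiltration D (baseChangeStr T' φ) (baseChangeRep T' σ)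
      (fun k => (F k).baseChange T') ν (fun k => functionalBaseChange T' (ε k))
      (fun k γ => 1 ⊗ₜ q k γ) where
  bot := by rw [hF.bot, Submodule.baseChange_bot]
  top := by rw [hF.top, Submodule.baseChange_top]
  mono j k hjk z hz := by
    refine baseChange_induction T' (fun t z hz => ?_) (fun _ _ => add_mem) hz
    exact Submodule.tmul_mem_baseChange_of_mem t (hF.mono hjk hz)
  stable k x z hz := by
    refine baseChange_induction T'
      (p := fun z => baseChangeRep T' σ x z ∈ (F k).baseChange T')
      (fun t z hz => ?_) (fun _ _ ha hb => ?_) hz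
    · exact Submodule.tmul_mem_baseChange_of_mem t (hF.stable k x z hz)
    · rw [map_add]
      exact add_mem ha hb
  equivariant k z hz h x hx := by
    refine baseChange_induction T'
      (p := fun z => functionalBaseChange T' (ε k) (baseChangeRep T' σ ((h : g) + x) z) =
        defChar (baseChangeStr T' φ) (ν k) h * functionalBaseChange T' (ε k) z)
      (fun t z hz => ?_) (fun _ _ ha hb => ?_) hz
    · rw [baseChangeRep_tmul, functionalBaseChange_tmul, functionalBaseChange_tmul,
        hF.equivariant k z hz h x hx, defChar_baseChangeStr, map_mul, mul_assoc]
    · rw [LinearMap.map_add, LinearMap.map_add, LinearMap.map_add, ha, hb, mul_add]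
  map_eq_zero k z hz := by
    refine baseChange_induction T' (p := fun z => functionalBaseChange T' (ε k) z = 0)
      (fun t z hz => ?_) (fun _ _ ha hb => ?_) hz
    · rw [functionalBaseChange_tmul, hF.map_eq_zero k z hz, map_zero, zero_mul]
    · rw [map_add, ha, hb, add_zero]
  mem k γ := Submodule.tmul_mem_baseChange_of_mem 1 (hF.mem k γ)
  le k z hz := by
    refine baseChange_induction T' (fun t z hz => ?_) (fun _ _ => add_mem) hz
    obtain ⟨a, ha, b, hb, rfl⟩ := Submodule.mem_sup.1 (hF.le k hz)
    rw [TensorProduct.tmul_add]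
    refine add_mem (Submodule.mem_sup_left (Submodule.tmul_mem_baseChange_of_mem t ha))
      (Submodule.mem_sup_right ?_)
    clear hz
    induction hb using Submodule.span_induction with
    | mem b hb =>
      obtain ⟨γ, rfl⟩ := hb
      rw [← mul_one t, ← smul_eq_mul, ← TensorProduct.smul_tmul']
      exact Submodule.smul_mem _ _ (Submodule.subset_span ⟨γ, rfl⟩)
    | zero => rw [TensorProduct.tmul_zero]; exact zero_mem _
    | add a b _ _ ha hb => rw [TensorProduct.tmul_add]; exact add_mem ha hb
    | smul c b _ hb =>
      rw [TensorProduct.tmul_smul]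
      exact Submodule.smul_of_tower_mem _ c hb
  dual k γ δ := by
    rw [repU_baseChangeRep, functionalBaseChange_tmul, hF.dual, mul_one]
    split_ifs <;> simp

lemma iSup_weightSpace_baseChange (hP : ⨆ μ, weightSpace φ ρ μ = ⊤) :
    ⨆ μ, weightSpace (baseChangeStr T' φ) (baseChangeRep T' ρ) μ = ⊤ := by
  rw [eq_top_iff]
  rintro z -
  induction z with
  | zero => exact zero_mem _
  | add a b ha hb => exact add_mem ha hb
  | tmul t z =>
    obtain ⟨s, v, hv, rfl⟩ := exists_sum_weight hP z
    rw [TensorProduct.tmul_sum]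
    exact sum_mem fun μ _ => Submodule.mem_iSup_of_mem μ (tmul_mem_weightSpace T' (hv μ) t)

lemma InO.baseChange (hP : InO B φ ρ) :
    InO B (baseChangeStr T' φ) (baseChangeRep T' ρ) := by
  refine ⟨fun z => ?_, iSup_weightSpace_baseChange T' hP.2⟩
  induction z with
  | zero => exact ⟨⊥, inferInstance, zero_mem _, fun x _ v hv => by
      rw [(Submodule.mem_bot ℂ).1 hv, map_zero]; exact zero_mem _⟩
  | add a b ha hb =>
    obtain ⟨V, h1, h2, h3⟩ := ha
    obtain ⟨W, h4, h5, h6⟩ := hb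
    refine ⟨V ⊔ W, inferInstance, Submodule.add_mem_sup h2 h5, fun x hx v hv => ?_⟩
    obtain ⟨y, hy, w, hw, rfl⟩ := Submodule.mem_sup.1 hv
    rw [map_add]
    exact Submodule.add_mem_sup (h3 x hx y hy) (h6 x hx w hw)
  | tmul t z =>
    obtain ⟨V, h1, h2, h3⟩ := hP.1 z
    let j : P →ₗ[ℂ] T' ⊗[T] P := (TensorProduct.mk T T' P t).restrictScalars ℂ
    refine ⟨V.map j, inferInstance, ⟨z, h2, rfl⟩, ?_⟩
    rintro x hx _ ⟨v, hv, rfl⟩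
    exact ⟨ρ x v, h3 x hx v hv, rfl⟩

lemma homBaseChange_tmul (t : T') (f : bimodHom ρ σ) :
    homBaseChange T' ρ σ (t ⊗ₜ f) = t • homExtend T' ρ σ f := by
  simp [homBaseChange]

end HomBasis

/-! ### Finiteness and base change of spaces of homomorphisms -/

section HomFlags

local notation "ι" => UniversalEnvelopingAlgebra.ι ℂ

variable {g : Type*} [LieRing g] [LieAlgebra ℂ g] {H B Bop : LieSubalgebra ℂ g}
variable {T : Type*} [CommRing T] [Algebra ℂ T] {φ : SymmetricAlgebra ℂ H →ₐ[ℂ] T}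
variable {P : Type*} [AddCommGroup P] [Module ℂ P] [Module T P] [IsScalarTower ℂ T P]
variable {Q : Type*} [AddCommGroup Q] [Module ℂ Q] [Module T Q] [IsScalarTower ℂ T Q]
variable {ρ : g →ₗ⁅ℂ⁆ Module.End T P} {σ : g →ₗ⁅ℂ⁆ Module.End T Q}

/-- The universal property is applied to `T` with `Bop` acting by the character of weight `l i`.
Only the `i`-th generator has a nonzero target, so the other weights impose no condition. -/
lemma exists_dual_functional (D : Triangular H B Bop) {r : ℕ} {m : Fin r → P}
    {l : Fin r → Module.Dual ℂ H} (b : Module.Basis (Σ _ : Fin r, Fin D.p → ℕ) T P)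
    (hb : ∀ x, b x = repU ρ (mon (fun i => ι (D.f i)) x.2) (m x.1))
    (hm : ∀ i, m i ∈ weightSpace φ ρ (l i)) (i : Fin r) :
    ∃ ξ : P →ₗ[T] T, (∀ j, ξ (m j) = if i = j then 1 else 0) ∧
      ∀ z, ∀ (h : H), ∀ x ∈ derivedSubspace Bop,
        ξ (ρ ((h : g) + x) z) = defChar φ (l i) h * ξ z := by
  obtain ⟨χ, hχ, -⟩ := exists_lie_char (T := T) (φ := φ) (l := l i) D.disj_Bop D.sup_Bop
  let τ : Bop →ₗ⁅ℂ⁆ Module.End T T :=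
    ((Algebra.lmul T T).restrictScalars ℂ).toLieHom.comp χ
  have hτ : ∀ k t, τ k t = χ k * t := fun _ _ => rfl
  obtain ⟨ξ, h1, h2⟩ := exists_equivariant_map D b hb hm τ (fun j => if i = j then 1 else 0)
    (fun j h k hk => by
      by_cases hij : i = j
      · subst hij
        rw [hτ, hχ h 0 (zero_mem _) k (by rw [hk, add_zero]), smul_eq_mul]
      · rw [if_neg hij, map_zero, smul_zero])
  refine ⟨ξ, h1, fun z h x hx => ?_⟩
  have hmem : (h : g) + x ∈ Bop := by
    rw [← LieSubalgebra.mem_toSubmodule, ← D.sup_Bop]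
    exact Submodule.add_mem_sup h.2 hx
  rw [← hχ h x hx ⟨_, hmem⟩ rfl, ← hτ]
  exact h2 ⟨_, hmem⟩ z

theorem bimodHom_of_flags [FiniteDimensional ℂ g] [LieAlgebra.IsSemisimple ℂ g]
    [H.IsCartanSubalgebra] (D : Triangular H B Bop)
    (hP : ⨆ l, weightSpace φ ρ l = ⊤) (hPflag : HasDeltaFlag B φ ρ)
    (hQ : ⨆ l, weightSpace φ σ l = ⊤) (hQflag : HasNablaFlag Bop φ σ) :
    Module.Finite T (bimodHom ρ σ) ∧ Module.Free T (bimodHom ρ σ) ∧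
    ∀ (T' : Type*) [CommRing T'] [Algebra ℂ T'] [Algebra T T'] [IsScalarTower ℂ T T'],
      Function.Bijective (homBaseChange T' ρ σ) := by
  classical
  obtain ⟨r, m, l, b, hm, hb⟩ := exists_basis_of_deltaFlag D hP hPflag
  obtain ⟨n, F, ν, ε, q, hF, hsurj⟩ := exists_isNablaFiltration D hQflag
  have hgen := isGeneratedBy_of_basis D b hb
  have hex : ∀ k (i : {i // l i = ν k}), ∃ f : bimodHom ρ σ, (∀ z, f.1 z ∈ F k.succ) ∧
      ∀ j, ε k (f.1 (m j)) = if i.1 = j then 1 else 0 := by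
    rintro k ⟨i, hi⟩
    obtain ⟨ξ, h1, h2⟩ := exists_dual_functional D b hb hm i
    obtain ⟨f, hf, h3, h4⟩ := exists_bimodHom_lift hQ hP hF hsurj b hb hm k ξ
      (fun z h x hx => by rw [h2 z h x hx, hi])
    exact ⟨⟨f, hf⟩, h3, fun j => by rw [h4, h1]⟩
  choose f hf hfε using hex
  obtain ⟨c, hc⟩ := exists_basis_bimodHom hF hgen hm f hf hfε
  refine ⟨Module.Finite.of_basis c, Module.Free.of_basis c, fun T' _ _ _ _ => ?_⟩
  -- The scalar extensions of the same homs satisfy the basis criterion over `T'`, so the canonical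
  -- map matches two bases with one index set.
  obtain ⟨c', hc'⟩ := exists_basis_bimodHom (hF.baseChange T') (hgen.baseChange T')
    (fun i => tmul_mem_weightSpace T' (hm i) 1) (fun k i => homExtend T' ρ σ (f k i))
    (fun k i z => by
      induction z with
      | zero => rw [map_zero]; exact zero_mem _
      | add x y hx hy => rw [map_add]; exact add_mem hx hy
      | tmul t z => exact Submodule.tmul_mem_baseChange_of_mem t (hf k i z))
    (fun k i j => by
      change functionalBaseChange T' (ε k) (1 ⊗ₜ (f k i).1 (m j)) = _
      rw [functionalBaseChange_tmul, hfε, mul_one]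
      split_ifs <;> simp)
  have heq : homBaseChange T' ρ σ = ((c.baseChange T').equiv c' (Equiv.refl _)).toLinearMap := by
    refine (c.baseChange T').ext fun x => ?_
    rw [LinearEquiv.coe_coe, Module.Basis.equiv_apply, Module.Basis.baseChange_apply,
      homBaseChange_tmul, one_smul, hc, Equiv.refl_apply, hc']
  rw [heq]
  exact LinearEquiv.bijective _

end HomFlags

/-! ### Passage to direct summands. -/

section Summands

variable {g : Type*} [LieRing g] [LieAlgebra ℂ g]
variable {T : Type*} [CommRing T] [Algebra ℂ T]
variable {M : Type*} [AddCommGroup M] [Module ℂ M] [Module T M] [IsScalarTower ℂ T M]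
variable {N : Type*} [AddCommGroup N] [Module ℂ N] [Module T N] [IsScalarTower ℂ T N]
variable {P : Type*} [AddCommGroup P] [Module ℂ P] [Module T P] [IsScalarTower ℂ T P]
variable {Q : Type*} [AddCommGroup Q] [Module ℂ Q] [Module T Q] [IsScalarTower ℂ T Q]
variable {ρM : g →ₗ⁅ℂ⁆ Module.End T M} {ρN : g →ₗ⁅ℂ⁆ Module.End T N}
variable {ρP : g →ₗ⁅ℂ⁆ Module.End T P} {ρQ : g →ₗ⁅ℂ⁆ Module.End T Q}

/-- The map `f ↦ j ∘ f ∘ p` on homomorphisms of bimodules. -/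
def bimodHomMap (p : bimodHom ρP ρM) (j : bimodHom ρN ρQ) :
    bimodHom ρM ρN →ₗ[T] bimodHom ρP ρQ where
  toFun f := ⟨j.1 ∘ₗ f.1 ∘ₗ p.1, fun x z => by
    simp only [LinearMap.comp_apply, p.2 x z, f.2 x, j.2 x]⟩
  map_add' f f' := by
    refine Subtype.ext (LinearMap.ext fun z => ?_)
    simp
  map_smul' t f := by
    refine Subtype.ext (LinearMap.ext fun z => ?_)
    simp

lemma bimodHomMap_bimodHomMap {i : bimodHom ρM ρP} {p : bimodHom ρP ρM} {j : bimodHom ρN ρQ}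
    {s : bimodHom ρQ ρN} (hp : p.1 ∘ₗ i.1 = LinearMap.id) (hs : s.1 ∘ₗ j.1 = LinearMap.id)
    (f : bimodHom ρM ρN) : bimodHomMap i s (bimodHomMap p j f) = f := by
  refine Subtype.ext (LinearMap.ext fun z => ?_)
  change (s.1 ∘ₗ j.1) (f.1 ((p.1 ∘ₗ i.1) z)) = f.1 z
  rw [hp, hs, LinearMap.id_apply, LinearMap.id_apply]

variable (T' : Type*) [CommRing T'] [Algebra ℂ T'] [Algebra T T'] [IsScalarTower ℂ T T']

lemma homBaseChange_bimodHomMap (p : bimodHom ρP ρM) (j : bimodHom ρN ρQ)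
    (z : T' ⊗[T] bimodHom ρM ρN) :
    homBaseChange T' ρP ρQ ((bimodHomMap p j).baseChange T' z) =
      bimodHomMap (homExtend T' ρP ρM p) (homExtend T' ρN ρQ j) (homBaseChange T' ρM ρN z) := by
  induction z with
  | zero => simp only [map_zero]
  | add a b ha hb => simp only [map_add, ha, hb]
  | tmul t f =>
    rw [LinearMap.baseChange_tmul, homBaseChange_tmul, homBaseChange_tmul, map_smul]
    congr 1
    refine Subtype.ext (TensorProduct.AlgebraTensorModule.ext fun t z => ?_)
    rfl

lemma homExtend_comp_eq_id {i : bimodHom ρM ρP} {p : bimodHom ρP ρM}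
    (h : p.1 ∘ₗ i.1 = LinearMap.id) :
    (homExtend T' ρP ρM p).1 ∘ₗ (homExtend T' ρM ρP i).1 = LinearMap.id := by
  refine TensorProduct.AlgebraTensorModule.ext fun t z => ?_
  change t ⊗ₜ (p.1 ∘ₗ i.1) z = t ⊗ₜ z
  rw [h, LinearMap.id_apply]

theorem bimodHom_of_isDirectSummand (hMP : IsDirectSummand ρM ρP) (hNQ : IsDirectSummand ρN ρQ)
    [Module.Finite T (bimodHom ρP ρQ)] [Module.Projective T (bimodHom ρP ρQ)] :
    Module.Finite T (bimodHom ρM ρN) ∧ Module.Projective T (bimodHom ρM ρN) := by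
  obtain ⟨i, hi, p, hp, hpi⟩ := hMP
  obtain ⟨j, hj, s, hs, hsj⟩ := hNQ
  have h1 := bimodHomMap_bimodHomMap (i := ⟨i, hi⟩) (p := ⟨p, hp⟩) (j := ⟨j, hj⟩)
    (s := ⟨s, hs⟩) hpi hsj
  refine ⟨Module.Finite.of_surjective (bimodHomMap ⟨i, hi⟩ ⟨s, hs⟩) fun f => ⟨_, h1 f⟩,
    Module.Projective.of_split (bimodHomMap ⟨p, hp⟩ ⟨j, hj⟩) (bimodHomMap ⟨i, hi⟩ ⟨s, hs⟩)
      (LinearMap.ext h1)⟩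

/-- By naturality, the canonical map for the summands is a retract of the one for `P` and `Q`, and
bijectivity passes to retracts. -/
theorem homBaseChange_bijective_of_isDirectSummand (hMP : IsDirectSummand ρM ρP)
    (hNQ : IsDirectSummand ρN ρQ) (hPQ : Function.Bijective (homBaseChange T' ρP ρQ)) :
    Function.Bijective (homBaseChange T' ρM ρN) := by
  obtain ⟨i, hi, p, hp, hpi⟩ := hMP
  obtain ⟨j, hj, s, hs, hsj⟩ := hNQ
  have h1 := bimodHomMap_bimodHomMap (i := ⟨i, hi⟩) (p := ⟨p, hp⟩) (j := ⟨j, hj⟩)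
    (s := ⟨s, hs⟩) hpi hsj
  have h2 := bimodHomMap_bimodHomMap
    (homExtend_comp_eq_id T' (i := ⟨i, hi⟩) (p := ⟨p, hp⟩) hpi)
    (homExtend_comp_eq_id T' (i := ⟨j, hj⟩) (p := ⟨s, hs⟩) hsj)
  have h3 : ∀ z, (bimodHomMap ⟨i, hi⟩ ⟨s, hs⟩).baseChange T'
      ((bimodHomMap (ρP := ρP) (ρQ := ρQ) ⟨p, hp⟩ ⟨j, hj⟩).baseChange T' z) = z := fun z => by
    rw [← LinearMap.comp_apply, ← LinearMap.baseChange_comp,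
      show bimodHomMap _ _ ∘ₗ bimodHomMap _ _ = LinearMap.id from LinearMap.ext h1,
      LinearMap.baseChange_id, LinearMap.id_apply]
  constructor
  · intro a b hab
    rw [← h3 a, ← h3 b]
    congr 1
    apply hPQ.1
    rw [homBaseChange_bimodHomMap, homBaseChange_bimodHomMap, hab]
  · intro f
    obtain ⟨z, hz⟩ := hPQ.2 (bimodHomMap (homExtend T' ρP ρM ⟨p, hp⟩)
      (homExtend T' ρN ρQ ⟨j, hj⟩) f)
    refine ⟨(bimodHomMap ⟨i, hi⟩ ⟨s, hs⟩).baseChange T' z, ?_⟩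
    rw [homBaseChange_bimodHomMap, hz, h2]

end Summands

/-! ### Root spaces of Borel subalgebras -/

section Roots

variable {g : Type*} [LieRing g] [LieAlgebra ℂ g]

lemma lie_mem_derivedSubspace {K : LieSubalgebra ℂ g} {x y : g} (hx : x ∈ K) (hy : y ∈ K) :
    ⁅x, y⁆ ∈ derivedSubspace K :=
  Submodule.subset_span ⟨x, hx, y, hy, rfl⟩

lemma lie_mem_of_mem_iSup {I J : Type*} {V : I → Submodule ℂ g} {W : J → Submodule ℂ g}
    {K : Submodule ℂ g} (hVW : ∀ i j, ∀ x ∈ V i, ∀ y ∈ W j, ⁅x, y⁆ ∈ K) {x y : g}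
    (hx : x ∈ ⨆ i, V i) (hy : y ∈ ⨆ j, W j) : ⁅x, y⁆ ∈ K := by
  induction hx using Submodule.iSup_induction' with
  | zero => rw [zero_lie]; exact zero_mem _
  | add a b _ _ ha hb => rw [add_lie]; exact add_mem ha hb
  | mem i x hx =>
    induction hy using Submodule.iSup_induction' with
    | zero => rw [lie_zero]; exact zero_mem _
    | add a b _ _ ha hb => rw [lie_add]; exact add_mem ha hb
    | mem j y hy => exact hVW i j x hx y hy

/-- Two steps of the derived series of `K` land in `L`, and from there the two series can be
compared. -/
lemma isSolvable_of_lie_mem {K L : LieSubalgebra ℂ g} [LieAlgebra.IsSolvable L]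
    (S : Submodule ℂ g) (hK : ∀ x ∈ K, ∀ y ∈ K, ⁅x, y⁆ ∈ S) (hS : ∀ x ∈ S, ∀ y ∈ S, ⁅x, y⁆ ∈ L) :
    LieAlgebra.IsSolvable K := by
  have h1 : ∀ x ∈ LieAlgebra.derivedSeries ℂ K 1, (x : g) ∈ S := by
    intro x hx
    rw [LieAlgebra.derivedSeries_def, LieAlgebra.derivedSeriesOfIdeal_succ,
      ← LieSubmodule.mem_toSubmodule, LieSubmodule.lieIdeal_oper_eq_linear_span'] at hx
    induction hx using Submodule.span_induction with
    | mem z hz =>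
      obtain ⟨a, -, b, -, rfl⟩ := hz
      exact hK a a.2 b b.2
    | zero => exact zero_mem _
    | add a b _ _ ha hb => exact add_mem ha hb
    | smul c a _ ha => exact S.smul_mem c ha
  have h2 : ∀ k, ∀ x ∈ LieAlgebra.derivedSeries ℂ K (k + 2),
      ∃ y ∈ LieAlgebra.derivedSeries ℂ L k, (y : g) = x := by
    intro k
    induction k with
    | zero =>
      intro x hx
      rw [LieAlgebra.derivedSeries_def, LieAlgebra.derivedSeriesOfIdeal_succ,
        ← LieSubmodule.mem_toSubmodule, LieSubmodule.lieIdeal_oper_eq_linear_span'] at hx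
      suffices h : (x : g) ∈ L from ⟨⟨x, h⟩, trivial, rfl⟩
      induction hx using Submodule.span_induction with
      | mem z hz =>
        obtain ⟨a, ha, b, hb, rfl⟩ := hz
        exact hS a (h1 a ha) b (h1 b hb)
      | zero => exact zero_mem _
      | add a b _ _ ha hb => exact add_mem ha hb
      | smul c a _ ha => exact L.smul_mem c ha
    | succ k ih =>
      intro x hx
      rw [show k + 1 + 2 = (k + 2) + 1 by ring, LieAlgebra.derivedSeries_def,
        LieAlgebra.derivedSeriesOfIdeal_succ, ← LieSubmodule.mem_toSubmodule,
        LieSubmodule.lieIdeal_oper_eq_linear_span'] at hx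
      induction hx using Submodule.span_induction with
      | mem z hz =>
        obtain ⟨a, ha, b, hb, rfl⟩ := hz
        obtain ⟨a', ha', haa⟩ := ih a ha
        obtain ⟨b', hb', hbb⟩ := ih b hb
        refine ⟨⁅a', b'⁆, ?_, by rw [LieSubalgebra.coe_bracket, haa, hbb]; rfl⟩
        rw [LieAlgebra.derivedSeries_def, LieAlgebra.derivedSeriesOfIdeal_succ]
        exact LieSubmodule.lie_mem_lie ha' hb'
      | zero => exact ⟨0, zero_mem _, rfl⟩
      | add a b _ _ ha hb =>
        obtain ⟨a', ha', haa⟩ := ha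
        obtain ⟨b', hb', hbb⟩ := hb
        exact ⟨a' + b', add_mem ha' hb', congrArg₂ (· + ·) haa hbb⟩
      | smul c a _ ha =>
        obtain ⟨a', ha', haa⟩ := ha
        exact ⟨c • a', Submodule.smul_mem _ c ha', congrArg (c • ·) haa⟩
  obtain ⟨k, hk⟩ := LieAlgebra.IsSolvable.solvable ℂ L
  refine LieAlgebra.IsSolvable.mk (R := ℂ) (k := k + 2) ?_
  rw [eq_bot_iff]
  intro x hx
  obtain ⟨y, hy, hyx⟩ := h2 k x hx
  rw [hk, LieSubmodule.mem_bot] at hy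
  rw [LieSubmodule.mem_bot]
  refine Subtype.ext ?_
  rw [← hyx, hy]
  rfl

/-- The span of an `sl₂` triple is perfect, so it survives in every derived term. -/
lemma not_isSolvable_of_isSl2Triple {K : LieSubalgebra ℂ g} {h e f : g}
    (ht : IsSl2Triple h e f) (he : e ∈ K) (hf : f ∈ K) : ¬ LieAlgebra.IsSolvable K := by
  intro hK
  have hh : h ∈ K := ht.lie_e_f ▸ K.lie_mem he hf
  have hmem : ∀ k, (⟨e, he⟩ : K) ∈ LieAlgebra.derivedSeries ℂ K k ∧
      (⟨f, hf⟩ : K) ∈ LieAlgebra.derivedSeries ℂ K k ∧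
      (⟨h, hh⟩ : K) ∈ LieAlgebra.derivedSeries ℂ K k := by
    intro k
    induction k with
    | zero => exact ⟨trivial, trivial, trivial⟩
    | succ k ih =>
      obtain ⟨h1, h2, h3⟩ := ih
      rw [LieAlgebra.derivedSeries_def, LieAlgebra.derivedSeriesOfIdeal_succ]
      have he' : (⟨e, he⟩ : K) = (2⁻¹ : ℂ) • ⁅(⟨h, hh⟩ : K), (⟨e, he⟩ : K)⁆ := by
        refine Subtype.ext ?_
        change e = (2⁻¹ : ℂ) • ⁅h, e⁆
        rw [ht.lie_h_e_smul ℂ, smul_smul, inv_mul_cancel₀ two_ne_zero, one_smul]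
      have hf' : (⟨f, hf⟩ : K) = (-2⁻¹ : ℂ) • ⁅(⟨h, hh⟩ : K), (⟨f, hf⟩ : K)⁆ := by
        refine Subtype.ext ?_
        change f = (-2⁻¹ : ℂ) • ⁅h, f⁆
        rw [ht.lie_lie_smul_f ℂ, smul_neg, neg_smul, neg_neg, smul_smul,
          inv_mul_cancel₀ two_ne_zero, one_smul]
      have hh' : (⟨h, hh⟩ : K) = ⁅(⟨e, he⟩ : K), (⟨f, hf⟩ : K)⁆ := Subtype.ext ht.lie_e_f.symm
      refine ⟨?_, ?_, ?_⟩
      · rw [he']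
        exact Submodule.smul_mem _ _ (LieSubmodule.lie_mem_lie h3 h1)
      · rw [hf']
        exact Submodule.smul_mem _ _ (LieSubmodule.lie_mem_lie h3 h2)
      · rw [hh']
        exact LieSubmodule.lie_mem_lie h1 h2
  obtain ⟨k, hk⟩ := LieAlgebra.IsSolvable.solvable ℂ K
  have h1 := (hmem k).2.2
  rw [hk, LieSubmodule.mem_bot] at h1
  exact ht.h_ne_zero (congrArg Subtype.val h1)

variable (H : LieSubalgebra ℂ g) [H.IsCartanSubalgebra]

/-- The root space of `χ`, as a subspace. -/
def rootSubspace (χ : H → ℂ) : Submodule ℂ g := (LieAlgebra.rootSpace H χ).toSubmodule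

/-- The roots whose root spaces lie in `K`. -/
def rootsIn (K : LieSubalgebra ℂ g) : Set (H → ℂ) :=
  {χ | χ ≠ 0 ∧ rootSubspace H χ ≠ ⊥ ∧ rootSubspace H χ ≤ K.toSubmodule}

/-- The sum of the root spaces of the elements of `A`. -/
def rootSum (A : Set (H → ℂ)) : Submodule ℂ g := ⨆ χ : A, rootSubspace H χ

variable {H}

lemma lie_mem_rootSubspace {χ ψ : H → ℂ} {x y : g} (hx : x ∈ rootSubspace H χ)
    (hy : y ∈ rootSubspace H ψ) : ⁅x, y⁆ ∈ rootSubspace H (χ + ψ) :=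
  LieAlgebra.lie_mem_genWeightSpace_of_mem_genWeightSpace hx hy

lemma iSupIndep_rootSubspace : iSupIndep (rootSubspace H) :=
  LieSubmodule.iSupIndep_toSubmodule.2 (LieModule.iSupIndep_genWeightSpace ℂ H g)

lemma rootSum_le {A : Set (H → ℂ)} {K : Submodule ℂ g} :
    rootSum H A ≤ K ↔ ∀ χ ∈ A, rootSubspace H χ ≤ K := by
  rw [rootSum, iSup_le_iff, Subtype.forall]

lemma rootSubspace_le_rootSum {A : Set (H → ℂ)} {χ : H → ℂ} (hχ : χ ∈ A) :
    rootSubspace H χ ≤ rootSum H A := rootSum_le.1 le_rfl χ hχ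

lemma disjoint_rootSum {A A' : Set (H → ℂ)} (h : Disjoint A A') :
    Disjoint (rootSum H A) (rootSum H A') := by
  rw [rootSum, rootSum, iSup_subtype, iSup_subtype]
  exact iSupIndep_rootSubspace.disjoint_biSup_biSup h

lemma exists_weight {χ : H → ℂ} (hχ : rootSubspace H χ ≠ ⊥) :
    ∃ α : LieModule.Weight ℂ H g, ⇑α = χ :=
  ⟨⟨χ, fun h => hχ ((LieSubmodule.toSubmodule_eq_bot _).2 h)⟩, rfl⟩

variable [FiniteDimensional ℂ g]

lemma rootSubspace_zero : rootSubspace H 0 = H.toSubmodule := by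
  rw [rootSubspace, LieAlgebra.rootSpace_zero_eq]
  rfl

lemma iSup_rootSubspace : ⨆ χ, rootSubspace H χ = ⊤ :=
  LieSubmodule.iSup_toSubmodule_eq_top.2 (LieModule.iSup_genWeightSpace_eq_top ℂ H g)

lemma finite_rootsIn (K : LieSubalgebra ℂ g) : (rootsIn H K).Finite := by
  refine (LieModule.finite_genWeightSpace_ne_bot ℂ H g).subset fun χ hχ h => hχ.2.1 ?_
  exact (LieSubmodule.toSubmodule_eq_bot _).2 h

variable [LieAlgebra.IsSemisimple ℂ g]

lemma lie_of_mem_rootSubspace {χ : H → ℂ} {x : g} (hx : x ∈ rootSubspace H χ) (h : H) :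
    ⁅(h : g), x⁆ = χ h • x :=
  LieAlgebra.IsKilling.lie_eq_smul_of_mem_rootSpace hx h

lemma finrank_rootSubspace {χ : H → ℂ} (hχ : χ ≠ 0) (hχ' : rootSubspace H χ ≠ ⊥) :
    Module.finrank ℂ (rootSubspace H χ) = 1 := by
  obtain ⟨α, rfl⟩ := exists_weight hχ'
  exact LieAlgebra.IsKilling.finrank_rootSpace_eq_one α hχ

lemma rootSubspace_le_of_mem {χ : H → ℂ} (hχ : χ ≠ 0) {x : g} (hx : x ∈ rootSubspace H χ)
    (hx0 : x ≠ 0) {K : Submodule ℂ g} (hK : x ∈ K) : rootSubspace H χ ≤ K := by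
  have h1 := finrank_rootSubspace hχ fun h => hx0 (by rwa [h, Submodule.mem_bot] at hx)
  intro y hy
  obtain ⟨c, hc⟩ := (finrank_eq_one_iff_of_nonzero' (⟨x, hx⟩ : rootSubspace H χ)
    (fun h => hx0 (congrArg Subtype.val h))).1 h1 ⟨y, hy⟩
  rw [← show c • x = y from congrArg Subtype.val hc]
  exact K.smul_mem c hK

lemma mem_rootsIn_of_mem {K : LieSubalgebra ℂ g} {χ : H → ℂ} (hχ : χ ≠ 0) {x : g}
    (hx : x ∈ rootSubspace H χ) (hx0 : x ≠ 0) (hK : x ∈ K) : χ ∈ rootsIn H K :=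
  ⟨hχ, fun h => hx0 (by rwa [h, Submodule.mem_bot] at hx), rootSubspace_le_of_mem hχ hx hx0 hK⟩

lemma exists_sl2Triple {χ : H → ℂ} (hχ : χ ≠ 0) (hχ' : rootSubspace H χ ≠ ⊥) :
    ∃ h e f : g, IsSl2Triple h e f ∧ e ∈ rootSubspace H χ ∧ f ∈ rootSubspace H (-χ) := by
  obtain ⟨α, rfl⟩ := exists_weight hχ'
  exact LieAlgebra.IsKilling.exists_isSl2Triple_of_weight_isNonZero hχ

lemma neg_notMem_rootsIn {K : LieSubalgebra ℂ g} (hK : LieAlgebra.IsSolvable K) {χ : H → ℂ}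
    (hχ : χ ∈ rootsIn H K) : -χ ∉ rootsIn H K := by
  intro hneg
  obtain ⟨h, e, f, ht, he, hf⟩ := exists_sl2Triple hχ.1 hχ.2.1
  exact not_isSolvable_of_isSl2Triple ht (hχ.2.2 he) (hneg.2.2 hf) hK

lemma add_mem_rootsIn {K : LieSubalgebra ℂ g} (hK : LieAlgebra.IsSolvable K) {χ ψ : H → ℂ}
    (hχ : χ ∈ rootsIn H K) (hψ : ψ ∈ rootsIn H K) {x y : g} (hx : x ∈ rootSubspace H χ)
    (hy : y ∈ rootSubspace H ψ) (hxy : ⁅x, y⁆ ≠ 0) : χ + ψ ∈ rootsIn H K := by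
  refine mem_rootsIn_of_mem (fun h => ?_) (lie_mem_rootSubspace hx hy) hxy
    (K.lie_mem (hχ.2.2 hx) (hψ.2.2 hy))
  rw [add_comm] at h
  exact neg_notMem_rootsIn hK hχ (by rwa [← eq_neg_of_add_eq_zero_left h])

/-- In a vanishing sum, two members can be replaced by their sum, which is again a root in `K`; this
contradicts minimal length. It gives the positivity of a root system without choosing a positive
system. -/
lemma sum_ne_zero_of_mem_rootsIn {K : LieSubalgebra ℂ g} (hK : LieAlgebra.IsSolvable K)
    (s : Multiset (H → ℂ)) (hs : s ≠ 0) (hsK : ∀ χ ∈ s, χ ∈ rootsIn H K) : s.sum ≠ 0 := by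
  induction hn : Multiset.card s using Nat.strong_induction_on generalizing s with
  | _ n ih =>
  intro hsum
  obtain ⟨χ, hχ⟩ := Multiset.exists_mem_of_ne_zero hs
  obtain ⟨s, rfl⟩ := Multiset.exists_cons_of_mem hχ
  obtain ⟨hχ0, hχ1, hχ2⟩ := hsK χ hχ
  obtain ⟨h, e, f, ht, he, hf⟩ := exists_sl2Triple hχ0 hχ1
  have hh : h ∈ H := by
    rw [← LieSubalgebra.mem_toSubmodule, ← rootSubspace_zero, ← add_neg_cancel χ, ← ht.lie_e_f]
    exact lie_mem_rootSubspace he hf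
  have hχh : χ ⟨h, hh⟩ = 2 := by
    have h1 := lie_of_mem_rootSubspace he ⟨h, hh⟩
    rw [ht.lie_h_e_smul ℂ] at h1
    exact (smul_left_injective ℂ ht.e_ne_zero h1).symm
  -- Since `χ` takes the value `2` on its coroot, some other member must be negative there. Real
  -- parts suffice.
  have hex : ∃ ψ ∈ s, (ψ ⟨h, hh⟩).re < 0 := by
    by_contra! hcon
    have h1 : 0 ≤ ((s.map fun ψ => (ψ ⟨h, hh⟩).re)).sum :=
      Multiset.sum_nonneg fun r hr => by
        obtain ⟨ψ, hψ, rfl⟩ := Multiset.mem_map.1 hr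
        exact hcon ψ hψ
    have h2 := congrArg (fun χ : H → ℂ => (χ ⟨h, hh⟩).re) hsum
    let ev : (H → ℂ) →+ ℝ :=
      Complex.reAddGroupHom.comp (Pi.evalAddMonoidHom (fun _ : H => ℂ) ⟨h, hh⟩)
    have h3 : ev (Multiset.sum (χ ::ₘ s)) = 0 := h2
    rw [map_multiset_sum, Multiset.map_cons, Multiset.sum_cons] at h3
    have h4 : ev χ = 2 := by
      change (χ ⟨h, hh⟩).re = 2
      rw [hχh]
      rfl
    have h5 : (s.map ev).sum = (s.map fun ψ => (ψ ⟨h, hh⟩).re).sum := rfl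
    linarith
  obtain ⟨ψ, hψ, hre⟩ := hex
  have hψK := hsK ψ (Multiset.mem_cons_of_mem hψ)
  obtain ⟨s, rfl⟩ := Multiset.exists_cons_of_mem hψ
  obtain ⟨y, hy, hy0⟩ := (Submodule.ne_bot_iff _).1 hψK.2.1
  have hey : ⁅e, y⁆ ≠ 0 := by
    intro h0
    -- Otherwise `y` would be a primitive vector of negative weight, impossible in a
    -- finite-dimensional module.
    have hprim : ht.HasPrimitiveVectorWith y (ψ ⟨h, hh⟩) :=
      { ne_zero := hy0
        lie_h := lie_of_mem_rootSubspace hy ⟨h, hh⟩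
        lie_e := h0 }
    obtain ⟨k, hk⟩ := hprim.exists_nat
    rw [hk] at hre
    simp only [Complex.natCast_re] at hre
    exact absurd hre (not_lt.2 (Nat.cast_nonneg k))
  have hadd := add_mem_rootsIn hK ⟨hχ0, hχ1, hχ2⟩ hψK he hy hey
  refine ih _ ?_ ((χ + ψ) ::ₘ s) (Multiset.cons_ne_zero) ?_ rfl ?_
  · rw [← hn]
    simp
  · intro θ hθ
    rcases Multiset.mem_cons.1 hθ with rfl | hθ
    · exact hadd
    · exact hsK θ (Multiset.mem_cons_of_mem (Multiset.mem_cons_of_mem hθ))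
  · rw [← hsum, Multiset.sum_cons, Multiset.sum_cons, Multiset.sum_cons, add_assoc]

/-- An `H`-stable subspace is the sum of its intersections with the root spaces, and each nonzero
root space, being a line, is contained entirely or meets it trivially. -/
lemma sup_rootSum_rootsIn {K : LieSubalgebra ℂ g} (hHK : H ≤ K) :
    H.toSubmodule ⊔ rootSum H (rootsIn H K) = K.toSubmodule := by
  refine le_antisymm (sup_le hHK (rootSum_le.2 fun χ hχ => hχ.2.2)) ?_
  let N : LieSubmodule ℂ H g :=
    { K.toSubmodule with lie_mem := fun {h x} hx => K.lie_mem (hHK h.2) hx }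
  have hN : K.toSubmodule = ⨆ α : LieModule.Weight ℂ H g,
      (N ⊓ LieModule.genWeightSpace g α).toSubmodule := by
    rw [← LieSubmodule.iSup_toSubmodule, ← LieModule.eq_iSup_inf_genWeightSpace (N := N)]
  rw [hN]
  refine iSup_le fun α x hx => ?_
  obtain ⟨hxK, hx⟩ := LieSubmodule.mem_inf _ _ _ |>.1 hx
  change x ∈ rootSubspace H α at hx
  by_cases hα : (α : H → ℂ) = 0
  · rw [hα, rootSubspace_zero] at hx
    exact Submodule.mem_sup_left hx
  · by_cases hx0 : x = 0
    · rw [hx0]; exact zero_mem _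
    · exact Submodule.mem_sup_right
        (rootSubspace_le_rootSum (mem_rootsIn_of_mem hα hx hx0 hxK) hx)

lemma derivedSubspace_eq_rootSum {K : LieSubalgebra ℂ g} (hHK : H ≤ K)
    (hK : LieAlgebra.IsSolvable K) : derivedSubspace K = rootSum H (rootsIn H K) := by
  have hlie : ∀ χ ∈ rootsIn H K, ∀ h : H, ∀ x ∈ rootSubspace H χ, ⁅(h : g), x⁆ ∈
      rootSum H (rootsIn H K) := fun χ hχ h x hx => by
    rw [lie_of_mem_rootSubspace hx]
    exact Submodule.smul_mem _ _ (rootSubspace_le_rootSum hχ hx)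
  have hlie' : ∀ h : H, ∀ x ∈ rootSum H (rootsIn H K), ⁅(h : g), x⁆ ∈ rootSum H (rootsIn H K) :=
    fun h x hx => lie_mem_of_mem_iSup (V := fun _ : Unit => H.toSubmodule)
      (W := fun χ : rootsIn H K => rootSubspace H χ.1)
      (fun _ χ y hy z hz => hlie χ.1 χ.2 ⟨y, hy⟩ z hz) (Submodule.mem_iSup_of_mem () h.2) hx
  refine le_antisymm (Submodule.span_le.2 ?_) (rootSum_le.2 fun χ hχ x hx => ?_)
  · rintro _ ⟨x, hx, y, hy, rfl⟩
    rw [← LieSubalgebra.mem_toSubmodule, ← sup_rootSum_rootsIn hHK] at hx hy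
    obtain ⟨h, hh, x, hxR, rfl⟩ := Submodule.mem_sup.1 hx
    obtain ⟨h', hh', y, hyR, rfl⟩ := Submodule.mem_sup.1 hy
    have h0 : ⁅h, h'⁆ = 0 := congrArg Subtype.val (trivial_lie_zero H H ⟨h, hh⟩ ⟨h', hh'⟩)
    have h1 : ⁅x, h'⁆ ∈ rootSum H (rootsIn H K) := by
      rw [← lie_skew]
      exact neg_mem (hlie' ⟨h', hh'⟩ x hxR)
    have h2 : ⁅x, y⁆ ∈ rootSum H (rootsIn H K) := by
      refine lie_mem_of_mem_iSup (fun χ ψ a ha b hb => ?_) hxR hyR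
      by_cases hab : ⁅a, b⁆ = 0
      · rw [hab]; exact zero_mem _
      · exact rootSubspace_le_rootSum (add_mem_rootsIn hK χ.2 ψ.2 ha hb hab)
          (lie_mem_rootSubspace ha hb)
    rw [add_lie, lie_add, lie_add, h0, zero_add]
    exact add_mem (hlie' ⟨h, hh⟩ y hyR) (add_mem h1 h2)
  · obtain ⟨h, hh⟩ := Function.ne_iff.1 hχ.1
    have h1 : x = (χ h)⁻¹ • ⁅(h : g), x⁆ := by
      rw [lie_of_mem_rootSubspace hx, smul_smul, inv_mul_cancel₀ hh, one_smul]
    rw [h1]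
    exact Submodule.smul_mem _ _ (lie_mem_derivedSubspace (hHK h.2) (hχ.2.2 hx))

end Roots

/-! ### The triangular decomposition -/

section TriangularDecomposition

variable {g : Type*} [LieRing g] [LieAlgebra ℂ g] [FiniteDimensional ℂ g]
variable [LieAlgebra.IsSemisimple ℂ g] {H : LieSubalgebra ℂ g} [H.IsCartanSubalgebra]

/-- A finite set of characters has an element which is maximal with respect to adding roots of a
solvable subalgebra. -/
lemma exists_maximal_root {K : LieSubalgebra ℂ g} (hK : LieAlgebra.IsSolvable K)
    {X : Set (H → ℂ)} (hX : X.Finite) (hne : X.Nonempty) :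
    ∃ χ ∈ X, ∀ β ∈ rootsIn H K, χ + β ∉ X := by
  -- Here `r a b` says that `a` exceeds `b` by a nonempty sum of roots. Such sums are nonzero, so
  -- `r` is well-founded on a finite set, and an `r`-minimal element is the required maximal one.
  let r : X → X → Prop := fun a b => ∃ s : Multiset (H → ℂ), s ≠ 0 ∧
    (∀ χ ∈ s, χ ∈ rootsIn H K) ∧ a.1 = b.1 + s.sum
  have : Finite X := hX
  have : IsTrans X r := ⟨by
    rintro a b c ⟨s, hs, hsK, h1⟩ ⟨t, -, htK, h2⟩
    refine ⟨t + s, fun h => hs (add_eq_zero.1 h).2, fun χ hχ => ?_, ?_⟩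
    · exact (Multiset.mem_add.1 hχ).elim (htK χ) (hsK χ)
    · rw [h1, h2, Multiset.sum_add, add_assoc]⟩
  have : Std.Irrefl r := ⟨by
    rintro a ⟨s, hs, hsK, h1⟩
    exact sum_ne_zero_of_mem_rootsIn hK s hs hsK (left_eq_add.1 h1)⟩
  obtain ⟨χ₀, hχ₀⟩ := hne
  obtain ⟨χ, -, hχ⟩ := (Finite.wellFounded_of_trans_of_irrefl r).has_min Set.univ
    ⟨⟨χ₀, hχ₀⟩, trivial⟩
  refine ⟨χ, χ.2, fun β hβ hmem => hχ ⟨_, hmem⟩ trivial ⟨{β}, Multiset.singleton_ne_zero β, ?_, ?_⟩⟩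
  · intro χ hχ
    rw [Multiset.mem_singleton.1 hχ]
    exact hβ
  · rw [Multiset.sum_singleton]

/-- The Killing form pairs `[x, y]` nontrivially with some `w` of weight `-(α + β)`; by invariance
`[x, w]` is a nonzero vector of `K` of weight `-α`. -/
lemma neg_mem_rootsIn_of_lie_ne_zero {K : LieSubalgebra ℂ g} {α β : H → ℂ} (hα : α ≠ 0)
    (hβ : β ∈ rootsIn H K) (hαβ : -(α + β) ∈ rootsIn H K) {x y : g}
    (hx : x ∈ rootSubspace H β) (hy : y ∈ rootSubspace H α) (hxy : ⁅x, y⁆ ≠ 0) :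
    -α ∈ rootsIn H K := by
  have hmem : ⁅x, y⁆ ∈ rootSubspace H (α + β) := by
    rw [add_comm]
    exact lie_mem_rootSubspace hx hy
  obtain ⟨w, hw, hne⟩ : ∃ w ∈ rootSubspace H (-(α + β)), killingForm ℂ g ⁅x, y⁆ w ≠ 0 := by
    by_contra! hcon
    have h1 := LieAlgebra.mem_ker_killingForm_of_mem_rootSpace_of_forall_rootSpace_neg ℂ g H
      hmem hcon
    rw [LieAlgebra.IsKilling.ker_killingForm_eq_bot, Submodule.mem_bot] at h1
    exact hxy h1
  have hxw : ⁅x, w⁆ ≠ 0 := by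
    intro h0
    apply hne
    rw [← lie_skew, map_neg, LinearMap.neg_apply, LieModule.traceForm_apply_lie_apply, h0,
      map_zero, neg_zero]
  have hmem' : ⁅x, w⁆ ∈ rootSubspace H (-α) := by
    have h1 := lie_mem_rootSubspace hx hw
    rwa [show β + -(α + β) = -α by abel] at h1
  exact mem_rootsIn_of_mem (neg_ne_zero.2 hα) hmem' hxw
    (K.lie_mem (hβ.2.2 hx) (hαβ.2.2 hw))

/-- If some pair of opposite roots missed `B`, a maximal such root `α` could be adjoined to `B`
without losing solvability, contradicting the maximality of a Borel. -/
lemma mem_or_neg_mem_rootsIn {B : LieSubalgebra ℂ g} (hB : IsBorel B) (hHB : H ≤ B) {χ : H → ℂ}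
    (hχ : χ ≠ 0) (hχ' : rootSubspace H χ ≠ ⊥) : χ ∈ rootsIn H B ∨ -χ ∈ rootsIn H B := by
  by_contra hcon
  rw [not_or] at hcon
  have hsolv : LieAlgebra.IsSolvable B := hB.prop
  let X : Set (H → ℂ) := {χ | χ ∈ rootsIn H (⊤ : LieSubalgebra ℂ g) ∧
    χ ∉ rootsIn H B ∧ -χ ∉ rootsIn H B}
  obtain ⟨α, ⟨⟨hα0, hα1, -⟩, hα2, hα3⟩, hmax⟩ := exists_maximal_root hsolv (X := X)
    ((finite_rootsIn ⊤).subset fun χ hχ => hχ.1) ⟨χ, ⟨hχ, hχ', le_top⟩, hcon⟩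
  have hder := derivedSubspace_eq_rootSum hHB hsolv
  have hlie : ∀ x ∈ rootSum H (rootsIn H B), ∀ y ∈ rootSubspace H α,
      ⁅x, y⁆ ∈ rootSum H (rootsIn H B) := by
    intro x hx y hy
    refine lie_mem_of_mem_iSup (W := fun _ : Unit => rootSubspace H α) (fun β _ x hx y hy => ?_)
      hx (Submodule.mem_iSup_of_mem () hy)
    by_cases hxy : ⁅x, y⁆ = 0
    · rw [hxy]; exact zero_mem _
    have hmem : ⁅x, y⁆ ∈ rootSubspace H (α + β.1) := by
      rw [add_comm]
      exact lie_mem_rootSubspace hx hy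
    have hne : α + β.1 ≠ 0 := fun h => hα3 (by
      rw [← eq_neg_of_add_eq_zero_right h]
      exact β.2)
    refine rootSubspace_le_rootSum ?_ hmem
    by_contra hnot
    -- By maximality of `α`, the root `α + β` or its negative lies in `B`; the negative would force
    -- `-α` into `B`.
    refine hmax β.1 β.2 ⟨mem_rootsIn_of_mem hne hmem hxy trivial, hnot, fun hneg => hα3 ?_⟩
    exact neg_mem_rootsIn_of_lie_ne_zero hα0 β.2 hneg hx hy hxy
  have hαα : ∀ x ∈ rootSubspace H α, ∀ y ∈ rootSubspace H α, ⁅x, y⁆ = 0 := by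
    intro x hx y hy
    by_cases hx0 : x = 0
    · rw [hx0, zero_lie]
    obtain ⟨c, rfl⟩ := Submodule.mem_span_singleton.1
      (rootSubspace_le_of_mem hα0 hx hx0 (Submodule.mem_span_singleton_self x) hy)
    rw [lie_smul, lie_self, smul_zero]
  let S : Submodule ℂ g := rootSum H (rootsIn H B) ⊔ rootSubspace H α
  have hBα : ∀ x ∈ B, ∀ y ∈ rootSubspace H α, ⁅x, y⁆ ∈ S := by
    intro x hx y hy
    rw [← LieSubalgebra.mem_toSubmodule, ← sup_rootSum_rootsIn hHB] at hx
    obtain ⟨h, hh, x, hxR, rfl⟩ := Submodule.mem_sup.1 hx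
    rw [add_lie, show ⁅h, y⁆ = α ⟨h, hh⟩ • y from lie_of_mem_rootSubspace hy ⟨h, hh⟩]
    exact add_mem (Submodule.mem_sup_right (Submodule.smul_mem _ _ hy))
      (Submodule.mem_sup_left (hlie x hxR y hy))
  have hKS : ∀ x ∈ B.toSubmodule ⊔ rootSubspace H α, ∀ y ∈ B.toSubmodule ⊔ rootSubspace H α,
      ⁅x, y⁆ ∈ S := by
    intro x hx y hy
    obtain ⟨x, hx', a, ha, rfl⟩ := Submodule.mem_sup.1 hx
    obtain ⟨y, hy', b, hb, rfl⟩ := Submodule.mem_sup.1 hy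
    rw [add_lie, lie_add, lie_add, hαα a ha b hb, add_zero, ← lie_skew a y]
    refine add_mem (add_mem (Submodule.mem_sup_left ?_) (hBα x hx' b hb))
      (neg_mem (hBα y hy' a ha))
    rw [← hder]
    exact lie_mem_derivedSubspace hx' hy'
  have hSK : S ≤ B.toSubmodule ⊔ rootSubspace H α :=
    sup_le_sup_right (rootSum_le.2 fun χ hχ => hχ.2.2) _
  let K : LieSubalgebra ℂ g :=
    { B.toSubmodule ⊔ rootSubspace H α with
      lie_mem' := fun {x y} hx hy => hSK (hKS x hx y hy) }
  have hBK : B ≤ K := fun x hx => Submodule.mem_sup_left (S := B.toSubmodule) hx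
  have hK : LieAlgebra.IsSolvable K := by
    refine isSolvable_of_lie_mem (L := B) S hKS fun x hx y hy => ?_
    obtain ⟨x, hx', a, ha, rfl⟩ := Submodule.mem_sup.1 hx
    obtain ⟨y, hy', b, hb, rfl⟩ := Submodule.mem_sup.1 hy
    have hle : rootSum H (rootsIn H B) ≤ B.toSubmodule := rootSum_le.2 fun χ hχ => hχ.2.2
    rw [add_lie, lie_add, lie_add, hαα a ha b hb, add_zero, ← lie_skew a y]
    exact add_mem (add_mem (B.lie_mem (hle hx') (hle hy')) (hle (hlie x hx' b hb)))
      (neg_mem (hle (hlie y hy' a ha)))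
  have hKB : K ≤ B := hB.le_of_ge hK hBK
  exact hα2 ⟨hα0, hα1, fun x hx => hKB (Submodule.mem_sup_right (S := B.toSubmodule) hx)⟩

lemma exists_root_vectors (K : LieSubalgebra ℂ g) :
    ∃ (p : ℕ) (f : Fin p → g) (w : Fin p → Module.Dual ℂ H), (∀ i, ⇑(w i) ∈ rootsIn H K) ∧
      (∀ (h : H) i, ⁅(h : g), f i⁆ = w i h • f i) ∧ LinearIndependent ℂ f ∧
      Submodule.span ℂ (Set.range f) = rootSum H (rootsIn H K) := by
  have : Finite (rootsIn H K) := finite_rootsIn K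
  obtain ⟨p, ⟨E⟩⟩ := Finite.exists_equiv_fin (rootsIn H K)
  have hex : ∀ i, ∃ (x : g) (w : Module.Dual ℂ H), x ∈ rootSubspace H (E.symm i) ∧ x ≠ 0 ∧
      ⇑w = (E.symm i).1 := by
    intro i
    obtain ⟨x, hx, hx0⟩ := (Submodule.ne_bot_iff _).1 (E.symm i).2.2.1
    obtain ⟨α, hα⟩ := exists_weight (E.symm i).2.2.1
    exact ⟨x, α.toLinear, hx, hx0, hα⟩
  choose f w hf hf0 hw using hex
  refine ⟨p, f, w, fun i => ?_, fun h i => ?_, ?_, le_antisymm ?_ ?_⟩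
  · rw [hw]
    exact (E.symm i).2
  · rw [hw]
    exact lie_of_mem_rootSubspace (hf i) h
  · refine iSupIndep.linearIndependent _ (iSupIndep_rootSubspace.comp
      (Subtype.val_injective.comp E.symm.injective)) hf hf0
  · rw [Submodule.span_le]
    rintro _ ⟨i, rfl⟩
    exact rootSubspace_le_rootSum (E.symm i).2 (hf i)
  · refine rootSum_le.2 fun χ hχ => ?_
    have h1 := rootSubspace_le_of_mem (E.symm (E ⟨χ, hχ⟩)).2.1 (hf (E ⟨χ, hχ⟩)) (hf0 _)
      (Submodule.subset_span (R := ℂ) (Set.mem_range_self _))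
    rwa [Equiv.symm_apply_apply] at h1

/-- Two comparable exponents of equal weight differ by a sum of roots equal to zero, hence coincide.
So the fibre is an antichain in `ℕ^q`, finite by Dickson's lemma. -/
lemma finite_monWeight {K : LieSubalgebra ℂ g} (hK : LieAlgebra.IsSolvable K) {q : ℕ}
    {w : Fin q → Module.Dual ℂ H} (hw : ∀ i, ⇑(w i) ∈ rootsIn H K) (μ : Module.Dual ℂ H) :
    {δ | monWeight w δ = μ}.Finite := by
  refine IsAntichain.finite_of_partiallyWellOrderedOn (r := (· ≤ ·)) ?_
    (Set.isPWO_of_wellQuasiOrderedLE _)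
  intro δ hδ δ' hδ' hne hle
  let s : Multiset (H → ℂ) := ∑ i, (δ' i - δ i) • {⇑(w i)}
  refine sum_ne_zero_of_mem_rootsIn hK s ?_ ?_ ?_
  · intro h0
    apply hne
    funext i
    have h1 := (Finset.sum_eq_zero_iff.1 h0) i (Finset.mem_univ i)
    have h2 := congrArg Multiset.card h1
    rw [Multiset.card_nsmul, Multiset.card_singleton, Multiset.card_zero, mul_one] at h2
    exact le_antisymm (hle i) (Nat.sub_eq_zero_iff_le.1 h2)
  · intro χ hχ
    obtain ⟨i, -, hi⟩ := Multiset.mem_sum.1 hχ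
    rw [Multiset.mem_singleton.1 (Multiset.mem_of_mem_nsmul hi)]
    exact hw i
  · funext h
    have h1 : monWeight w δ h = monWeight w δ' h := by rw [hδ, hδ']
    rw [monWeight, monWeight, LinearMap.sum_apply, LinearMap.sum_apply, ← sub_eq_zero,
      ← Finset.sum_sub_distrib] at h1
    rw [Multiset.sum_sum, Finset.sum_apply, Pi.zero_apply, ← neg_eq_zero,
      ← Finset.sum_neg_distrib, ← h1]
    refine Finset.sum_congr rfl fun i _ => ?_
    rw [Multiset.sum_nsmul, Multiset.sum_singleton, Pi.smul_apply, LinearMap.smul_apply,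
      LinearMap.smul_apply, nsmul_eq_mul, nsmul_eq_mul, nsmul_eq_mul, Nat.cast_sub (hle i)]
    ring

theorem nonempty_triangular {B Bop : LieSubalgebra ℂ g} (hB : IsBorel B) (hHB : H ≤ B)
    (hBop : IsOppositeBorel H B Bop) : Nonempty (Triangular H B Bop) := by
  have hHBop : H ≤ Bop := hBop.2 ▸ inf_le_right
  have hsB : LieAlgebra.IsSolvable B := hB.prop
  have hsBop : LieAlgebra.IsSolvable Bop := hBop.1.prop
  obtain ⟨p, f, wf, -, hf, indep_f, span_f⟩ := exists_root_vectors (H := H) Bop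
  obtain ⟨q, e, we, hwe, he, indep_e, span_e⟩ := exists_root_vectors (H := H) B
  have hdB := derivedSubspace_eq_rootSum hHB hsB
  have hdBop := derivedSubspace_eq_rootSum hHBop hsBop
  have hzero : rootSum H {0} = H.toSubmodule := by
    rw [rootSum, iSup_subtype, iSup_singleton, rootSubspace_zero]
  have hdisj : ∀ K : LieSubalgebra ℂ g, Disjoint {0} (rootsIn H K) := fun K =>
    Set.disjoint_singleton_left.2 fun h => h.1 rfl
  have hunion : ∀ A A' : Set (H → ℂ), rootSum H (A ∪ A') = rootSum H A ⊔ rootSum H A' :=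
    fun A A' => by simp only [rootSum, iSup_subtype, iSup_union]
  have hopp : Disjoint (rootsIn H B) (rootsIn H Bop) := by
    refine Set.disjoint_left.2 fun χ hχ hχ' => hχ.2.1 ?_
    have h1 : rootSubspace H χ ≤ rootSubspace H 0 := by
      rw [rootSubspace_zero]
      exact fun x hx => hBop.2.le ⟨hχ.2.2 hx, hχ'.2.2 hx⟩
    exact (iSupIndep_rootSubspace.pairwiseDisjoint hχ.1).eq_bot_of_le h1
  have htop : H.toSubmodule ⊔ rootSum H (rootsIn H B) ⊔ rootSum H (rootsIn H Bop) = ⊤ := by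
    rw [eq_top_iff, ← iSup_rootSubspace (H := H)]
    refine iSup_le fun χ => ?_
    by_cases hχ0 : χ = 0
    · rw [hχ0, rootSubspace_zero]
      exact le_sup_of_le_left le_sup_left
    by_cases hχ1 : rootSubspace H χ = ⊥
    · rw [hχ1]
      exact bot_le
    by_cases hχ : χ ∈ rootsIn H B
    · exact le_sup_of_le_left (le_sup_of_le_right (rootSubspace_le_rootSum hχ))
    -- The dichotomy is used for both Borels: a root outside `B` has its negative in `B`, which is
    -- then outside `Bop`, so the root itself lies in `Bop`.
    · have hneg := (mem_or_neg_mem_rootsIn hB hHB hχ0 hχ1).resolve_left hχ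
      have hχ' := (mem_or_neg_mem_rootsIn hBop.1 hHBop hχ0 hχ1).resolve_right
        (Set.disjoint_left.1 hopp hneg)
      exact le_sup_of_le_right (rootSubspace_le_rootSum hχ')
  exact ⟨{ p := p, q := q, f := f, e := e, wf := wf, we := we, lie_f := hf, lie_e := he,
           indep_f := indep_f, indep_e := indep_e
           span_f := by rw [span_f, hdBop]
           span_e := by rw [span_e, hdB]
           sup_B := by rw [hdB, sup_rootSum_rootsIn hHB]
           disj_B := by
            rw [hdB, ← hzero]
            exact disjoint_rootSum (hdisj B)
           sup_Bop := by rw [hdBop, sup_rootSum_rootsIn hHBop]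
           disj_Bop := by
            rw [hdBop, ← hzero]
            exact disjoint_rootSum (hdisj Bop)
           compl_f := by
            rw [hdBop, ← sup_rootSum_rootsIn hHB]
            refine ⟨?_, codisjoint_iff.2 (by rw [sup_comm, htop])⟩
            rw [← hzero, ← hunion]
            exact disjoint_rootSum (Set.disjoint_union_right.2 ⟨(hdisj Bop).symm, hopp.symm⟩)
           compl_e := by
            rw [hdB, ← sup_rootSum_rootsIn hHBop]
            refine ⟨?_, codisjoint_iff.2 (by
              rw [sup_left_comm, ← sup_assoc, htop])⟩
            rw [← hzero, ← hunion]
            exact disjoint_rootSum (Set.disjoint_union_right.2 ⟨(hdisj B).symm, hopp⟩)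
           finite_e := finite_monWeight hsB hwe }⟩

end TriangularDecomposition

end DeformedO

end

/-! ### The main theorem. -/

theorem mainTheorem10
    {g : Type*} [LieRing g] [LieAlgebra ℂ g] [FiniteDimensional ℂ g]
    [LieAlgebra.IsSemisimple ℂ g]
    (H : LieSubalgebra ℂ g) [H.IsCartanSubalgebra]
    (B Bop : LieSubalgebra ℂ g) (hB : DeformedO.IsBorel B) (hHB : H ≤ B)
    (hBop : DeformedO.IsOppositeBorel H B Bop)
    {T : Type*} [CommRing T] [Algebra ℂ T] (φ : SymmetricAlgebra ℂ H →ₐ[ℂ] T)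
    {M : Type*} [AddCommGroup M] [Module ℂ M] [Module T M] [IsScalarTower ℂ T M]
    (ρM : g →ₗ⁅ℂ⁆ Module.End T M) (hM : DeformedO.InO B φ ρM)
    {N : Type*} [AddCommGroup N] [Module ℂ N] [Module T N] [IsScalarTower ℂ T N]
    (ρN : g →ₗ⁅ℂ⁆ Module.End T N) (hN : DeformedO.InO B φ ρN)
    {P : Type*} [AddCommGroup P] [Module ℂ P] [Module T P] [IsScalarTower ℂ T P]
    (ρP : g →ₗ⁅ℂ⁆ Module.End T P) (hP : DeformedO.InO B φ ρP)
    (hPflag : DeformedO.HasDeltaFlag B φ ρP) (hMP : DeformedO.IsDirectSummand ρM ρP)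
    {Q : Type*} [AddCommGroup Q] [Module ℂ Q] [Module T Q] [IsScalarTower ℂ T Q]
    (ρQ : g →ₗ⁅ℂ⁆ Module.End T Q) (hQ : DeformedO.InO B φ ρQ)
    (hQflag : DeformedO.HasNablaFlag Bop φ ρQ) (hNQ : DeformedO.IsDirectSummand ρN ρQ) :
    Module.Finite T (DeformedO.bimodHom ρM ρN) ∧
    Module.Projective T (DeformedO.bimodHom ρM ρN) ∧
    ∀ (T' : Type*) [CommRing T'] [Algebra ℂ T'] [Algebra T T'] [IsScalarTower ℂ T T'],
      DeformedO.InO B (DeformedO.baseChangeStr T' φ) (DeformedO.baseChangeRep T' ρM) ∧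
      DeformedO.InO B (DeformedO.baseChangeStr T' φ) (DeformedO.baseChangeRep T' ρN) ∧
      Function.Bijective (DeformedO.homBaseChange T' ρM ρN) := by
  obtain ⟨D⟩ := DeformedO.nonempty_triangular hB hHB hBop
  obtain ⟨hfin, hfree, hbij⟩ := DeformedO.bimodHom_of_flags D hP.2 hPflag hQ.2 hQflag
  obtain ⟨h1, h2⟩ := DeformedO.bimodHom_of_isDirectSummand hMP hNQ
  exact ⟨h1, h2, fun T' _ _ _ _ => ⟨hM.baseChange T', hN.baseChange T',
    DeformedO.homBaseChange_bijective_of_isDirectSummand T' hMP hNQ (hbij T')⟩⟩
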